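/- **Notation.** For $f:\mathbb N\to\mathbb C$, a real number $X$ and coprime integers $a$ and $q\ge 1$, put $$\Delta(f,X;q,a)=\sum_{\substack{n\le X\\ n\equiv a\ (\mathrm{mod}\ q)}} f(n)-\frac1{\varphi(q)}\sum_{\substack{n\le X\\ (n,q)=1}} f(n).$$ For a multiplicative function $f:\mathbb N\to\mathbb C$ with Dirichlet series $F(s)=\sum_{n\ge1} f(n)n^{-s}$, define $\Lambda_f$ by $-F'(s)/F(s)=\sum_{n\ge 1}\Lambda_f(n)n^{-s}$ (as an identity of formal Dirichlet series, i.e. $\sum_{d\mid n}\Lambda_f(d)f(n/d)=f(n)\log n$ for all $n\ge1$). Let $\mathcal C$ be the class of multiplicative functions $f$ with $|\Lambda_f(n)|\le\Lambda(n)$ for all $n\ge 1$, where $\Lambda$ is the von Mangoldt function. Let $1_{\mathcal P}$ be the indicator function of the set of primes. **Theorem.** Fix $A\ge 0$, $B>A+5$, $\gamma>2A+6$ and constants $C_1,C_2$. There is a constant $K$, depending only on $A,B,\gamma,C_1,C_2$, such that the following holds for all real $x\ge 2$ and all $f\in\mathcal C$. Let $Q=x^{1/2}/(\log x)^B$ and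 $y=x/(\log x)^\gamma$. Assume that $$\sum_{q\le Q}\ \max_{a:\,(a,q)=1}|\Delta(f\cdot 1_{\mathcal P},X;q,a)|\le C_1\,\frac{X}{(\log x)^A\log(x/y)}$$ for all $X$ with $y\le X\le x$, and that $$|\Delta(f,X;q,a)|\le C_2\,\frac{X}{(\log x)^{A+2B}}$$ for all $q\ge1$, all $a$ with $(a,q)=1$, and all $X$ with $x^{1/2}\le X\le x$. Then $$\sum_{q\le Q}\ \max_{a:\,(a,q)=1}|\Delta(f,x;q,a)|\le K\,\frac{x}{(\log x)^{A-1}}.$$ (For $x=e$, where $\log(x/y)=0$, the right-hand side of the first assumption is read as $0$; both sides are then $0$.) -/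

import Mathlib

noncomputable section

namespace BVMult

/-- `Lam` is the arithmetic function `Λ_f`, i.e. `-F'(s)/F(s) = ∑ Λ_f(n) n^{-s}` where
`F(s) = ∑ f(n) n^{-s}`. As an identity between the coefficients of the Dirichlet series
`(∑ Λ_f(n) n^{-s}) F(s)` and `-F'(s) = ∑ f(n) (log n) n^{-s}` this says that the Dirichlet
convolution of `Λ_f` and `f` is `f · log`. If `f(1) = 1`, exactly one `Lam` has this property. -/
def IsLambda (f Lam : ArithmeticFunction ℂ) : Prop :=
  ∀ n : ℕ, (Lam * f) n = f n * (Real.log n : ℂ)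

theorem existsUnique_isLambda (f : ArithmeticFunction ℂ) (hf : f 1 = 1) :
    ∃! Lam : ArithmeticFunction ℂ, IsLambda f Lam := by
  obtain ⟨u, hu⟩ : IsUnit f :=
    ArithmeticFunction.isUnit_iff_isUnit_apply_one.mpr (by rw [hf]; exact isUnit_one)
  let g : ArithmeticFunction ℂ := ⟨fun n => f n * (Real.log n : ℂ), by simp⟩
  have key : ∀ L : ArithmeticFunction ℂ, IsLambda f L ↔ L * f = g := fun L =>
    ⟨fun h => ArithmeticFunction.ext h, fun h n => by rw [h]; rfl⟩
  refine ⟨g * (↑u⁻¹ : ArithmeticFunction ℂ), (key _).mpr ?_, fun L hL => ?_⟩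
  · rw [← hu, mul_assoc, Units.inv_mul, mul_one]
  · rw [← (key L).mp hL, ← hu, mul_assoc, Units.mul_inv, mul_one]

/-- The class `𝒞` of multiplicative functions `f` with `|Λ_f(n)| ≤ Λ(n)` for all `n ≥ 1`. -/
def ClassC (f : ArithmeticFunction ℂ) : Prop :=
  f.IsMultiplicative ∧
    ∃ Lam : ArithmeticFunction ℂ, IsLambda f Lam ∧
      ∀ n : ℕ, 1 ≤ n → ‖Lam n‖ ≤ ArithmeticFunction.vonMangoldt n

/-- `f · 1_𝒫`: the function `f` restricted to the primes. -/
def onPrimes (f : ℕ → ℂ) : ℕ → ℂ :=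
  Set.indicator {p : ℕ | p.Prime} f

/-- `Δ(f, X; q, a)` for a modulus `q` and a reduced residue class `a` modulo `q`. -/
def Delta (f : ℕ → ℂ) (X : ℝ) (q : ℕ) (a : (ZMod q)ˣ) : ℂ :=
  (∑ n ∈ (Finset.Icc 1 ⌊X⌋₊).filter (fun n : ℕ => (n : ZMod q) = (a : ZMod q)), f n)
    - (1 / (q.totient : ℂ)) *
      ∑ n ∈ (Finset.Icc 1 ⌊X⌋₊).filter (fun n : ℕ => n.Coprime q), f n

/-- `∑_{q ≤ Q} max_{(a,q)=1} |Δ(f, X; q, a)|`. For each `q ≥ 1` the supremum is over the finite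
nonempty set of reduced residue classes, so it is a maximum. -/
def bvSum (f : ℕ → ℂ) (X Q : ℝ) : ℝ :=
  ∑ q ∈ Finset.Icc 1 ⌊Q⌋₊, ⨆ a : (ZMod q)ˣ, ‖Delta f X q a‖

end BVMult

end

noncomputable section

namespace BVMult

open Finset

/-! Write `L = log x`, `R = L^B`, and split `f = f_s + f_r`, where `f_s` lives on the integers with
all prime factors at most `y` (`smoothPart`) and `f_r` on those with a prime factor exceeding `y`
(`roughPart`). Expanding `Δ` in characters modulo `q` and sorting them by conductor, at most `R` or
larger, gives `Δ(f) = small(f) + large(f_s) + Δ(f_r) - small(f_r)`, because `large(f_r) = Δ(f_r) -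
small(f_r)`. The four terms are bounded separately and combined in `bvSum_le_of_parts`.

The term `small(f)`: Möbius inversion over conductors turns it into discrepancies of `f`, restricted
to integers coprime to `q`, to moduli `d ≤ R`. That restriction is the convolution of `f` with a
bounded function supported on integers composed of primes dividing `q`, so the pointwise hypothesis
on `f` carries over (`exists_norm_Delta_coprimePart_le`).

The term `large(f_s)`: the large sieve is used (`multiplicative_large_sieve`,
`primMean_hyperbola_le`). A bilinear structure comes from `Λ_f`: if `w(n)` is `(log x)⁻¹` times the
sum of `v_p(n) log p` over primes `p` in `(Z, y]`, then `f w log x` is the convolution of `Λ_f`,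
restricted to powers of those primes, with `f`. As `1 - w` is small for most smooth `n`, the
identity `1 = w ∑_{j<J} (1-w)^j + (1-w)^J` writes `f_s` as bilinear sums plus a negligible
remainder; additivity of `w` separates the variables in `(1-w)^j` by the binomial theorem. This is
`primMean_smooth_le`. It saves `L^A` on each mean, and the sum of `1/φ(k)` over `k ≤ Q` then loses
one logarithm, whence the exponent `A - 1`.

The term `Δ(f_r)`: each `n` with `f_r(n) ≠ 0` is uniquely `m p` with `p > y` prime and `m < x/y`.
For fixed `m` the hypothesis on primes applies at `x/m`, and summing over `m` costs a factor of
order `log(x/y)`, exactly what the hypothesis saves (`sum_primeDiscrepancy_le`).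

The term `small(f_r)`: the same prime discrepancies occur, for moduli `d ≤ R`, with losses of order
`log x` and `log log x` from totient sums. The factor `log log x` is regained because small moduli
carry a small share of the total: the discrepancy modulo `d` is at most `p - 1` times that modulo `d
p`, so the sum over `d ≤ R` times the sum of `1/(p-1)` over `R < p ≤ Q/R` is at most the sum over
all moduli up to `Q` (`sum_maxDelta_mul_sum_prime_le`). The sum over these primes has order `log log
x`. -/

/-! ### Additive characters, geometric sums and well-spaced points -/

/-- The additive character `θ ↦ exp(2πiθ)` of `ℝ`. -/
def ee (θ : ℝ) : ℂ := Complex.exp (Complex.I * ((2 * Real.pi * θ : ℝ) : ℂ))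

lemma ee_add (a b : ℝ) : ee (a + b) = ee a * ee b := by
  unfold ee
  rw [← Complex.exp_add]
  congr 1
  push_cast
  ring

lemma norm_ee (a : ℝ) : ‖ee a‖ = 1 := Complex.norm_exp_I_mul_ofReal _

lemma conj_ee (a : ℝ) : (starRingEnd ℂ) (ee a) = ee (-a) := by
  unfold ee
  rw [← Complex.exp_conj, map_mul, Complex.conj_I, Complex.conj_ofReal]
  congr 1
  push_cast
  ring

lemma ee_intCast (k : ℤ) : ee k = 1 := by
  unfold ee
  rw [Complex.exp_eq_one_iff]
  exact ⟨k, by push_cast; ring⟩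

lemma ee_natCast_mul (n : ℕ) (θ : ℝ) : ee (n * θ) = ee θ ^ n := by
  unfold ee
  rw [← Complex.exp_nat_mul]
  congr 1
  push_cast
  ring

/-- The norm equals `2|sin πs|`, and Jordan's inequality bounds the sine from below. -/
lemma four_mul_abs_le_norm_ee_sub_one {s : ℝ} (hs : |s| ≤ 1 / 2) : 4 * |s| ≤ ‖ee s - 1‖ := by
  unfold ee
  rw [Complex.norm_exp_I_mul_ofReal_sub_one, Real.norm_eq_abs, abs_mul, abs_two]
  have h1 : |2 * Real.pi * s / 2| ≤ Real.pi / 2 := by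
    rw [show 2 * Real.pi * s / 2 = Real.pi * s by ring, abs_mul, abs_of_pos Real.pi_pos]
    nlinarith [Real.pi_pos]
  have h := Real.mul_abs_le_abs_sin h1
  rw [show 2 * Real.pi * s / 2 = Real.pi * s by ring, abs_mul, abs_of_pos Real.pi_pos] at h
  have : 2 / Real.pi * (Real.pi * |s|) = 2 * |s| := by
    field_simp
  rw [this] at h
  rw [show 2 * Real.pi * s / 2 = Real.pi * s by ring]
  linarith

/-- The geometric sum `∑_{m < K} e(mθ)`. -/
def geomE (K : ℕ) (θ : ℝ) : ℂ := ∑ m ∈ range K, ee (m * θ)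

lemma norm_geomE_le (K : ℕ) (θ : ℝ) : ‖geomE K θ‖ ≤ K := by
  unfold geomE
  refine (norm_sum_le _ _).trans ?_
  simp [norm_ee]

lemma norm_geomE_mul_le (K : ℕ) (θ : ℝ) : ‖geomE K θ‖ * (2 * |θ - round θ|) ≤ 1 := by
  have h1 : ee θ = ee (θ - round θ) := by
    have : θ = (θ - round θ) + round θ := by ring
    conv_lhs => rw [this, ee_add, ee_intCast, mul_one]
  have h2 : geomE K θ * (ee θ - 1) = ee θ ^ K - 1 := by
    unfold geomE
    simp_rw [ee_natCast_mul]
    exact geom_sum_mul _ _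
  have h3 : ‖geomE K θ‖ * ‖ee θ - 1‖ ≤ 2 := by
    rw [← norm_mul, h2]
    refine (norm_sub_le _ _).trans ?_
    rw [norm_pow, norm_ee]
    norm_num
  have h4 := four_mul_abs_le_norm_ee_sub_one (abs_sub_round θ)
  rw [← h1] at h4
  nlinarith [mul_le_mul_of_nonneg_left h4 (norm_nonneg (geomE K θ))]

lemma sum_inv_sq_le_two (m : ℕ) : ∑ k ∈ Icc 1 m, ((k : ℝ) ^ 2)⁻¹ ≤ 2 := by
  have h := sum_Ioo_inv_sq_le (α := ℝ) 0 (m + 1)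
  have e : Ioo 0 (m + 1) = Icc 1 m := by ext; simp; omega
  rw [e] at h
  simpa using h

/-- Reals of absolute value at least `δ`, of constant sign and `δ`-spaced. -/
lemma sum_inv_sq_spaced {ι : Type*} (s : Finset ι) (t : ι → ℝ) {δ : ℝ} (hδ : 0 < δ)
    (h1 : ∀ i ∈ s, δ ≤ t i) (h2 : ∀ i ∈ s, ∀ j ∈ s, i ≠ j → δ ≤ |t i - t j|) :
    ∑ i ∈ s, (t i ^ 2)⁻¹ ≤ 2 / δ ^ 2 := by
  classical
  -- Spacing `δ` puts at most one point in each cell `[kδ, (k+1)δ)`, so the points are compared with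
  -- the `kδ`, `k ≥ 1`.
  have hinj : Set.InjOn (fun i => ⌊t i / δ⌋₊) s := by
    intro i hi j hj hij
    by_contra hne
    have h := h2 i hi j hj hne
    have hi0 : 0 ≤ t i / δ := div_nonneg (hδ.le.trans (h1 i hi)) hδ.le
    have hj0 : 0 ≤ t j / δ := div_nonneg (hδ.le.trans (h1 j hj)) hδ.le
    have a1 := Nat.floor_le hi0
    have a2 := Nat.lt_floor_add_one (t i / δ)
    have b1 := Nat.floor_le hj0
    have b2 := Nat.lt_floor_add_one (t j / δ)
    simp only at hij
    rw [hij] at a1 a2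
    have : |t i / δ - t j / δ| < 1 := by rw [abs_lt]; constructor <;> linarith
    rw [← sub_div, abs_div, abs_of_pos hδ, div_lt_one hδ] at this
    linarith
  have hle : ∀ i ∈ s, (t i ^ 2)⁻¹ ≤ (((⌊t i / δ⌋₊ : ℕ) : ℝ) ^ 2)⁻¹ / δ ^ 2 := by
    intro i hi
    have hi0 : 0 ≤ t i / δ := div_nonneg (hδ.le.trans (h1 i hi)) hδ.le
    have a1 := Nat.floor_le hi0
    have a3 : 1 ≤ ⌊t i / δ⌋₊ := Nat.one_le_floor_iff _ |>.mpr ((one_le_div hδ).mpr (h1 i hi))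
    have a3' : (1 : ℝ) ≤ (⌊t i / δ⌋₊ : ℕ) := by exact_mod_cast a3
    rw [le_div_iff₀ hδ] at a1
    rw [← one_div, ← one_div, div_div, ← mul_pow]
    apply one_div_le_one_div_of_le (by positivity)
    gcongr
  refine (sum_le_sum hle).trans ?_
  rw [← sum_div]
  gcongr
  rw [← sum_image (f := fun k : ℕ => ((k : ℝ) ^ 2)⁻¹) hinj]
  refine le_trans (sum_le_sum_of_subset_of_nonneg (t := Icc 1 ((s.image fun i => ⌊t i / δ⌋₊).sup id))
    ?_ (fun _ _ _ => by positivity)) (sum_inv_sq_le_two _)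
  intro k hk
  rw [mem_Icc]
  refine ⟨?_, le_sup (f := id) hk⟩
  obtain ⟨i, hi, rfl⟩ := mem_image.mp hk
  exact Nat.one_le_floor_iff _ |>.mpr ((one_le_div hδ).mpr (h1 i hi))

/-- The geometric sum at distance `t` from the nearest integer is at most `1/(2|t|)`; its square is
summable over `δ`-spaced points. The squares, rather than first powers, are what avoid a logarithm
here. -/
lemma sum_norm_geomE_sq_le {ι : Type*} (s : Finset ι) (α : ι → ℝ) {δ : ℝ}
    (hδ : 0 < δ) (hsp : ∀ i ∈ s, ∀ j ∈ s, i ≠ j → ∀ k : ℤ, δ ≤ |α i - α j - k|)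
    (K : ℕ) (i : ι) (hi : i ∈ s) :
    ∑ j ∈ s, ‖geomE K (α i - α j)‖ ^ 2 ≤ K ^ 2 + 1 / δ ^ 2 := by
  classical
  set t : ι → ℝ := fun j => (α i - α j) - round (α i - α j) with ht
  have hG : ∀ j ∈ s, j ≠ i → ‖geomE K (α i - α j)‖ ^ 2 ≤ (1 / 4) * (t j ^ 2)⁻¹ := by
    intro j hj hji
    have h1 := norm_geomE_mul_le K (α i - α j)
    have h2 : δ ≤ |t j| := hsp i hi j hj (Ne.symm hji) _
    have h3 : 0 < |t j| := hδ.trans_le h2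
    have h4 : ‖geomE K (α i - α j)‖ ≤ 1 / (2 * |t j|) := by
      rw [le_div_iff₀ (by positivity)]; exact h1
    calc ‖geomE K (α i - α j)‖ ^ 2 ≤ (1 / (2 * |t j|)) ^ 2 := by gcongr
      _ = (1 / 4) * (t j ^ 2)⁻¹ := by
        rw [div_pow, mul_pow, sq_abs]; ring_nf
  have hsep : ∀ j ∈ s, ∀ l ∈ s, j ≠ l → δ ≤ |t j - t l| := by
    intro j hj l hl hjl
    have := hsp l hl j hj (Ne.symm hjl) (round (α i - α j) - round (α i - α l))
    convert this using 2
    simp only [ht]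
    push_cast
    ring
  rw [← add_sum_erase s _ hi]
  have e1 : ‖geomE K (α i - α i)‖ ^ 2 ≤ (K : ℝ) ^ 2 := by
    gcongr; exact norm_geomE_le _ _
  have e2 : ∑ j ∈ s.erase i, ‖geomE K (α i - α j)‖ ^ 2 ≤
      (1 / 4) * ∑ j ∈ s.erase i, (t j ^ 2)⁻¹ := by
    rw [mul_sum]
    exact sum_le_sum fun j hj => hG j (mem_of_mem_erase hj) (ne_of_mem_erase hj)
  have e3 : ∑ j ∈ s.erase i, (t j ^ 2)⁻¹ ≤ 4 / δ ^ 2 := by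
    -- Positive and negative representatives each contribute `2/δ²`; with the factor `1/4` this
    -- totals `1/δ²`.
    rw [← sum_filter_add_sum_filter_not (s.erase i) (fun j => 0 ≤ t j)]
    have p1 : ∑ j ∈ (s.erase i).filter (fun j => 0 ≤ t j), (t j ^ 2)⁻¹ ≤ 2 / δ ^ 2 := by
      refine sum_inv_sq_spaced _ t hδ ?_ ?_
      · intro j hj
        rw [mem_filter, mem_erase] at hj
        have := hsp i hi j hj.1.2 (Ne.symm hj.1.1) (round (α i - α j))
        rwa [show α i - α j - (round (α i - α j) : ℤ) = t j from rfl, abs_of_nonneg hj.2] at this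
      · intro j hj l hl hjl
        rw [mem_filter, mem_erase] at hj hl
        exact hsep j hj.1.2 l hl.1.2 hjl
    have p2 : ∑ j ∈ (s.erase i).filter (fun j => ¬ 0 ≤ t j), (t j ^ 2)⁻¹ ≤ 2 / δ ^ 2 := by
      have := sum_inv_sq_spaced ((s.erase i).filter (fun j => ¬ 0 ≤ t j)) (fun j => - t j) hδ ?_ ?_
      · simpa using this
      · intro j hj
        rw [mem_filter, mem_erase] at hj
        have := hsp i hi j hj.1.2 (Ne.symm hj.1.1) (round (α i - α j))
        rwa [show α i - α j - (round (α i - α j) : ℤ) = t j from rfl,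
          abs_of_neg (not_le.mp hj.2)] at this
      · intro j hj l hl hjl
        rw [mem_filter, mem_erase] at hj hl
        have := hsep l hl.1.2 j hj.1.2 (Ne.symm hjl)
        convert this using 2
        ring
    calc _ ≤ 2 / δ ^ 2 + 2 / δ ^ 2 := add_le_add p1 p2
      _ = 4 / δ ^ 2 := by ring
  have e4 : (1 / 4 : ℝ) * (4 / δ ^ 2) = 1 / δ ^ 2 := by ring
  linarith

/-! ### The additive large sieve -/

/-- Dual form of the additive large sieve. -/
lemma additive_large_sieve_dual {ι : Type*} (s : Finset ι) (α : ι → ℝ) {δ : ℝ}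
    (hδ : 0 < δ) (hsp : ∀ i ∈ s, ∀ j ∈ s, i ≠ j → ∀ k : ℤ, δ ≤ |α i - α j - k|)
    {N M : ℕ} (hM : 0 < M) (hNM : N ≤ M) (hδM : 1 / δ ≤ M) (b : ι → ℂ) :
    ∑ n ∈ range N, ‖∑ i ∈ s, b i * ee (n * α i)‖ ^ 2 ≤ 5 * M * ∑ i ∈ s, ‖b i‖ ^ 2 := by
  set T : ℝ → ℂ := fun u => ∑ i ∈ s, b i * ee (u * α i) with hT
  -- Averaging over shifts: each `n < N` is `m - m'` for every `m' < M`, with `m = n + m' < 2M`.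
  -- Expanding the double sum produces the nonnegative kernel `|geomE|²` with quadratic decay.
  have hlow : (M : ℝ) * ∑ n ∈ range N, ‖T n‖ ^ 2 ≤
      ∑ m' ∈ range (2 * M), ∑ m ∈ range (2 * M), ‖T ((m : ℝ) - m')‖ ^ 2 := by
    calc (M : ℝ) * ∑ n ∈ range N, ‖T n‖ ^ 2
        = ∑ m' ∈ range M, ∑ n ∈ range N, ‖T n‖ ^ 2 := by simp
      _ ≤ ∑ m' ∈ range M, ∑ m ∈ range (2 * M), ‖T ((m : ℝ) - m')‖ ^ 2 := by
        refine sum_le_sum fun m' hm' => ?_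
        rw [mem_range] at hm'
        calc ∑ n ∈ range N, ‖T n‖ ^ 2
            = ∑ n ∈ range N, ‖T (((n + m' : ℕ) : ℝ) - m')‖ ^ 2 := by
              refine sum_congr rfl fun n _ => ?_
              push_cast
              rw [add_sub_cancel_right]
          _ = ∑ m ∈ (range N).map (addRightEmbedding m'), ‖T ((m : ℝ) - m')‖ ^ 2 := by
              rw [sum_map]; rfl
          _ ≤ _ := by
              refine sum_le_sum_of_subset_of_nonneg ?_ (fun _ _ _ => by positivity)
              intro m hm
              simp only [mem_map, mem_range, addRightEmbedding_apply] at hm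
              obtain ⟨n, hn, rfl⟩ := hm
              rw [mem_range]; omega
      _ ≤ _ := by
        refine sum_le_sum_of_subset_of_nonneg ?_ (fun _ _ _ => by positivity)
        exact range_subset_range.mpr (by omega)
  have hexp : ((∑ m' ∈ range (2 * M), ∑ m ∈ range (2 * M), ‖T ((m : ℝ) - m')‖ ^ 2 : ℝ) : ℂ) =
      ∑ i ∈ s, ∑ j ∈ s, b i * (starRingEnd ℂ) (b j) * ((‖geomE (2 * M) (α i - α j)‖ ^ 2 : ℝ) : ℂ) := by
    have h1 : ∀ m' m : ℕ, ((‖T ((m : ℝ) - m')‖ ^ 2 : ℝ) : ℂ) =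
        ∑ i ∈ s, ∑ j ∈ s, b i * (starRingEnd ℂ) (b j) *
          (ee (m * (α i - α j)) * (starRingEnd ℂ) (ee (m' * (α i - α j)))) := by
      intro m' m
      rw [Complex.ofReal_pow, ← Complex.mul_conj', hT]
      simp only [map_sum, map_mul]
      rw [sum_mul_sum]
      refine sum_congr rfl fun i _ => sum_congr rfl fun j _ => ?_
      rw [conj_ee, conj_ee, mul_mul_mul_comm, ← ee_add, ← ee_add]
      congr 2
      ring
    have h2 : ∀ θ : ℝ, ((‖geomE (2 * M) θ‖ ^ 2 : ℝ) : ℂ) =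
        ∑ m' ∈ range (2 * M), ∑ m ∈ range (2 * M), ee (m * θ) * (starRingEnd ℂ) (ee (m' * θ)) := by
      intro θ
      rw [Complex.ofReal_pow, ← Complex.mul_conj', geomE, map_sum, sum_mul_sum, sum_comm]
    push_cast
    simp_rw [← Complex.ofReal_pow, h1, h2, mul_sum]
    rw [sum_congr rfl fun m' _ => sum_comm, sum_comm]
    refine sum_congr rfl fun i _ => ?_
    rw [sum_congr rfl fun m' _ => sum_comm, sum_comm]
  have hup : ∑ m' ∈ range (2 * M), ∑ m ∈ range (2 * M), ‖T ((m : ℝ) - m')‖ ^ 2 ≤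
      (5 * M ^ 2) * ∑ i ∈ s, ‖b i‖ ^ 2 := by
    have h0 : 0 ≤ ∑ m' ∈ range (2 * M), ∑ m ∈ range (2 * M), ‖T ((m : ℝ) - m')‖ ^ 2 := by
      positivity
    rw [← Complex.norm_of_nonneg h0, hexp]
    -- The constant `5M²` is `(2M)²` from the diagonal plus `1/δ² ≤ M²`.
    have hrow : ∀ i ∈ s, ∑ j ∈ s, ‖geomE (2 * M) (α i - α j)‖ ^ 2 ≤ 5 * (M : ℝ) ^ 2 := by
      intro i hi
      refine (sum_norm_geomE_sq_le s α hδ hsp (2 * M) i hi).trans ?_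
      have : 1 / δ ^ 2 ≤ (M : ℝ) ^ 2 := by
        rw [← one_div_pow]; gcongr
      push_cast
      nlinarith
    have hsymm : ∀ i j, ‖geomE (2 * M) (α i - α j)‖ = ‖geomE (2 * M) (α j - α i)‖ := by
      intro i j
      rw [← Complex.norm_conj]
      congr 1
      simp only [geomE, map_sum, conj_ee]
      refine sum_congr rfl fun m _ => ?_
      congr 1
      ring
    calc ‖∑ i ∈ s, ∑ j ∈ s, b i * (starRingEnd ℂ) (b j) *
            ((‖geomE (2 * M) (α i - α j)‖ ^ 2 : ℝ) : ℂ)‖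
        ≤ ∑ i ∈ s, ∑ j ∈ s, ‖b i‖ * ‖b j‖ * ‖geomE (2 * M) (α i - α j)‖ ^ 2 := by
          refine (norm_sum_le _ _).trans (sum_le_sum fun i _ => (norm_sum_le _ _).trans
            (sum_le_sum fun j _ => ?_))
          rw [norm_mul, norm_mul, Complex.norm_conj, Complex.norm_of_nonneg (by positivity)]
      -- Schur's test: the kernel is symmetric, so `2|b_i b_j| ≤ |b_i|² + |b_j|²` reduces the form
      -- to its row sums.
      _ ≤ ∑ i ∈ s, ∑ j ∈ s, (1 / 2 * (‖b i‖ ^ 2 * ‖geomE (2 * M) (α i - α j)‖ ^ 2) +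
            1 / 2 * (‖b j‖ ^ 2 * ‖geomE (2 * M) (α j - α i)‖ ^ 2)) := by
          refine sum_le_sum fun i _ => sum_le_sum fun j _ => ?_
          rw [hsymm j i]
          nlinarith [mul_nonneg (sq_nonneg (‖b i‖ - ‖b j‖))
            (sq_nonneg ‖geomE (2 * M) (α i - α j)‖)]
      _ = ∑ i ∈ s, ‖b i‖ ^ 2 * ∑ j ∈ s, ‖geomE (2 * M) (α i - α j)‖ ^ 2 := by
          simp_rw [sum_add_distrib, ← mul_sum]
          rw [sum_comm (f := fun i j => ‖b j‖ ^ 2 * ‖geomE (2 * M) (α j - α i)‖ ^ 2)]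
          simp_rw [← mul_sum]
          ring
      _ ≤ ∑ i ∈ s, ‖b i‖ ^ 2 * (5 * (M : ℝ) ^ 2) :=
          sum_le_sum fun i hi => mul_le_mul_of_nonneg_left (hrow i hi) (by positivity)
      _ = _ := by rw [← sum_mul]; ring
  have hM' : (0 : ℝ) < M := by exact_mod_cast hM
  have := hlow.trans hup
  rw [show (5 * (M : ℝ) ^ 2) * ∑ i ∈ s, ‖b i‖ ^ 2 = M * (5 * M * ∑ i ∈ s, ‖b i‖ ^ 2) by ring] at this
  exact le_of_mul_le_mul_left this hM'

/-- Duality principle for finite bilinear forms. -/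
lemma bilinear_duality {ι κ : Type*} (s : Finset ι) (t : Finset κ) (Φ : ι → κ → ℂ) {C : ℝ}
    (hC : 0 ≤ C)
    (h : ∀ b : ι → ℂ, ∑ n ∈ t, ‖∑ i ∈ s, b i * Φ i n‖ ^ 2 ≤ C * ∑ i ∈ s, ‖b i‖ ^ 2)
    (c : κ → ℂ) :
    ∑ i ∈ s, ‖∑ n ∈ t, c n * Φ i n‖ ^ 2 ≤ C * ∑ n ∈ t, ‖c n‖ ^ 2 := by
  set X := ∑ i ∈ s, ‖∑ n ∈ t, c n * Φ i n‖ ^ 2 with hX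
  -- The extremal test vector: pairing with these conjugates reproduces the sum to be bounded, and
  -- Cauchy-Schwarz then returns `X² ≤ C X ∑|c|²`.
  set b : ι → ℂ := fun i => (starRingEnd ℂ) (∑ n ∈ t, c n * Φ i n) with hb
  have hbX : ∑ i ∈ s, ‖b i‖ ^ 2 = X := by
    simp only [hb, Complex.norm_conj, hX]
  have h1 : (X : ℂ) = ∑ n ∈ t, c n * ∑ i ∈ s, b i * Φ i n := by
    rw [hX]
    push_cast
    simp_rw [← Complex.conj_mul', mul_sum]
    rw [sum_comm]
    refine sum_congr rfl fun n _ => sum_congr rfl fun i _ => ?_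
    simp only [hb]
    ring
  have hX0 : 0 ≤ X := by positivity
  have h2 : X ≤ ∑ n ∈ t, ‖c n‖ * ‖∑ i ∈ s, b i * Φ i n‖ := by
    calc X = ‖(X : ℂ)‖ := (Complex.norm_of_nonneg hX0).symm
      _ ≤ _ := by
        rw [h1]
        refine (norm_sum_le _ _).trans (sum_le_sum fun n _ => ?_)
        rw [norm_mul]
  have h3 : X ^ 2 ≤ (∑ n ∈ t, ‖c n‖ ^ 2) * (C * X) := by
    calc X ^ 2 ≤ (∑ n ∈ t, ‖c n‖ * ‖∑ i ∈ s, b i * Φ i n‖) ^ 2 := by gcongr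
      _ ≤ (∑ n ∈ t, ‖c n‖ ^ 2) * ∑ n ∈ t, ‖∑ i ∈ s, b i * Φ i n‖ ^ 2 :=
        sum_mul_sq_le_sq_mul_sq _ _ _
      _ ≤ _ := by
        rw [← hbX]
        exact mul_le_mul_of_nonneg_left (h b) (by positivity)
  rcases hX0.eq_or_lt with h0 | h0
  · rw [← h0]; positivity
  · have : X * X ≤ (C * ∑ n ∈ t, ‖c n‖ ^ 2) * X := by nlinarith
    exact le_of_mul_le_mul_right this h0

/-- The additive large sieve inequality. -/
theorem additive_large_sieve {ι : Type*} (s : Finset ι) (α : ι → ℝ) {δ : ℝ}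
    (hδ : 0 < δ) (hsp : ∀ i ∈ s, ∀ j ∈ s, i ≠ j → ∀ k : ℤ, δ ≤ |α i - α j - k|)
    {N M : ℕ} (hM : 0 < M) (hNM : N ≤ M) (hδM : 1 / δ ≤ M) (c : ℕ → ℂ) :
    ∑ i ∈ s, ‖∑ n ∈ range N, c n * ee (n * α i)‖ ^ 2 ≤ 5 * M * ∑ n ∈ range N, ‖c n‖ ^ 2 :=
  bilinear_duality s (range N) (fun i n => ee (n * α i)) (by positivity)
    (additive_large_sieve_dual s α hδ hsp hM hNM hδM) c

/-! ### Gauss sums and the multiplicative large sieve -/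

open Classical in
/-- The primitive Dirichlet characters modulo `r`. -/
def primChars (r : ℕ) : Finset (DirichletCharacter ℂ r) := univ.filter fun ψ => ψ.IsPrimitive

lemma mem_primChars {r : ℕ} {ψ : DirichletCharacter ℂ r} : ψ ∈ primChars r ↔ ψ.IsPrimitive := by
  simp [primChars]

/-- Plancherel on the unit group: expand the square and apply orthogonality of characters. -/
lemma sum_sq_norm_characters {r : ℕ} [NeZero r] (z : (ZMod r)ˣ → ℂ) :
    ∑ χ : DirichletCharacter ℂ r, ‖∑ u : (ZMod r)ˣ, χ u * z u‖ ^ 2 =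
      r.totient * ∑ u : (ZMod r)ˣ, ‖z u‖ ^ 2 := by
  have hconj : ∀ (χ : DirichletCharacter ℂ r) (u : (ZMod r)ˣ),
      (starRingEnd ℂ) (χ u) = χ ((u : ZMod r)⁻¹) := by
    intro χ u
    rw [starRingEnd_apply, MulChar.star_apply', MulChar.inv_apply, ZMod.inv_coe_unit,
      Ring.inverse_unit]
  have key : ∑ χ : DirichletCharacter ℂ r, ((‖∑ u : (ZMod r)ˣ, χ u * z u‖ ^ 2 : ℝ) : ℂ) =
      r.totient * ∑ u : (ZMod r)ˣ, ((‖z u‖ ^ 2 : ℝ) : ℂ) := by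
    have h1 : ∀ χ : DirichletCharacter ℂ r, ((‖∑ u : (ZMod r)ˣ, χ u * z u‖ ^ 2 : ℝ) : ℂ) =
        ∑ u : (ZMod r)ˣ, ∑ v : (ZMod r)ˣ,
          ((starRingEnd ℂ) (z u) * z v) * (χ ((u : ZMod r)⁻¹) * χ v) := by
      intro χ
      rw [Complex.ofReal_pow, ← Complex.conj_mul', map_sum, sum_mul_sum]
      refine sum_congr rfl fun u _ => sum_congr rfl fun v _ => ?_
      rw [map_mul, hconj]
      ring
    simp_rw [h1]
    rw [sum_comm, mul_sum]
    refine sum_congr rfl fun u _ => ?_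
    rw [sum_comm]
    simp_rw [← mul_sum, DirichletCharacter.sum_char_inv_mul_char_eq ℂ u.isUnit, Units.val_inj]
    rw [Complex.ofReal_pow, ← Complex.conj_mul']
    simp
    ring
  exact_mod_cast key

lemma sum_stdAddChar_mul_conj {r : ℕ} [NeZero r] (b b' : ZMod r) :
    ∑ n : ZMod r, ZMod.stdAddChar (n * b) * (starRingEnd ℂ) (ZMod.stdAddChar (n * b')) =
      if b = b' then (r : ℂ) else 0 := by
  have h : ∀ n : ZMod r, ZMod.stdAddChar (n * b) * (starRingEnd ℂ) (ZMod.stdAddChar (n * b')) =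
      ZMod.stdAddChar (n * (b - b')) := by
    intro n
    rw [← AddChar.map_neg_eq_conj, ← AddChar.map_add_eq_mul]
    congr 1
    ring
  simp_rw [h]
  rw [AddChar.sum_mulShift _ (ZMod.isPrimitive_stdAddChar r)]
  simp [sub_eq_zero, ZMod.card]

/-- The finite Fourier transform of a primitive `ψ` is `τ(ψ) ψ⁻¹`. Parseval gives total mass `r
φ(r)` for the transform, while `ψ⁻¹` has mass `φ(r)`. -/
lemma norm_sq_gaussSum {r : ℕ} [NeZero r] {ψ : DirichletCharacter ℂ r} (hψ : ψ.IsPrimitive) :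
    ‖gaussSum ψ (ZMod.stdAddChar : AddChar (ZMod r) ℂ)‖ ^ 2 = r := by
  set τ := gaussSum ψ (ZMod.stdAddChar : AddChar (ZMod r) ℂ) with hτ
  have hshift : ∀ n : ZMod r, ∑ b : ZMod r, ψ b * ZMod.stdAddChar (n * b) = ψ⁻¹ n * τ := by
    intro n
    rw [hτ, ← gaussSum_mulShift_of_isPrimitive _ hψ n, gaussSum]
    rfl
  have hnorm : ∀ χ : DirichletCharacter ℂ r, ∑ n : ZMod r, ‖χ n‖ ^ 2 = r.totient := by
    intro χ
    rw [← ZMod.card_units_eq_totient, ← Finset.card_univ, Finset.card_eq_sum_ones]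
    push_cast
    symm
    refine sum_of_injOn (fun u : (ZMod r)ˣ => (u : ZMod r)) (fun _ _ _ _ h => Units.ext h)
      (fun _ _ => by simp) ?_ ?_
    · intro n _ hn
      have : ¬ IsUnit n := fun ⟨u, hu⟩ => hn ⟨u, by simp, hu⟩
      rw [MulChar.map_nonunit _ this]; simp
    · intro u _
      rw [DirichletCharacter.unit_norm_eq_one]; simp
  have h1 : ∑ n : ZMod r, ((‖∑ b : ZMod r, ψ b * ZMod.stdAddChar (n * b)‖ ^ 2 : ℝ) : ℂ) =
      r * r.totient := by
    have e : ∀ n : ZMod r, ((‖∑ b : ZMod r, ψ b * ZMod.stdAddChar (n * b)‖ ^ 2 : ℝ) : ℂ) =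
        ∑ b : ZMod r, ∑ b' : ZMod r, (ψ b * (starRingEnd ℂ) (ψ b')) *
          (ZMod.stdAddChar (n * b) * (starRingEnd ℂ) (ZMod.stdAddChar (n * b'))) := by
      intro n
      rw [Complex.ofReal_pow, ← Complex.mul_conj', map_sum, sum_mul_sum]
      refine sum_congr rfl fun u _ => sum_congr rfl fun v _ => ?_
      rw [map_mul (starRingEnd ℂ)]
      ring
    simp_rw [e]
    rw [sum_comm]
    have e2 : ∀ b : ZMod r, ∑ n : ZMod r, ∑ b' : ZMod r, (ψ b * (starRingEnd ℂ) (ψ b')) *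
          (ZMod.stdAddChar (n * b) * (starRingEnd ℂ) (ZMod.stdAddChar (n * b'))) =
          r * ((‖ψ b‖ ^ 2 : ℝ) : ℂ) := by
      intro b
      rw [sum_comm]
      simp_rw [← mul_sum, sum_stdAddChar_mul_conj]
      rw [Complex.ofReal_pow, ← Complex.mul_conj']
      simp
      ring
    simp_rw [e2]
    rw [← mul_sum, ← Complex.ofReal_sum, hnorm]
    simp
  simp_rw [hshift, norm_mul, mul_pow] at h1
  have h2 : ∑ n : ZMod r, ‖ψ⁻¹ n‖ ^ 2 * ‖τ‖ ^ 2 = r * r.totient := by exact_mod_cast h1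
  rw [← sum_mul, hnorm, mul_comm] at h2
  have hpos : (0 : ℝ) < r.totient := by
    exact_mod_cast Nat.totient_pos.mpr (Nat.pos_of_ne_zero (NeZero.ne r))
  exact mul_right_cancel₀ hpos.ne' h2

/-- Multiplicative to additive: the contribution of one modulus. -/
lemma sum_primitive_le_sum_units {r : ℕ} [NeZero r] (t : Finset ℕ) (c : ℕ → ℂ) :
    (r : ℝ) * ∑ ψ ∈ primChars r, ‖∑ n ∈ t, c n * ψ n‖ ^ 2 ≤
      r.totient * ∑ u : (ZMod r)ˣ, ‖∑ n ∈ t, c n * ZMod.stdAddChar ((n : ZMod r) * (u : ZMod r))‖ ^ 2 := by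
  classical
  rw [← sum_sq_norm_characters, mul_sum]
  -- For primitive `ψ`, `ψ(n) τ(ψ⁻¹) = ∑_u ψ⁻¹(u) e(nu/r)` for every `n`, including those not
  -- coprime to `r`; and `|τ(ψ⁻¹)|² = r`.
  have key : ∀ ψ : DirichletCharacter ℂ r, ψ.IsPrimitive →
      (r : ℝ) * ‖∑ n ∈ t, c n * ψ n‖ ^ 2 =
      ‖∑ u : (ZMod r)ˣ, ψ⁻¹ u * ∑ n ∈ t, c n * ZMod.stdAddChar ((n : ZMod r) * (u : ZMod r))‖ ^ 2 := by
    intro ψ hψ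
    have hψ' : ψ⁻¹.IsPrimitive := by
      rw [DirichletCharacter.isPrimitive_def, DirichletCharacter.conductor_inv]; exact hψ
    rw [← norm_sq_gaussSum hψ', ← mul_pow, ← norm_mul]
    congr 2
    simp_rw [mul_sum]
    rw [sum_comm]
    refine sum_congr rfl fun n _ => ?_
    have h := gaussSum_mulShift_of_isPrimitive (ZMod.stdAddChar : AddChar (ZMod r) ℂ) hψ' (n : ZMod r)
    rw [inv_inv] at h
    have h2 : gaussSum ψ⁻¹ ((ZMod.stdAddChar : AddChar (ZMod r) ℂ).mulShift n) =
        ∑ u : (ZMod r)ˣ, ψ⁻¹ u * ZMod.stdAddChar ((n : ZMod r) * (u : ZMod r)) := by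
      rw [gaussSum]
      symm
      refine sum_of_injOn (fun u : (ZMod r)ˣ => (u : ZMod r)) (fun _ _ _ _ h => Units.ext h)
        (fun _ _ => by simp) ?_ ?_
      · intro n _ hn
        have : ¬ IsUnit n := fun ⟨u, hu⟩ => hn ⟨u, by simp, hu⟩
        rw [MulChar.map_nonunit _ this]; simp
      · intro u _
        rfl
    rw [mul_left_comm, mul_comm (gaussSum _ _), ← h, h2, mul_sum]
    refine sum_congr rfl fun u _ => ?_
    ring
  rw [sum_congr rfl fun ψ hψ => key ψ (mem_primChars.mp hψ)]
  rw [← sum_image (s := primChars r)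
    (g := fun ψ => ψ⁻¹) (f := fun χ : DirichletCharacter ℂ r =>
      ‖∑ u : (ZMod r)ˣ, χ u * ∑ n ∈ t, c n * ZMod.stdAddChar ((n : ZMod r) * (u : ZMod r))‖ ^ 2)
      (fun _ _ _ _ h => inv_injective h)]
  -- The imprimitive characters are added by positivity, after which Plancherel on the units is
  -- available.
  exact sum_le_sum_of_subset_of_nonneg (subset_univ _) (fun _ _ _ => by positivity)

lemma sum_units_eq_sum_coprime {r : ℕ} [NeZero r] (g : ZMod r → ℝ) :
    ∑ u : (ZMod r)ˣ, g u = ∑ a ∈ (range r).filter (fun a => a.Coprime r), g a := by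
  refine sum_nbij' (fun u : (ZMod r)ˣ => (u : ZMod r).val)
    (fun a => if h : a.Coprime r then ZMod.unitOfCoprime a h else 1) ?_ ?_ ?_ ?_ ?_
  · intro u _
    rw [mem_filter, mem_range]
    exact ⟨ZMod.val_lt _, ZMod.val_coe_unit_coprime u⟩
  · intro a _; simp
  · intro u _
    have := ZMod.val_coe_unit_coprime u
    ext
    simp only [dif_pos this, ZMod.coe_unitOfCoprime, ZMod.natCast_val, ZMod.cast_id', id_eq]
  · intro a ha
    rw [mem_filter, mem_range] at ha
    simp only [dif_pos ha.2, ZMod.coe_unitOfCoprime, ZMod.val_natCast, Nat.mod_eq_of_lt ha.1]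
  · intro u _
    simp

/-- Over the common denominator `r r' ≤ D²` the numerator is an integer, and it is nonzero because
reduced fractions in `[0,1)` determine their numerator and denominator. -/
lemma farey_spacing {D r r' a a' : ℕ} (hr : 0 < r) (hr' : 0 < r') (hrD : r ≤ D) (hrD' : r' ≤ D)
    (ha : a < r) (ha' : a' < r') (hc : a.Coprime r) (hc' : a'.Coprime r')
    (hne : ¬ (r = r' ∧ a = a')) (k : ℤ) :
    1 / (D : ℝ) ^ 2 ≤ |(a / r : ℝ) - a' / r' - k| := by
  have hr0 : (0 : ℝ) < r := by exact_mod_cast hr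
  have hr0' : (0 : ℝ) < r' := by exact_mod_cast hr'
  have e : (a / r : ℝ) - a' / r' - k = ((a * r' - a' * r - k * r * r' : ℤ) : ℝ) / (r * r') := by
    push_cast
    field_simp
  have hnz : (a * r' - a' * r - k * r * r' : ℤ) ≠ 0 := by
    intro h0
    have h1 : (r : ℤ) ∣ a * r' := ⟨a' + k * r', by linarith⟩
    have h2 : (r' : ℤ) ∣ a' * r := ⟨a - k * r, by linarith⟩
    have h1' : r ∣ r' := by
      have : r ∣ a * r' := by exact_mod_cast h1
      exact (Nat.Coprime.dvd_mul_left hc.symm).mp this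
    have h2' : r' ∣ r := by
      have : r' ∣ a' * r := by exact_mod_cast h2
      exact (Nat.Coprime.dvd_mul_left hc'.symm).mp this
    have hrr := Nat.dvd_antisymm h1' h2'
    subst hrr
    apply hne
    refine ⟨rfl, ?_⟩
    have h3 : (r : ℤ) * (a - a' - k * r) = 0 := by linarith
    have h4 : (a : ℤ) - a' - k * r = 0 := by
      rcases mul_eq_zero.mp h3 with h | h
      · omega
      · exact h
    have h5 : (r : ℤ) ∣ (a : ℤ) - a' := ⟨k, by linarith⟩
    have h6 := Int.eq_zero_of_abs_lt_dvd h5 (by rw [abs_lt]; omega)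
    omega
  rw [e, abs_div, abs_of_pos (by positivity : (0 : ℝ) < r * r')]
  have h1 : (1 : ℝ) ≤ |((a * r' - a' * r - k * r * r' : ℤ) : ℝ)| := by
    exact_mod_cast Int.one_le_abs hnz
  have h2 : (r : ℝ) * r' ≤ (D : ℝ) ^ 2 := by
    rw [sq]; gcongr
  calc 1 / (D : ℝ) ^ 2 ≤ 1 / (r * r') := one_div_le_one_div_of_le (by positivity) h2
    _ ≤ _ := by gcongr

/-- The multiplicative large sieve inequality. -/
theorem multiplicative_large_sieve (D N : ℕ) (hD : 0 < D) (c : ℕ → ℂ) :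
    ∑ r ∈ Icc 1 D, (r : ℝ) / r.totient *
      ∑ ψ ∈ primChars r, ‖∑ n ∈ range N, c n * ψ n‖ ^ 2 ≤
      5 * (N + D ^ 2) * ∑ n ∈ range N, ‖c n‖ ^ 2 := by
  classical
  set s : Finset (Σ _ : ℕ, ℕ) := (Icc 1 D).sigma fun r => (range r).filter (fun a => a.Coprime r)
    with hs
  have hls := additive_large_sieve s (fun i => (i.2 : ℝ) / i.1) (δ := 1 / (D : ℝ) ^ 2)
    (by positivity) ?_ (N := N) (M := N + D ^ 2) (by positivity) (by omega)
    (by push_cast; rw [one_div_one_div]; linarith [(Nat.cast_nonneg N : (0 : ℝ) ≤ N)]) c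
  · push_cast at hls
    refine le_trans ?_ hls
    rw [hs, sum_sigma]
    refine sum_le_sum fun r hr => ?_
    rw [mem_Icc] at hr
    have : NeZero r := ⟨by omega⟩
    have hpos : (0 : ℝ) < r.totient := by exact_mod_cast Nat.totient_pos.mpr hr.1
    rw [div_mul_eq_mul_div, div_le_iff₀ hpos, mul_comm _ (r.totient : ℝ)]
    refine (sum_primitive_le_sum_units (range N) c).trans (le_of_eq ?_)
    congr 1
    rw [sum_units_eq_sum_coprime
      (fun u => ‖∑ n ∈ range N, c n * ZMod.stdAddChar ((n : ZMod r) * (u : ZMod r))‖ ^ 2)]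
    refine sum_congr rfl fun a _ => ?_
    congr 2
    refine sum_congr rfl fun n _ => ?_
    congr 1
    have := ZMod.stdAddChar_coe (N := r) ((n : ℤ) * a)
    push_cast at this
    rw [this, ee]
    congr 1
    push_cast
    ring
  · rintro ⟨r, a⟩ hi ⟨r', a'⟩ hj hne k
    simp only [hs, mem_sigma, mem_Icc, mem_filter, mem_range] at hi hj
    refine farey_spacing hi.1.1 hj.1.1 hi.1.2 hj.1.2 hi.2.1 hj.2.1 hi.2.2 hj.2.2 ?_ k
    rintro ⟨rfl, rfl⟩
    exact hne rfl

/-! ### Mean values over primitive characters and bilinear forms -/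

/-- The weighted mean `∑_{R < r ≤ Q} φ(r)⁻¹ ∑*_ψ ‖W(ψ)‖` over primitive characters. -/
def primMean (R Q : ℕ) (W : (r : ℕ) → DirichletCharacter ℂ r → ℂ) : ℝ :=
  ∑ r ∈ Ioc R Q, (1 / (r.totient : ℝ)) * ∑ ψ ∈ primChars r, ‖W r ψ‖

lemma primMean_nonneg (R Q : ℕ) (W : (r : ℕ) → DirichletCharacter ℂ r → ℂ) :
    0 ≤ primMean R Q W := by
  unfold primMean
  positivity

lemma primMean_add_le (R Q : ℕ) (W W' : (r : ℕ) → DirichletCharacter ℂ r → ℂ) :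
    primMean R Q (fun r ψ => W r ψ + W' r ψ) ≤ primMean R Q W + primMean R Q W' := by
  unfold primMean
  rw [← sum_add_distrib]
  refine sum_le_sum fun r _ => ?_
  rw [← mul_add, ← sum_add_distrib]
  gcongr
  exact norm_add_le _ _

lemma primMean_sum_le {ι : Type*} (R Q : ℕ) (s : Finset ι)
    (W : ι → (r : ℕ) → DirichletCharacter ℂ r → ℂ) :
    primMean R Q (fun r ψ => ∑ i ∈ s, W i r ψ) ≤ ∑ i ∈ s, primMean R Q (W i) := by
  classical
  induction s using Finset.induction_on with
  | empty => simp [primMean]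
  | insert i s hi ih =>
    simp_rw [sum_insert hi]
    exact (primMean_add_le _ _ _ _).trans (by gcongr)

lemma primMean_const_mul (R Q : ℕ) (z : ℂ) (W : (r : ℕ) → DirichletCharacter ℂ r → ℂ) :
    primMean R Q (fun r ψ => z * W r ψ) = ‖z‖ * primMean R Q W := by
  unfold primMean
  simp_rw [norm_mul, ← mul_sum]
  rw [mul_sum]
  refine sum_congr rfl fun r _ => ?_
  ring

lemma multiplicative_large_sieve_finset (D U : ℕ) (hD : 0 < D) (s : Finset ℕ)
    (hs : ∀ a ∈ s, a ≤ U) (c : ℕ → ℂ) :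
    ∑ r ∈ Icc 1 D, (r : ℝ) / r.totient * ∑ ψ ∈ primChars r, ‖∑ n ∈ s, c n * ψ n‖ ^ 2 ≤
      5 * (U + 1 + D ^ 2) * ∑ n ∈ s, ‖c n‖ ^ 2 := by
  classical
  have h := multiplicative_large_sieve D (U + 1) hD (fun n => if n ∈ s then c n else 0)
  have hsub : (range (U + 1)).filter (· ∈ s) = s := by
    ext n
    simp only [mem_filter, mem_range, and_iff_right_iff_imp]
    intro hn
    have := hs n hn
    omega
  have e1 : ∀ (r : ℕ) (ψ : DirichletCharacter ℂ r),
      ∑ n ∈ range (U + 1), (if n ∈ s then c n else 0) * ψ n = ∑ n ∈ s, c n * ψ n := by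
    intro r ψ
    simp_rw [ite_mul, zero_mul]
    rw [← sum_filter, hsub]
  have e2 : ∑ n ∈ range (U + 1), ‖(if n ∈ s then c n else 0)‖ ^ 2 = ∑ n ∈ s, ‖c n‖ ^ 2 := by
    rw [← hsub, sum_filter, hsub]
    refine sum_congr rfl fun n _ => ?_
    split_ifs <;> simp
  simp_rw [e1] at h
  rw [e2] at h
  push_cast at h
  exact h

/-- On a dyadic block `1/φ(r) ≤ D⁻¹ r/φ(r)`, which is the weight of the large sieve. Cauchy-Schwarz
over pairs `(r, ψ)` gives a multiple of `(√U + D)(√V + D)/D`. -/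
lemma sum_block_bilinear_le (D U V : ℕ) (hD : 0 < D) (s t : Finset ℕ)
    (hs : ∀ a ∈ s, a ≤ U) (ht : ∀ b ∈ t, b ≤ V) (α β : ℕ → ℂ) :
    ∑ r ∈ Ioc D (2 * D), (1 / (r.totient : ℝ)) * ∑ ψ ∈ primChars r,
        ‖(∑ a ∈ s, α a * ψ a) * ∑ b ∈ t, β b * ψ b‖ ≤
      45 * (D + √U + √V + √(U * V) / D) * (√(∑ a ∈ s, ‖α a‖ ^ 2) * √(∑ b ∈ t, ‖β b‖ ^ 2)) := by
  have hD' : (0 : ℝ) < D := by exact_mod_cast hD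
  have hD1 : (1 : ℝ) ≤ D := by exact_mod_cast hD
  set A : (r : ℕ) → DirichletCharacter ℂ r → ℝ := fun r ψ => ‖∑ a ∈ s, α a * ψ a‖ with hA
  set B : (r : ℕ) → DirichletCharacter ℂ r → ℝ := fun r ψ => ‖∑ b ∈ t, β b * ψ b‖ with hB
  have step1 : ∑ r ∈ Ioc D (2 * D), (1 / (r.totient : ℝ)) * ∑ ψ ∈ primChars r,
        ‖(∑ a ∈ s, α a * ψ a) * ∑ b ∈ t, β b * ψ b‖ ≤
      (1 / D) * ∑ r ∈ Icc 1 (2 * D), ∑ ψ ∈ primChars r,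
        (√((r : ℝ) / r.totient) * A r ψ) * (√((r : ℝ) / r.totient) * B r ψ) := by
    rw [mul_sum]
    have hsub : Ioc D (2 * D) ⊆ Icc 1 (2 * D) := by
      intro r; rw [mem_Ioc, mem_Icc]; omega
    refine le_trans (sum_le_sum fun r hr => ?_)
      (sum_le_sum_of_subset_of_nonneg hsub fun r _ _ => by positivity)
    rw [mem_Ioc] at hr
    have hrD : (D : ℝ) ≤ r := by exact_mod_cast hr.1.le
    rw [mul_sum, mul_sum]
    refine sum_le_sum fun ψ _ => ?_
    rw [norm_mul]
    have : √((r : ℝ) / r.totient) * A r ψ * (√((r : ℝ) / r.totient) * B r ψ) =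
        (r : ℝ) / r.totient * (A r ψ * B r ψ) := by
      rw [mul_mul_mul_comm, Real.mul_self_sqrt (by positivity)]
    rw [this]
    have h2 : 1 / (r.totient : ℝ) ≤ 1 / D * (r / r.totient) := by
      rw [div_mul_div_comm, one_mul, mul_comm (D : ℝ), ← div_div, div_right_comm]
      gcongr
      rw [le_div_iff₀ hD']; linarith
    calc 1 / (r.totient : ℝ) * (A r ψ * B r ψ)
        ≤ 1 / D * (r / r.totient) * (A r ψ * B r ψ) := by gcongr
      _ = _ := by ring
  have step2 : ∑ r ∈ Icc 1 (2 * D), ∑ ψ ∈ primChars r,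
        (√((r : ℝ) / r.totient) * A r ψ) * (√((r : ℝ) / r.totient) * B r ψ) ≤
      √(5 * (U + 1 + (2 * D) ^ 2) * ∑ a ∈ s, ‖α a‖ ^ 2) *
        √(5 * (V + 1 + (2 * D) ^ 2) * ∑ b ∈ t, ‖β b‖ ^ 2) := by
    rw [sum_sigma']
    refine (Real.sum_mul_le_sqrt_mul_sqrt _ _ _).trans ?_
    have h1 := multiplicative_large_sieve_finset (2 * D) U (by omega) s hs α
    have h2 := multiplicative_large_sieve_finset (2 * D) V (by omega) t ht β
    push_cast at h1 h2
    gcongr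
    · refine le_trans (le_of_eq ?_) h1
      rw [sum_sigma]
      refine sum_congr rfl fun r _ => ?_
      rw [mul_sum]
      refine sum_congr rfl fun ψ _ => ?_
      rw [mul_pow, Real.sq_sqrt (by positivity)]
    · refine le_trans (le_of_eq ?_) h2
      rw [sum_sigma]
      refine sum_congr rfl fun r _ => ?_
      rw [mul_sum]
      refine sum_congr rfl fun ψ _ => ?_
      rw [mul_pow, Real.sq_sqrt (by positivity)]
  have hsq : ∀ W : ℕ, √(5 * ((W : ℝ) + 1 + (2 * D) ^ 2)) ≤ 6 * (√W + D) := by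
    intro W
    apply Real.sqrt_le_iff.mpr
    refine ⟨by positivity, ?_⟩
    nlinarith [Real.sq_sqrt (Nat.cast_nonneg W : (0 : ℝ) ≤ W), Real.sqrt_nonneg (W : ℝ)]
  have step3 : √(5 * (U + 1 + (2 * D) ^ 2) * ∑ a ∈ s, ‖α a‖ ^ 2) *
        √(5 * (V + 1 + (2 * D) ^ 2) * ∑ b ∈ t, ‖β b‖ ^ 2) ≤
      (36 * ((√U + D) * (√V + D))) * (√(∑ a ∈ s, ‖α a‖ ^ 2) * √(∑ b ∈ t, ‖β b‖ ^ 2)) := by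
    have e : ∀ (W : ℕ) (S : ℝ), √(5 * ((W : ℝ) + 1 + (2 * D) ^ 2) * S) ≤ 6 * (√W + D) * √S := by
      intro W S
      rw [Real.sqrt_mul (by positivity)]
      exact mul_le_mul_of_nonneg_right (hsq W) (Real.sqrt_nonneg _)
    calc _ ≤ (6 * (√U + D) * √(∑ a ∈ s, ‖α a‖ ^ 2)) * (6 * (√V + D) * √(∑ b ∈ t, ‖β b‖ ^ 2)) :=
          mul_le_mul (e U _) (e V _) (by positivity) (by positivity)
      _ = _ := by ring
  refine step1.trans ?_
  calc _ ≤ 1 / (D : ℝ) * ((36 * ((√U + D) * (√V + D))) *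
        (√(∑ a ∈ s, ‖α a‖ ^ 2) * √(∑ b ∈ t, ‖β b‖ ^ 2))) := by
        gcongr
        exact step2.trans step3
    _ = (36 * (D + √U + √V + √(U * V) / D)) *
        (√(∑ a ∈ s, ‖α a‖ ^ 2) * √(∑ b ∈ t, ‖β b‖ ^ 2)) := by
        rw [Real.sqrt_mul (by positivity)]
        field_simp
        ring
    _ ≤ _ := by
        gcongr
        norm_num

/-- The bilinear form of the large sieve, over primitive characters with conductor in `(R, Q]`. -/
theorem primMean_bilinear_le (R Q U V : ℕ) (hR : 0 < R) (s t : Finset ℕ)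
    (hs : ∀ a ∈ s, a ≤ U) (ht : ∀ b ∈ t, b ≤ V) (α β : ℕ → ℂ) :
    primMean R Q (fun _ ψ => (∑ a ∈ s, α a * ψ a) * ∑ b ∈ t, β b * ψ b) ≤
      45 * (Nat.log 2 Q + 1) * (Q + √U + √V + √(U * V) / R) *
        (√(∑ a ∈ s, ‖α a‖ ^ 2) * √(∑ b ∈ t, ‖β b‖ ^ 2)) := by
  set g : ℕ → ℝ := fun r => (1 / (r.totient : ℝ)) * ∑ ψ ∈ primChars r,
        ‖(∑ a ∈ s, α a * ψ a) * ∑ b ∈ t, β b * ψ b‖ with hg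
  have hg0 : ∀ r, 0 ≤ g r := fun r => by positivity
  -- Cutting off at `Q` lets the blocks `(R 2^i, R 2^(i+1)]` overshoot `Q`. A block starting beyond
  -- `Q` contributes nothing; otherwise `R ≤ R 2^i ≤ Q` makes its bound uniform in `i`.
  set G : ℕ → ℝ := fun r => if r ≤ Q then g r else 0 with hG
  have hG0 : ∀ r, 0 ≤ G r := fun r => by simp only [hG]; split_ifs <;> simp [hg0]
  set k := Nat.log 2 Q + 1 with hk
  have h1 : primMean R Q (fun _ ψ => (∑ a ∈ s, α a * ψ a) * ∑ b ∈ t, β b * ψ b) ≤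
      ∑ r ∈ Ioc R (R * 2 ^ k), G r := by
    have hle : Q ≤ R * 2 ^ k := by
      have := Nat.lt_pow_succ_log_self (b := 2) (by norm_num) Q
      calc Q ≤ 2 ^ k := this.le
        _ ≤ R * 2 ^ k := Nat.le_mul_of_pos_left _ hR
    refine le_trans (le_of_eq ?_) (sum_le_sum_of_subset_of_nonneg
      (Ioc_subset_Ioc_right hle) fun r _ _ => hG0 r)
    unfold primMean
    refine sum_congr rfl fun r hr => ?_
    rw [mem_Ioc] at hr
    simp only [hG, if_pos hr.2, hg]
  have h2 : ∀ k : ℕ, ∑ r ∈ Ioc R (R * 2 ^ k), G r =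
      ∑ i ∈ range k, ∑ r ∈ Ioc (R * 2 ^ i) (2 * (R * 2 ^ i)), G r := by
    intro k
    induction k with
    | zero => simp
    | succ k ih =>
      rw [sum_range_succ, ← ih, show 2 * (R * 2 ^ k) = R * 2 ^ (k + 1) by ring,
        sum_Ioc_consecutive]
      · exact Nat.le_mul_of_pos_right _ (by positivity)
      · exact Nat.mul_le_mul_left _ (Nat.pow_le_pow_right (by norm_num) (by omega))
  have h3 : ∀ i, ∑ r ∈ Ioc (R * 2 ^ i) (2 * (R * 2 ^ i)), G r ≤
      45 * (Q + √U + √V + √(U * V) / R) *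
        (√(∑ a ∈ s, ‖α a‖ ^ 2) * √(∑ b ∈ t, ‖β b‖ ^ 2)) := by
    intro i
    by_cases hi : R * 2 ^ i ≤ Q
    · have hpos : 0 < R * 2 ^ i := by positivity
      refine le_trans (sum_le_sum fun r _ => ?_)
        ((sum_block_bilinear_le (R * 2 ^ i) U V hpos s t hs ht α β).trans ?_)
      · show G r ≤ g r
        simp only [hG]; split_ifs <;> simp [hg0]
      · have hi' : ((R * 2 ^ i : ℕ) : ℝ) ≤ Q := by exact_mod_cast hi
        have hR' : (R : ℝ) ≤ ((R * 2 ^ i : ℕ) : ℝ) := by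
          exact_mod_cast Nat.le_mul_of_pos_right _ (by positivity)
        have hR0 : (0 : ℝ) < R := by exact_mod_cast hR
        gcongr
    · rw [sum_eq_zero]
      · positivity
      · intro r hr
        rw [mem_Ioc] at hr
        simp only [hG]
        rw [if_neg]
        omega
  refine h1.trans ?_
  rw [h2]
  refine (sum_le_sum fun i _ => h3 i).trans (le_of_eq ?_)
  rw [sum_const, card_range, nsmul_eq_mul, hk]
  push_cast
  ring

/-- The linear form of the large sieve. -/
theorem primMean_linear_le (R Q V : ℕ) (hR : 0 < R) (hQ : (Q : ℝ) ≤ √V) (hV : 0 < V)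
    (t : Finset ℕ) (ht : ∀ b ∈ t, b ≤ V) (β : ℕ → ℂ) :
    primMean R Q (fun _ ψ => ∑ b ∈ t, β b * ψ b) ≤
      180 * (Nat.log 2 Q + 1) * √V * √(∑ b ∈ t, ‖β b‖ ^ 2) := by
  have h := primMean_bilinear_le R Q 1 V hR {1} t (by simp) ht (fun _ => 1) β
  simp only [sum_singleton, Nat.cast_one, map_one, one_mul, norm_one, one_pow, Real.sqrt_one] at h
  refine h.trans ?_
  have hV1 : 1 ≤ √(V : ℝ) := Real.one_le_sqrt.mpr (by exact_mod_cast hV)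
  have hR1 : (1 : ℝ) ≤ R := by exact_mod_cast hR
  have h3 : √(V : ℝ) / R ≤ √V := div_le_self (by positivity) hR1
  calc _ ≤ 45 * (Nat.log 2 Q + 1) * (√V + √V + √V + √V) * √(∑ b ∈ t, ‖β b‖ ^ 2) := by gcongr
    _ = _ := by ring

/-! ### Expansion of the discrepancy by conductors -/

/-- The twisted sum `∑_{n ≤ x} c(n) χ(n)`. -/
def charSum (c : ℕ → ℂ) (x : ℝ) {q : ℕ} (χ : DirichletCharacter ℂ q) : ℂ :=
  ∑ n ∈ Icc 1 ⌊x⌋₊, c n * χ n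

/-- The restriction of `c` to integers coprime to `k`. -/
def coprimePart (c : ℕ → ℂ) (k : ℕ) : ℕ → ℂ := fun n => if n.Coprime k then c n else 0

open Classical in
/-- The contribution of characters of conductor `r` to the character expansion of `Delta`. -/
def condPart (c : ℕ → ℂ) (x : ℝ) (q : ℕ) (a : (ZMod q)ˣ) (r : ℕ) : ℂ :=
  ∑ χ : DirichletCharacter ℂ q with χ.conductor = r, χ ((a⁻¹ : (ZMod q)ˣ) : ZMod q) * charSum c x χ

lemma changeLevel_apply_natCast {d q : ℕ} (hd : d ∣ q) (χ : DirichletCharacter ℂ d) {n : ℕ}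
    (hn : n.Coprime q) : DirichletCharacter.changeLevel hd χ (n : ZMod q) = χ (n : ZMod d) := by
  have := DirichletCharacter.changeLevel_eq_cast_of_dvd' χ hd (a := (n : ℤ))
    (Nat.isCoprime_iff_coprime.mpr hn)
  simpa using this

lemma charSum_changeLevel {d q : ℕ} (hd : d ∣ q) (χ : DirichletCharacter ℂ d) (c : ℕ → ℂ) (x : ℝ) :
    charSum c x (DirichletCharacter.changeLevel hd χ) = charSum (coprimePart c q) x χ := by
  unfold charSum coprimePart
  refine sum_congr rfl fun n _ => ?_
  split_ifs with h
  · rw [changeLevel_apply_natCast hd χ h]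
  · rw [MulChar.map_nonunit _ (by rwa [ZMod.isUnit_iff_coprime]), mul_zero, zero_mul]

/-- Characters modulo `q` of conductor dividing `d` are exactly those induced from modulus `d`.
Orthogonality modulo `d` then detects `n ≡ a (mod d)`, and induction to `q` leaves only the
condition that `n` be coprime to `q`. -/
lemma sum_condPart_divisors (c : ℕ → ℂ) (x : ℝ) {q : ℕ} [NeZero q] (a : (ZMod q)ˣ) {d : ℕ}
    (hd : d ∣ q) :
    ∑ r ∈ d.divisors, condPart c x q a r = d.totient *
      ∑ n ∈ (Icc 1 ⌊x⌋₊).filter (fun n : ℕ => (n : ZMod d) = ((a : ZMod q).cast : ZMod d)),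
        coprimePart c q n := by
  classical
  have hd0 : d ≠ 0 := fun h => NeZero.ne q (by rw [h] at hd; exact zero_dvd_iff.mp hd)
  have : NeZero d := ⟨hd0⟩
  have h1 : ∑ r ∈ d.divisors, condPart c x q a r =
      ∑ χ : DirichletCharacter ℂ q with χ.conductor ∣ d,
        χ ((a⁻¹ : (ZMod q)ˣ) : ZMod q) * charSum c x χ := by
    unfold condPart
    rw [← sum_biUnion]
    · refine sum_congr ?_ fun _ _ => rfl
      ext χ
      simp [hd0]
    · intro r _ r' _ hne
      refine disjoint_left.mpr fun χ h h' => hne ?_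
      rw [mem_filter] at h h'
      rw [← h.2, h'.2]
  have h2 : (univ.filter fun χ : DirichletCharacter ℂ q => χ.conductor ∣ d) =
      univ.image (DirichletCharacter.changeLevel (R := ℂ) hd) := by
    ext χ
    simp only [mem_filter, mem_univ, true_and, mem_image]
    rw [← DirichletCharacter.mem_conductorSet_iff_conductor_dvd χ hd,
      DirichletCharacter.mem_conductorSet_iff]
    constructor
    · rintro ⟨h, χ₀, rfl⟩; exact ⟨χ₀, rfl⟩
    · rintro ⟨χ₀, rfl⟩; exact ⟨hd, χ₀, rfl⟩
  rw [h1, h2, sum_image fun _ _ _ _ h => DirichletCharacter.changeLevel_injective hd h]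
  have h3 : ∀ χ : DirichletCharacter ℂ d,
      DirichletCharacter.changeLevel hd χ ((a⁻¹ : (ZMod q)ˣ) : ZMod q) =
        χ ((ZMod.unitsMap hd a : ZMod d)⁻¹) := by
    intro χ
    rw [DirichletCharacter.changeLevel_eq_cast_of_dvd, ← ZMod.unitsMap_val hd, map_inv,
      ZMod.inv_coe_unit]
  simp_rw [h3, charSum_changeLevel, charSum, mul_sum]
  rw [sum_comm, sum_filter]
  refine sum_congr rfl fun n _ => ?_
  have h4 : ∀ χ : DirichletCharacter ℂ d, χ ((ZMod.unitsMap hd a : ZMod d)⁻¹) *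
      (coprimePart c q n * χ n) = coprimePart c q n *
        (χ ((ZMod.unitsMap hd a : ZMod d)⁻¹) * χ n) := fun χ => by ring
  simp_rw [h4]
  rw [← mul_sum, DirichletCharacter.sum_char_inv_mul_char_eq ℂ (Units.isUnit _), ZMod.unitsMap_val]
  simp_rw [eq_comm (a := (n : ZMod d))]
  split_ifs <;> ring

lemma Delta_coprimePart (c : ℕ → ℂ) (x : ℝ) {q d : ℕ} (hd : d ∣ q) (a : (ZMod q)ˣ) :
    Delta (coprimePart c q) x d (ZMod.unitsMap hd a) =
      ∑ n ∈ (Icc 1 ⌊x⌋₊).filter (fun n : ℕ => (n : ZMod d) = ((a : ZMod q).cast : ZMod d)),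
        coprimePart c q n - (1 / (d.totient : ℂ)) * ∑ n ∈ Icc 1 ⌊x⌋₊, coprimePart c q n := by
  unfold Delta
  rw [ZMod.unitsMap_val]
  congr 2
  rw [sum_filter]
  refine sum_congr rfl fun n _ => ?_
  split_ifs with h
  · rfl
  · unfold coprimePart
    rw [if_neg]
    exact fun h' => h (Nat.Coprime.coprime_dvd_right hd h')

/-- Möbius inversion of the preceding divisor sum, valid on the divisors of `q`. -/
lemma condPart_eq (c : ℕ → ℂ) (x : ℝ) {q : ℕ} [NeZero q] (a : (ZMod q)ˣ) {r : ℕ}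
    (hr : r ∣ q) :
    condPart c x q a r = ∑ p ∈ r.divisorsAntidiagonal, (ArithmeticFunction.moebius p.1 : ℂ) *
      (p.2.totient * ∑ n ∈ (Icc 1 ⌊x⌋₊).filter
        (fun n : ℕ => (n : ZMod p.2) = ((a : ZMod q).cast : ZMod p.2)), coprimePart c q n) := by
  have hr0 : 0 < r := Nat.pos_of_dvd_of_pos hr (Nat.pos_of_ne_zero (NeZero.ne q))
  exact ((ArithmeticFunction.sum_eq_iff_sum_mul_moebius_eq_on (R := ℂ)
    (f := condPart c x q a) (g := fun d => d.totient * ∑ n ∈ (Icc 1 ⌊x⌋₊).filter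
        (fun n : ℕ => (n : ZMod d) = ((a : ZMod q).cast : ZMod d)), coprimePart c q n)
    {d | d ∣ q} (fun m n h h' => dvd_trans h h')).mp
    (fun n _ hn => sum_condPart_divisors c x a hn) r hr0 hr).symm

/-- The Möbius function sums to zero over the divisors of `r ≠ 1`, so the same main term may be
subtracted from every summand of `condPart_eq`. Each progression sum thereby becomes a discrepancy,
and no main term remains. -/
lemma norm_condPart_le (c : ℕ → ℂ) (x : ℝ) {q : ℕ} [NeZero q] (a : (ZMod q)ˣ) {r : ℕ}
    (hr : r ∣ q) (hr1 : r ≠ 1) (h : ℕ → ℝ)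
    (hh : ∀ d, d ∣ r → ∀ b : (ZMod d)ˣ, ‖Delta (coprimePart c q) x d b‖ ≤ h d) :
    ‖condPart c x q a r‖ ≤ ∑ d ∈ r.divisors, d.totient * h d := by
  have hr0 : r ≠ 0 := fun h => NeZero.ne q (by rw [h] at hr; exact zero_dvd_iff.mp hr)
  have e : condPart c x q a r = ∑ p ∈ (r.divisorsAntidiagonal).attach,
      (ArithmeticFunction.moebius p.1.1 : ℂ) * (p.1.2.totient *
        Delta (coprimePart c q) x p.1.2 (ZMod.unitsMap
          ((Nat.snd_mem_divisors_of_mem_antidiagonal p.2 |> Nat.dvd_of_mem_divisors).trans hr) a)) := by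
    have hz : ∑ p ∈ r.divisorsAntidiagonal, (ArithmeticFunction.moebius p.1 : ℂ) *
        ∑ n ∈ Icc 1 ⌊x⌋₊, coprimePart c q n = 0 := by
      rw [← sum_mul, Nat.sum_divisorsAntidiagonal (fun i _ => (ArithmeticFunction.moebius i : ℂ)),
        ← Int.cast_sum, ← ArithmeticFunction.coe_mul_zeta_apply,
        ArithmeticFunction.moebius_mul_coe_zeta, ArithmeticFunction.one_apply_ne hr1]
      simp
    rw [condPart_eq c x a hr, ← sub_zero (∑ p ∈ r.divisorsAntidiagonal, _), ← hz,
      ← sum_sub_distrib, ← sum_attach]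
    refine sum_congr rfl fun p _ => ?_
    rw [Delta_coprimePart]
    have hp0 : (p.1.2.totient : ℂ) ≠ 0 := by
      have := Nat.pos_of_mem_divisors (Nat.snd_mem_divisors_of_mem_antidiagonal p.2)
      exact_mod_cast (Nat.totient_pos.mpr this).ne'
    field_simp
  rw [e, ← Nat.sum_divisorsAntidiagonal' (fun _ d => (d.totient : ℝ) * h d),
    ← sum_attach r.divisorsAntidiagonal]
  refine (norm_sum_le _ _).trans (sum_le_sum fun p _ => ?_)
  rw [norm_mul, norm_mul, Complex.norm_natCast, Complex.norm_intCast]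
  have h1 : |((ArithmeticFunction.moebius p.1.1 : ℤ) : ℝ)| ≤ 1 := by
    exact_mod_cast ArithmeticFunction.abs_moebius_le_one
  have h2 := hh p.1.2 (Nat.dvd_of_mem_divisors (Nat.snd_mem_divisors_of_mem_antidiagonal p.2))
    (ZMod.unitsMap ((Nat.snd_mem_divisors_of_mem_antidiagonal p.2 |>
      Nat.dvd_of_mem_divisors).trans hr) a)
  calc _ ≤ 1 * ((p.1.2.totient : ℝ) * h p.1.2) := by gcongr
    _ = _ := one_mul _

/-- The part of `Delta` coming from nonprincipal characters of conductor at most `R`. -/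
def smallPart (c : ℕ → ℂ) (x : ℝ) (R q : ℕ) (a : (ZMod q)ˣ) : ℂ :=
  (1 / (q.totient : ℂ)) * ∑ r ∈ q.divisors.filter (fun r => r ≠ 1 ∧ r ≤ R), condPart c x q a r

/-- The part of `Delta` coming from characters of conductor exceeding `R`. -/
def largePart (c : ℕ → ℂ) (x : ℝ) (R q : ℕ) (a : (ZMod q)ˣ) : ℂ :=
  (1 / (q.totient : ℂ)) * ∑ r ∈ q.divisors.filter (fun r => R < r), condPart c x q a r

/-- All conductors together (`d = q`) give the progression sum, and conductor `1` alone (`d = 1`)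
gives the main term, so `Delta` is the part with nonprincipal characters. -/
lemma Delta_eq_smallPart_add_largePart (c : ℕ → ℂ) (x : ℝ) {R q : ℕ} [NeZero q] (hR : 0 < R)
    (a : (ZMod q)ˣ) : Delta c x q a = smallPart c x R q a + largePart c x R q a := by
  have hq : 0 < q := Nat.pos_of_ne_zero (NeZero.ne q)
  have hφ : (q.totient : ℂ) ≠ 0 := by exact_mod_cast (Nat.totient_pos.mpr hq).ne'
  have h1 := sum_condPart_divisors c x a (one_dvd q)
  have h2 := sum_condPart_divisors c x a (dvd_refl q)
  have h3 : ∑ r ∈ q.divisors, condPart c x q a r = condPart c x q a 1 +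
      (∑ r ∈ q.divisors.filter (fun r => r ≠ 1 ∧ r ≤ R), condPart c x q a r +
       ∑ r ∈ q.divisors.filter (fun r => R < r), condPart c x q a r) := by
    rw [← sum_union, ← sum_insert]
    · refine sum_congr ?_ fun _ _ => rfl
      ext r
      simp only [mem_insert, mem_union, mem_filter, Nat.mem_divisors]
      constructor
      · rintro ⟨h, h'⟩
        by_cases h1 : r = 1
        · exact Or.inl h1
        · rcases le_or_gt r R with h2 | h2
          · exact Or.inr (Or.inl ⟨⟨h, h'⟩, h1, h2⟩)
          · exact Or.inr (Or.inr ⟨⟨h, h'⟩, h2⟩)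
      · rintro (h | h | h)
        · rw [h]; exact ⟨one_dvd _, hq.ne'⟩
        · exact h.1
        · exact h.1
    · simp only [mem_union, mem_filter]
      rintro (h | h)
      · exact h.2.1 rfl
      · omega
    · refine disjoint_left.mpr fun r h h' => ?_
      rw [mem_filter] at h h'
      omega
  simp only [Nat.divisors_one, sum_singleton, Nat.totient_one, Nat.cast_one, one_mul] at h1
  rw [filter_true_of_mem (fun n _ => Subsingleton.elim _ _)] at h1
  rw [h2] at h3
  unfold smallPart largePart
  rw [← mul_add, ← sub_eq_iff_eq_add'.mpr h3, h1]
  have h4 : Delta c x q a = Delta (coprimePart c q) x q a := by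
    unfold Delta coprimePart
    congr 1
    · refine sum_congr rfl fun n hn => ?_
      rw [mem_filter] at hn
      rw [if_pos]
      rw [← ZMod.isUnit_iff_coprime, hn.2]
      exact a.isUnit
    · congr 1
      refine sum_congr rfl fun n hn => ?_
      rw [mem_filter] at hn
      rw [if_pos hn.2]
  have h5 := Delta_coprimePart c x (dvd_refl q) a
  rw [ZMod.unitsMap_self, MonoidHom.id_apply] at h5
  rw [h4, h5, mul_sub, ← mul_assoc, one_div_mul_cancel hφ, one_mul]

lemma charSum_add (c c' : ℕ → ℂ) (x : ℝ) {q : ℕ} (χ : DirichletCharacter ℂ q) :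
    charSum (fun n => c n + c' n) x χ = charSum c x χ + charSum c' x χ := by
  unfold charSum
  rw [← sum_add_distrib]
  exact sum_congr rfl fun n _ => by ring

lemma largePart_add (c c' : ℕ → ℂ) (x : ℝ) (R q : ℕ) (a : (ZMod q)ˣ) :
    largePart (fun n => c n + c' n) x R q a = largePart c x R q a + largePart c' x R q a := by
  unfold largePart condPart
  simp_rw [charSum_add, mul_add, sum_add_distrib, mul_add]

/-- A primitive `ψ` modulo `r` already vanishes off the integers coprime to `r`, so only coprimality
to `k = q/r` has to be imposed. This makes `k` and `r` independent parameters when `q = k r` is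
summed. -/
lemma norm_condPart_le_sum_primChars (c : ℕ → ℂ) (x : ℝ) {q : ℕ} [NeZero q] (a : (ZMod q)ˣ)
    {r : ℕ} (hr : r ∣ q) :
    ‖condPart c x q a r‖ ≤ ∑ ψ ∈ primChars r, ‖charSum (coprimePart c (q / r)) x ψ‖ := by
  classical
  have h2 : (univ.filter fun χ : DirichletCharacter ℂ q => χ.conductor = r) =
      (primChars r).image (DirichletCharacter.changeLevel (R := ℂ) hr) := by
    ext χ
    simp only [mem_filter, mem_univ, true_and, mem_image, mem_primChars]
    constructor
    · intro h
      have := DirichletCharacter.factorsThrough_conductor χ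
      rw [h] at this
      obtain ⟨h', χ₀, rfl⟩ := this
      rw [DirichletCharacter.conductor_changeLevel] at h
      exact ⟨χ₀, h, rfl⟩
    · rintro ⟨χ₀, h, rfl⟩
      rw [DirichletCharacter.conductor_changeLevel]
      exact h
  unfold condPart
  rw [h2, sum_image fun _ _ _ _ h => DirichletCharacter.changeLevel_injective hr h]
  refine (norm_sum_le _ _).trans (sum_le_sum fun ψ _ => ?_)
  rw [norm_mul, DirichletCharacter.unit_norm_eq_one, one_mul, charSum_changeLevel]
  apply le_of_eq
  congr 1
  unfold charSum coprimePart
  refine sum_congr rfl fun n _ => ?_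
  by_cases hn : n.Coprime r
  · have : n.Coprime q ↔ n.Coprime (q / r) := by
      conv_lhs => rw [← Nat.mul_div_cancel' hr]
      rw [Nat.coprime_mul_iff_right]
      exact ⟨fun h => h.2, fun h => ⟨hn, h⟩⟩
    simp only [this]
  · rw [MulChar.map_nonunit _ (by rwa [ZMod.isUnit_iff_coprime]), mul_zero, mul_zero]

lemma sum_antidiagonal_le (Q : ℕ) (F : ℕ → ℕ → ℝ) (hF : ∀ k r, 0 ≤ F k r) :
    ∑ q ∈ Icc 1 Q, ∑ p ∈ q.divisorsAntidiagonal, F p.1 p.2 ≤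
      ∑ k ∈ Icc 1 Q, ∑ r ∈ Icc 1 Q, F k r := by
  classical
  rw [sum_sigma', ← sum_product']
  have hinj : Set.InjOn (fun i : (_ : ℕ) × (ℕ × ℕ) => i.2)
      ((Icc 1 Q).sigma fun q => q.divisorsAntidiagonal) := by
    rintro ⟨q, p⟩ h ⟨q', p'⟩ h' he
    simp only [coe_sigma, Set.mem_sigma_iff, mem_coe, Nat.mem_divisorsAntidiagonal] at h h'
    simp only at he
    subst he
    rw [← h.2.1, ← h'.2.1]
  rw [← sum_image (f := fun p : ℕ × ℕ => F p.1 p.2) hinj]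
  refine sum_le_sum_of_subset_of_nonneg ?_ (fun p _ _ => hF _ _)
  intro p hp
  obtain ⟨⟨q, p'⟩, h, rfl⟩ := mem_image.mp hp
  simp only [mem_sigma, mem_Icc, Nat.mem_divisorsAntidiagonal] at h
  obtain ⟨⟨h1, h2⟩, h3, h4⟩ := h
  have p1 : 0 < p'.1 := Nat.pos_of_ne_zero fun h => h4 (by rw [← h3, h, zero_mul])
  have p2 : 0 < p'.2 := Nat.pos_of_ne_zero fun h => h4 (by rw [← h3, h, mul_zero])
  simp only [mem_product, mem_Icc]
  have e1 := Nat.le_mul_of_pos_right p'.1 p2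
  have e2 := Nat.le_mul_of_pos_left p'.2 p1
  omega

/-- Sum over the moduli of the large-conductor parts. -/
lemma sum_largePart_le (c : ℕ → ℂ) (x : ℝ) (R Q : ℕ) (b : (q : ℕ) → (ZMod q)ˣ) :
    ∑ q ∈ Icc 1 Q, ‖largePart c x R q (b q)‖ ≤
      ∑ k ∈ Icc 1 Q, (1 / (k.totient : ℝ)) *
        primMean R Q (fun _ ψ => charSum (coprimePart c k) x ψ) := by
  set P : ℕ → ℕ → ℝ := fun k r => ∑ ψ ∈ primChars r, ‖charSum (coprimePart c k) x ψ‖ with hP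
  have hP0 : ∀ k r, 0 ≤ P k r := fun k r => sum_nonneg fun _ _ => norm_nonneg _
  set F : ℕ → ℕ → ℝ := fun k r => if R < r then
    (1 / (k.totient : ℝ)) * (1 / (r.totient : ℝ)) * P k r else 0 with hF
  have hF0 : ∀ k r, 0 ≤ F k r := by
    intro k r
    simp only [hF]
    split_ifs
    · exact mul_nonneg (by positivity) (hP0 _ _)
    · exact le_rfl
  have h1 : ∀ q ∈ Icc 1 Q, ‖largePart c x R q (b q)‖ ≤
      ∑ p ∈ q.divisorsAntidiagonal, F p.1 p.2 := by
    intro q hq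
    rw [mem_Icc] at hq
    have : NeZero q := ⟨by omega⟩
    unfold largePart
    rw [norm_mul, norm_div, norm_one, Complex.norm_natCast, Nat.sum_divisorsAntidiagonal' F]
    simp only [hF]
    rw [← sum_filter]
    refine (mul_le_mul_of_nonneg_left (norm_sum_le _ _) (by positivity)).trans ?_
    rw [mul_sum]
    refine sum_le_sum fun r hr => ?_
    rw [mem_filter, Nat.mem_divisors] at hr
    have hr0 : 0 < r := Nat.pos_of_dvd_of_pos hr.1.1 hq.1
    have hk0 : 0 < q / r := Nat.div_pos (Nat.le_of_dvd hq.1 hr.1.1) hr0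
    -- From `φ(k) φ(r) ≤ φ(k r)` with `k = q/r`.
    have htot : (1 : ℝ) / q.totient ≤ 1 / (q / r).totient * (1 / r.totient) := by
      rw [one_div_mul_one_div]
      apply one_div_le_one_div_of_le
      · have := Nat.totient_pos.mpr hr0
        have := Nat.totient_pos.mpr hk0
        positivity
      · have := Nat.totient_super_multiplicative (q / r) r
        rw [Nat.div_mul_cancel hr.1.1] at this
        exact_mod_cast this
    exact mul_le_mul htot (norm_condPart_le_sum_primChars c x _ hr.1.1) (norm_nonneg _)
      (by positivity)
  refine (sum_le_sum h1).trans ((sum_antidiagonal_le Q F hF0).trans ?_)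
  refine sum_le_sum fun k _ => ?_
  simp only [hF]
  rw [← sum_filter]
  unfold primMean
  rw [mul_sum]
  simp_rw [mul_assoc]
  refine sum_le_sum_of_subset_of_nonneg ?_ (fun r _ _ => by positivity)
  intro r hr
  rw [mem_filter, mem_Icc] at hr
  rw [mem_Ioc]
  omega

/-! ### The logarithmic derivative and the class `ClassC` -/

lemma norm_le_vonMangoldt {Lam : ArithmeticFunction ℂ}
    (h : ∀ n : ℕ, 1 ≤ n → ‖Lam n‖ ≤ ArithmeticFunction.vonMangoldt n) (n : ℕ) :
    ‖Lam n‖ ≤ ArithmeticFunction.vonMangoldt n := by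
  rcases Nat.eq_zero_or_pos n with rfl | hn
  · simp
  · exact h n hn

lemma sum_antidiagonal_vonMangoldt (n : ℕ) :
    ∑ p ∈ n.divisorsAntidiagonal, ArithmeticFunction.vonMangoldt p.1 = Real.log n := by
  rw [Nat.sum_divisorsAntidiagonal (fun i _ => ArithmeticFunction.vonMangoldt i),
    ArithmeticFunction.vonMangoldt_sum]

/-- A function whose logarithmic derivative is dominated by `Λ` is bounded by `1`. -/
lemma norm_le_one_of_isLambda {h Lam : ArithmeticFunction ℂ} (hL : IsLambda h Lam)
    (hb : ∀ n : ℕ, ‖Lam n‖ ≤ ArithmeticFunction.vonMangoldt n) (h1 : ‖h 1‖ ≤ 1) (n : ℕ) :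
    ‖h n‖ ≤ 1 := by
  induction n using Nat.strong_induction_on with
  | _ n ih =>
  rcases Nat.lt_or_ge n 2 with hn | hn
  · interval_cases n
    · simp
    · exact h1
  have hlog : 0 < Real.log n := Real.log_pos (by exact_mod_cast hn)
  have e := hL n
  have h2 : ‖h n‖ * Real.log n ≤ 1 * Real.log n := by
    calc ‖h n‖ * Real.log n = ‖(Lam * h) n‖ := by
          rw [e, norm_mul, Complex.norm_of_nonneg hlog.le]
      _ ≤ ∑ p ∈ n.divisorsAntidiagonal, ‖Lam p.1 * h p.2‖ := by
          rw [ArithmeticFunction.mul_apply]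
          exact norm_sum_le _ _
      _ ≤ ∑ p ∈ n.divisorsAntidiagonal, ArithmeticFunction.vonMangoldt p.1 := by
          refine sum_le_sum fun p hp => ?_
          rw [Nat.mem_divisorsAntidiagonal] at hp
          rw [norm_mul]
          -- The only term in which `h` is evaluated at `n` itself has `p.1 = 1`, and it vanishes
          -- since `Λ(1) = 0`; the induction hypothesis covers the rest.
          by_cases hp1 : p.1 = 1
          · have := hb 1
            rw [ArithmeticFunction.vonMangoldt_apply_one] at this
            rw [hp1, ArithmeticFunction.vonMangoldt_apply_one,
              le_antisymm this (norm_nonneg _), zero_mul]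
          · have hp0 : p.1 ≠ 0 := fun h0 => hp.2 (by rw [← hp.1, h0, zero_mul])
            have hp2 : p.2 ≠ 0 := fun h0 => hp.2 (by rw [← hp.1, h0, mul_zero])
            have hlt : p.2 < n := by
              rw [← hp.1]
              have : 2 ≤ p.1 := by omega
              nlinarith [Nat.pos_of_ne_zero hp2]
            calc ‖Lam p.1‖ * ‖h p.2‖ ≤ ArithmeticFunction.vonMangoldt p.1 * 1 := by
                  gcongr
                  · exact hb _
                  · exact ih _ hlt
              _ = _ := mul_one _
      _ = 1 * Real.log n := by rw [sum_antidiagonal_vonMangoldt, one_mul]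
  exact le_of_mul_le_mul_right h2 hlog

lemma ClassC.norm_le_one {f : ArithmeticFunction ℂ} (hf : ClassC f) (n : ℕ) : ‖f n‖ ≤ 1 := by
  obtain ⟨hm, Lam, hL, hb⟩ := hf
  exact norm_le_one_of_isLambda hL (norm_le_vonMangoldt hb) (by simp [hm.map_one]) n

/-- The derivation `h ↦ h · log` of the ring of arithmetic functions. -/
def logDeriv (h : ArithmeticFunction ℂ) : ArithmeticFunction ℂ :=
  ⟨fun n => h n * (Real.log n : ℂ), by simp⟩

lemma logDeriv_apply (h : ArithmeticFunction ℂ) (n : ℕ) :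
    logDeriv h n = h n * (Real.log n : ℂ) := rfl

lemma isLambda_iff {h Lam : ArithmeticFunction ℂ} : IsLambda h Lam ↔ Lam * h = logDeriv h :=
  ⟨fun H => ArithmeticFunction.ext H, fun H n => by rw [H]; rfl⟩

lemma logDeriv_mul (a b : ArithmeticFunction ℂ) :
    logDeriv (a * b) = logDeriv a * b + a * logDeriv b := by
  ext n
  rw [logDeriv_apply, ArithmeticFunction.add_apply, ArithmeticFunction.mul_apply,
    ArithmeticFunction.mul_apply, ArithmeticFunction.mul_apply, sum_mul, ← sum_add_distrib]
  refine sum_congr rfl fun p hp => ?_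
  rw [Nat.mem_divisorsAntidiagonal] at hp
  have h1 : (p.1 : ℝ) ≠ 0 := fun h => hp.2 (by rw [← hp.1, Nat.cast_eq_zero.mp h, zero_mul])
  have h2 : (p.2 : ℝ) ≠ 0 := fun h => hp.2 (by rw [← hp.1, Nat.cast_eq_zero.mp h, mul_zero])
  rw [logDeriv_apply, logDeriv_apply, ← hp.1]
  push_cast
  rw [Real.log_mul h1 h2]
  push_cast
  ring

/-- A product is coprime to `q` exactly when both factors are, so the restriction commutes with
convolution and the restricted function has the restricted logarithmic derivative. -/
lemma logDeriv_coprimePart {f Lam : ArithmeticFunction ℂ} (hL : IsLambda f Lam) (q : ℕ) (n : ℕ) :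
    ∑ p ∈ n.divisorsAntidiagonal, coprimePart Lam q p.1 * coprimePart f q p.2 =
      coprimePart f q n * (Real.log n : ℂ) := by
  unfold coprimePart
  by_cases hn : n.Coprime q
  · rw [if_pos hn, ← hL n, ArithmeticFunction.mul_apply]
    refine sum_congr rfl fun p hp => ?_
    rw [Nat.mem_divisorsAntidiagonal] at hp
    rw [← hp.1, Nat.coprime_mul_iff_left] at hn
    rw [if_pos hn.1, if_pos hn.2]
  · rw [if_neg hn, zero_mul]
    refine sum_eq_zero fun p hp => ?_
    rw [Nat.mem_divisorsAntidiagonal] at hp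
    rw [← hp.1, Nat.coprime_mul_iff_left] at hn
    by_cases h1 : p.1.Coprime q
    · rw [if_neg (fun h2 => hn ⟨h1, h2⟩), mul_zero]
    · rw [if_neg h1, zero_mul]

/-- The restriction of `f ∈ 𝒞` to integers coprime to `q` is the convolution of `f` with a bounded
function supported on integers composed of primes dividing `q`. -/
lemma exists_coprime_convolution {f : ArithmeticFunction ℂ} (hf : ClassC f) (q : ℕ) :
    ∃ g : ArithmeticFunction ℂ, (∀ n, (g * f) n = coprimePart f q n) ∧ (∀ n, ‖g n‖ ≤ 1) ∧
      ∀ n, g n ≠ 0 → ∀ p : ℕ, p.Prime → p ∣ n → p ∣ q := by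
  obtain ⟨hm, Lam, hL, hb⟩ := hf
  replace hb := norm_le_vonMangoldt hb
  obtain ⟨u, hu⟩ : IsUnit f :=
    ArithmeticFunction.isUnit_iff_isUnit_apply_one.mpr (by rw [hm.map_one]; exact isUnit_one)
  have hz : coprimePart f q 0 = 0 := by unfold coprimePart; simp
  have hz' : coprimePart Lam q 0 = 0 := by unfold coprimePart; simp
  set fq : ArithmeticFunction ℂ := ⟨coprimePart f q, hz⟩ with hfq
  set Lq : ArithmeticFunction ℂ := ⟨coprimePart Lam q, hz'⟩ with hLq
  have hLq' : IsLambda fq Lq := fun n => by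
    rw [ArithmeticFunction.mul_apply]
    exact logDeriv_coprimePart hL q n
  set g : ArithmeticFunction ℂ := fq * (↑u⁻¹ : ArithmeticFunction ℂ) with hg
  have hgf : g * f = fq := by rw [hg, ← hu, mul_assoc, Units.inv_mul, mul_one]
  -- Logarithmic derivatives of quotients subtract. The difference is `-Λ_f` off the integers
  -- coprime to `q` and `0` on them, hence again dominated by `Λ`; this is why `g` is bounded by
  -- `1`.
  have hgL : IsLambda g (Lq - Lam) := by
    rw [isLambda_iff]
    have h1 := isLambda_iff.mp hLq'
    have h2 := isLambda_iff.mp hL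
    have h3 := logDeriv_mul g f
    rw [hgf, ← h1, ← h2, ← hgf] at h3
    have h4 : ((Lq - Lam) * g) * f = logDeriv g * f := by
      have : ((Lq - Lam) * g) * f = Lq * (g * f) - g * (Lam * f) := by ring
      rw [this, h3, add_sub_cancel_right]
    rw [← hu] at h4
    exact u.isUnit.mul_left_injective h4
  have hLsub : ∀ n, (Lq - Lam) n = if n.Coprime q then 0 else - Lam n := by
    intro n
    rw [sub_eq_add_neg, ArithmeticFunction.add_apply, ArithmeticFunction.neg_apply]
    show coprimePart Lam q n + _ = _
    unfold coprimePart
    split_ifs <;> ring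
  have hg1 : g 1 = 1 := by
    have := congrArg (fun h : ArithmeticFunction ℂ => h 1) hgf
    simp only [ArithmeticFunction.mul_apply_one, hm.map_one, mul_one] at this
    rw [this]
    show coprimePart f q 1 = 1
    unfold coprimePart
    simp [hm.map_one]
  refine ⟨g, fun n => by rw [hgf]; rfl, ?_, ?_⟩
  · refine norm_le_one_of_isLambda hgL (fun n => ?_) (by simp [hg1])
    rw [hLsub]
    split_ifs
    · simp
    · rw [norm_neg]; exact hb n
  · intro n
    induction n using Nat.strong_induction_on with
    | _ n ih =>
    intro hn p hp hpn
    by_contra hpq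
    apply hn
    have hn0 : n ≠ 0 := by rintro rfl; simp at hn
    have hn2 : 2 ≤ n := hp.two_le.trans (Nat.le_of_dvd (Nat.pos_of_ne_zero hn0) hpn)
    have hlog : (Real.log n : ℂ) ≠ 0 := by
      exact_mod_cast (Real.log_pos (by exact_mod_cast hn2)).ne'
    have e := hgL n
    -- In a nonzero term the first factor is a power of a prime dividing `q`, and by induction the
    -- second is composed of such primes, which excludes `p`. So `g(n) log n = 0`.
    have hsum : ((Lq - Lam) * g) n = 0 := by
      rw [ArithmeticFunction.mul_apply]
      refine sum_eq_zero fun d hd => ?_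
      rw [Nat.mem_divisorsAntidiagonal] at hd
      rw [hLsub]
      split_ifs with hc
      · rw [zero_mul]
      · by_contra hne
        have hLd : Lam d.1 ≠ 0 := fun h => hne (by rw [h]; simp)
        have hgd : g d.2 ≠ 0 := fun h => hne (by rw [h]; simp)
        have hΛ : ArithmeticFunction.vonMangoldt d.1 ≠ 0 := fun h => hLd (by
          have := hb d.1
          rw [h] at this
          exact norm_le_zero_iff.mp this)
        rw [ArithmeticFunction.vonMangoldt_ne_zero_iff] at hΛ
        have hd1 : d.1 ≠ 0 := fun h => hd.2 (by rw [← hd.1, h, zero_mul])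
        have hd2 : d.2 ≠ 0 := fun h => hd.2 (by rw [← hd.1, h, mul_zero])
        have hlt : d.2 < n := by
          rw [← hd.1]
          have := hΛ.one_lt
          nlinarith [Nat.pos_of_ne_zero hd2]
        rw [← hd.1, hp.dvd_mul] at hpn
        rcases hpn with h1 | h1
        · obtain ⟨p', k, hp', hk, hpk⟩ := hΛ
          rw [← hpk] at h1 hc
          have hpp : p = p' := (Nat.prime_dvd_prime_iff_eq hp hp'.nat_prime).mp (hp.dvd_of_dvd_pow h1)
          subst hpp
          apply hc
          exact Nat.Coprime.pow_left _ ((Nat.Prime.coprime_iff_not_dvd hp).mpr hpq)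
        · exact hpq (ih _ hlt hgd p hp h1)
    rw [hsum] at e
    rcases mul_eq_zero.mp e.symm with h | h
    · exact h
    · exact absurd h hlog

/-! ### Additive functions over a set of primes -/

/-- The completely additive function `∑_{p ∈ P} v_p(n) log p`. -/
def primeLog (P : Finset ℕ) (n : ℕ) : ℝ :=
  n.factorization.sum fun p v => if p ∈ P then v * Real.log p else 0

lemma primeLog_mul (P : Finset ℕ) {a b : ℕ} (ha : a ≠ 0) (hb : b ≠ 0) :
    primeLog P (a * b) = primeLog P a + primeLog P b := by
  unfold primeLog
  rw [Nat.factorization_mul ha hb, Finsupp.sum_add_index']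
  · intro p; simp
  · intro p v w
    split_ifs
    · push_cast; ring
    · simp

lemma primeLog_nonneg (P : Finset ℕ) (n : ℕ) : 0 ≤ primeLog P n := by
  unfold primeLog Finsupp.sum
  refine sum_nonneg fun p _ => ?_
  beta_reduce
  split_ifs
  · positivity
  · exact le_rfl

/-- The part of `n` composed of primes in `P`. -/
def primePart (P : Finset ℕ) (n : ℕ) : ℕ := ∏ p ∈ n.primeFactors with p ∈ P, p ^ n.factorization p

/-- The part of `n` composed of primes outside `P`. -/
def coprimePrimePart (P : Finset ℕ) (n : ℕ) : ℕ :=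
  ∏ p ∈ n.primeFactors with p ∉ P, p ^ n.factorization p

lemma primePart_mul_coprimePrimePart (P : Finset ℕ) {n : ℕ} (hn : n ≠ 0) :
    primePart P n * coprimePrimePart P n = n := by
  unfold primePart coprimePrimePart
  rw [prod_filter_mul_prod_filter_not]
  exact Nat.prod_factorization_pow_eq_self hn

lemma prime_dvd_primePart {P : Finset ℕ} {n p : ℕ} (hp : p.Prime) (h : p ∣ primePart P n) :
    p ∈ P := by
  unfold primePart at h
  rw [Prime.dvd_finsetProd_iff hp.prime] at h
  obtain ⟨p', hp', hd⟩ := h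
  rw [mem_filter] at hp'
  have := (Nat.prime_dvd_prime_iff_eq hp (Nat.prime_of_mem_primeFactors hp'.1)).mp
    (hp.dvd_of_dvd_pow hd)
  rw [this]; exact hp'.2

lemma prime_dvd_coprimePrimePart {P : Finset ℕ} {n p : ℕ} (hp : p.Prime)
    (h : p ∣ coprimePrimePart P n) : p ∉ P := by
  unfold coprimePrimePart at h
  rw [Prime.dvd_finsetProd_iff hp.prime] at h
  obtain ⟨p', hp', hd⟩ := h
  rw [mem_filter] at hp'
  have := (Nat.prime_dvd_prime_iff_eq hp (Nat.prime_of_mem_primeFactors hp'.1)).mp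
    (hp.dvd_of_dvd_pow hd)
  rw [this]; exact hp'.2

lemma coprime_primePart (P : Finset ℕ) (n : ℕ) :
    (primePart P n).Coprime (coprimePrimePart P n) :=
  Nat.coprime_of_dvd fun _ hp h1 h2 =>
    prime_dvd_coprimePrimePart hp h2 (prime_dvd_primePart hp h1)

lemma primeLog_eq_log_primePart (P : Finset ℕ) (n : ℕ) :
    primeLog P n = Real.log (primePart P n) := by
  unfold primeLog primePart Finsupp.sum
  rw [Nat.cast_prod, Real.log_prod, sum_filter]
  · refine sum_congr rfl fun p _ => ?_
    simp
  · intro p hp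
    rw [mem_filter] at hp
    have := (Nat.prime_of_mem_primeFactors hp.1).pos
    positivity

/-- The restriction of `Lam` to powers of primes in `P`. -/
def lambdaOn (P : Finset ℕ) (Lam : ℕ → ℂ) (a : ℕ) : ℂ := if a.minFac ∈ P then Lam a else 0

lemma exists_prime_pow_of_lambdaOn_ne_zero {Lam : ℕ → ℂ} {P : Finset ℕ}
    (hb : ∀ n : ℕ, ‖Lam n‖ ≤ ArithmeticFunction.vonMangoldt n) {a : ℕ}
    (ha : lambdaOn P Lam a ≠ 0) : ∃ p k, p.Prime ∧ 0 < k ∧ p ^ k = a ∧ p ∈ P := by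
  unfold lambdaOn at ha
  rw [ite_ne_right_iff] at ha
  have hΛ : ArithmeticFunction.vonMangoldt a ≠ 0 := fun h => ha.2 (by
    have := hb a
    rw [h] at this
    exact norm_le_zero_iff.mp this)
  rw [ArithmeticFunction.vonMangoldt_ne_zero_iff] at hΛ
  obtain ⟨p, k, hp, hk, rfl⟩ := hΛ
  rw [hp.nat_prime.pow_minFac hk.ne'] at ha
  exact ⟨p, k, hp.nat_prime, hk, rfl, ha.1⟩

/-- Factor `n = n₁ n₂` into its parts inside and outside `P`. Then `primeLog P n = log n₁`, and the
identity for `Λ_f` is applied to `n₁` alone; multiplication by `f n₂` restores `f(n/a)`. Powers of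
primes in `P` divide `n` exactly when they divide `n₁`. -/
lemma ClassC.primeLog_identity {f Lam : ArithmeticFunction ℂ} (hm : f.IsMultiplicative)
    (hL : IsLambda f Lam) (hb : ∀ n : ℕ, ‖Lam n‖ ≤ ArithmeticFunction.vonMangoldt n)
    (P : Finset ℕ) {n : ℕ} (hn : n ≠ 0) :
    f n * (primeLog P n : ℂ) = ∑ p ∈ n.divisorsAntidiagonal, lambdaOn P Lam p.1 * f p.2 := by
  set n₁ := primePart P n with hn₁
  set n₂ := coprimePrimePart P n with hn₂
  have hmul : n₁ * n₂ = n := primePart_mul_coprimePrimePart P hn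
  have hcop : n₁.Coprime n₂ := coprime_primePart P n
  have hn₁0 : n₁ ≠ 0 := fun h => hn (by rw [← hmul, h, zero_mul])
  have hL1 : Lam 1 = 0 := by
    have := hb 1
    rw [ArithmeticFunction.vonMangoldt_apply_one] at this
    exact norm_le_zero_iff.mp this
  have e1 : f n = f n₁ * f n₂ := by rw [← hmul, hm.map_mul_of_coprime hcop]
  rw [e1, primeLog_eq_log_primePart, mul_right_comm, ← hL n₁, ArithmeticFunction.mul_apply,
    Nat.sum_divisorsAntidiagonal (fun a b => Lam a * f b),
    Nat.sum_divisorsAntidiagonal (fun a b => lambdaOn P Lam a * f b), sum_mul]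
  have hsub : n₁.divisors ⊆ n.divisors := Nat.divisors_subset_of_dvd hn ⟨n₂, hmul.symm⟩
  rw [← sum_subset hsub]
  · refine sum_congr rfl fun a ha => ?_
    have had := Nat.dvd_of_mem_divisors ha
    have e2 : n / a = n₁ / a * n₂ := by
      conv_lhs => rw [← hmul]
      exact Nat.mul_div_right_comm had n₂ |>.symm ▸ rfl
    have e3 : f (n / a) = f (n₁ / a) * f n₂ := by
      rw [e2, hm.map_mul_of_coprime]
      exact Nat.Coprime.coprime_dvd_left (Nat.div_dvd_of_dvd had) hcop
    rw [e3, ← mul_assoc]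
    congr 2
    unfold lambdaOn
    by_cases ha1 : a = 1
    · subst ha1; simp [hL1]
    · rw [if_pos]
      exact prime_dvd_primePart (Nat.minFac_prime ha1) ((Nat.minFac_dvd a).trans had)
  · intro a ha hna
    have had := Nat.dvd_of_mem_divisors ha
    by_contra hne
    have hl : lambdaOn P Lam a ≠ 0 := fun h => hne (by rw [h, zero_mul])
    obtain ⟨p, k, hp, hk, rfl, hpP⟩ := exists_prime_pow_of_lambdaOn_ne_zero hb hl
    apply hna
    rw [Nat.mem_divisors]
    refine ⟨?_, hn₁0⟩
    rw [← hmul] at had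
    refine Nat.Coprime.dvd_of_dvd_mul_right ?_ had
    refine Nat.Coprime.pow_left _ ((Nat.Prime.coprime_iff_not_dvd hp).mpr ?_)
    exact fun h => prime_dvd_coprimePrimePart hp h hpP

/-! ### Bilinear sums under a hyperbola -/

lemma sqrt_mul_sqrt_add_le {a b c d : ℝ} (ha : 0 ≤ a) (hb : 0 ≤ b) (hc : 0 ≤ c) (hd : 0 ≤ d) :
    √a * √b + √c * √d ≤ √(a + c) * √(b + d) := by
  rw [← Real.sqrt_mul (add_nonneg ha hc)]
  apply Real.le_sqrt_of_sq_le
  have h1 := Real.sq_sqrt ha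
  have h2 := Real.sq_sqrt hb
  have h3 := Real.sq_sqrt hc
  have h4 := Real.sq_sqrt hd
  nlinarith [sq_nonneg (√a * √d - √b * √c)]

/-- A bilinear bound for rectangles gives one for the region between a rectangle and a hyperbola,
at the cost of the number of halvings. -/
lemma primMean_residual_le (R Q N U V : ℕ) (hU : 0 < U) (hV : N / U ≤ V) (α β : ℕ → ℂ) {K : ℝ}
    (hK : 0 ≤ K)
    (hbil : ∀ s t : Finset ℕ, (∀ a ∈ s, a ≤ 2 * U) → (∀ b ∈ t, b ≤ V) →
      primMean R Q (fun _ ψ => (∑ a ∈ s, α a * ψ a) * ∑ b ∈ t, β b * ψ b) ≤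
        K * (√(∑ a ∈ s, ‖α a‖ ^ 2) * √(∑ b ∈ t, ‖β b‖ ^ 2))) (j : ℕ) :
    ∀ s : ℕ, U ≤ s → s + 2 ^ j ≤ 2 * U →
      primMean R Q (fun _ ψ => ∑ a ∈ Ioc s (s + 2 ^ j), α a * ψ a *
          ∑ b ∈ Ioc (N / (s + 2 ^ j)) (N / a), β b * ψ b) ≤
        j * K * (√(∑ a ∈ Ioc s (s + 2 ^ j), ‖α a‖ ^ 2) *
          √(∑ b ∈ Ioc (N / (s + 2 ^ j)) (N / s), ‖β b‖ ^ 2)) := by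
  induction j with
  | zero =>
    intro s _ _
    simp [primMean]
  | succ j ih =>
    intro s hs ht
    set m := s + 2 ^ j with hm
    set t := s + 2 ^ (j + 1) with htdef
    have hmt : m + 2 ^ j = t := by rw [hm, htdef, pow_succ]; ring
    have hsm : s ≤ m := Nat.le_add_right _ _
    have hmt' : m ≤ t := hmt ▸ Nat.le_add_right _ _
    have i1 := ih s hs (by omega)
    have i2 := ih m (by omega) (by omega)
    rw [hmt] at i2
    rw [← hm] at i1
    have hNtm : N / t ≤ N / m := Nat.div_le_div_left hmt' (by omega)
    have hNms : N / m ≤ N / s := Nat.div_le_div_left hsm (by omega)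
    have hrect := hbil (Ioc s m) (Ioc (N / t) (N / m))
      (fun a ha => by rw [mem_Ioc] at ha; omega)
      (fun b hb => by
        rw [mem_Ioc] at hb
        have : N / m ≤ N / U := Nat.div_le_div_left (by omega) hU
        omega)
    -- Cutting at the midpoint `m` leaves one rectangle, `a ∈ (s, m]` with `b ∈ (N/t, N/m]`, and two
    -- regions of the original shape and half the width.
    have hdec : ∀ (r : ℕ) (ψ : DirichletCharacter ℂ r),
        ∑ a ∈ Ioc s t, α a * ψ a * ∑ b ∈ Ioc (N / t) (N / a), β b * ψ b =
        (∑ a ∈ Ioc s m, α a * ψ a) * (∑ b ∈ Ioc (N / t) (N / m), β b * ψ b) +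
        (∑ a ∈ Ioc s m, α a * ψ a * ∑ b ∈ Ioc (N / m) (N / a), β b * ψ b +
         ∑ a ∈ Ioc m t, α a * ψ a * ∑ b ∈ Ioc (N / t) (N / a), β b * ψ b) := by
      intro r ψ
      rw [← sum_Ioc_consecutive _ hsm hmt', ← add_assoc, sum_mul, ← sum_add_distrib]
      congr 1
      refine sum_congr rfl fun a ha => ?_
      rw [mem_Ioc] at ha
      have hNma : N / m ≤ N / a := Nat.div_le_div_left ha.2 (by omega)
      rw [← sum_Ioc_consecutive _ hNtm hNma, mul_add]
    simp_rw [hdec]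
    refine (primMean_add_le _ _ _ _).trans
      ((add_le_add hrect ((primMean_add_le _ _ _ _).trans (add_le_add i1 i2))).trans ?_)
    rw [← sum_Ioc_consecutive (fun a => ‖α a‖ ^ 2) hsm hmt',
      ← sum_Ioc_consecutive (fun b => ‖β b‖ ^ 2) hNtm hNms]
    set A₁ := ∑ a ∈ Ioc s m, ‖α a‖ ^ 2
    set A₂ := ∑ a ∈ Ioc m t, ‖α a‖ ^ 2
    set B₁ := ∑ b ∈ Ioc (N / t) (N / m), ‖β b‖ ^ 2
    set B₂ := ∑ b ∈ Ioc (N / m) (N / s), ‖β b‖ ^ 2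
    have hA₁ : 0 ≤ A₁ := sum_nonneg fun _ _ => by positivity
    have hA₂ : 0 ≤ A₂ := sum_nonneg fun _ _ => by positivity
    have hB₁ : 0 ≤ B₁ := sum_nonneg fun _ _ => by positivity
    have hB₂ : 0 ≤ B₂ := sum_nonneg fun _ _ => by positivity
    have c1 : √A₁ * √B₁ ≤ √(A₁ + A₂) * √(B₁ + B₂) := by
      gcongr <;> linarith
    -- The two smaller regions use disjoint ranges of `a` and disjoint ranges of `b`, so
    -- Cauchy-Schwarz recombines them without loss. Each halving thus adds one `K`, for a total of
    -- `j K`.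
    have c2 : √A₁ * √B₂ + √A₂ * √B₁ ≤ √(A₁ + A₂) * √(B₁ + B₂) := by
      rw [add_comm B₁]
      exact sqrt_mul_sqrt_add_le hA₁ hB₂ hA₂ hB₁
    calc K * (√A₁ * √B₁) + (j * K * (√A₁ * √B₂) + j * K * (√A₂ * √B₁))
        = K * (√A₁ * √B₁) + j * K * (√A₁ * √B₂ + √A₂ * √B₁) := by ring
      _ ≤ K * (√(A₁ + A₂) * √(B₁ + B₂)) + j * K * (√(A₁ + A₂) * √(B₁ + B₂)) := by gcongr
      _ = _ := by push_cast; ring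

/-- For `a` in a dyadic block, the region `ab ≤ N` is the rectangle `b ≤ N/2^(i+1)` together with a
residual region of width `2^i`. The factor `i + 1` counts the rectangle and the `i` halvings. -/
lemma primMean_hyperbola_block_le (R Q N i : ℕ) (hR : 0 < R) (α β : ℕ → ℂ) :
    primMean R Q (fun _ ψ => ∑ a ∈ Ioc (2 ^ i) (2 ^ (i + 1)), α a * ψ a *
          ∑ b ∈ Icc 1 (N / a), β b * ψ b) ≤
      (i + 1) * (45 * (Nat.log 2 Q + 1) *
        (Q + √((2 : ℝ) ^ (i + 1)) + √((N : ℝ) / 2 ^ i) + √(2 * N) / R)) *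
        (√(∑ a ∈ Ioc (2 ^ i) (2 ^ (i + 1)), ‖α a‖ ^ 2) *
          √(∑ b ∈ Icc 1 (N / 2 ^ i), ‖β b‖ ^ 2)) := by
  set U := 2 ^ i with hU
  have hU0 : 0 < U := by positivity
  have hU2 : 2 ^ (i + 1) = U + 2 ^ i := by rw [pow_succ]; omega
  set K : ℝ := 45 * (Nat.log 2 Q + 1) *
        (Q + √((2 : ℝ) ^ (i + 1)) + √((N : ℝ) / 2 ^ i) + √(2 * N) / R) with hKdef
  have hK : 0 ≤ K := by positivity
  have hR' : (0 : ℝ) < R := by exact_mod_cast hR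
  have hdiv : ((N / U : ℕ) : ℝ) ≤ (N : ℝ) / 2 ^ i := by
    refine Nat.cast_div_le.trans (le_of_eq ?_)
    rw [hU]; push_cast; rfl
  have hbil : ∀ s t : Finset ℕ, (∀ a ∈ s, a ≤ 2 * U) → (∀ b ∈ t, b ≤ N / U) →
      primMean R Q (fun _ ψ => (∑ a ∈ s, α a * ψ a) * ∑ b ∈ t, β b * ψ b) ≤
        K * (√(∑ a ∈ s, ‖α a‖ ^ 2) * √(∑ b ∈ t, ‖β b‖ ^ 2)) := by
    intro s t hs ht
    refine (primMean_bilinear_le R Q (2 * U) (N / U) hR s t hs ht α β).trans ?_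
    have e1 : ((2 * U : ℕ) : ℝ) = 2 ^ (i + 1) := by rw [hU]; push_cast; ring
    have e2 : ((2 * U : ℕ) : ℝ) * ((N / U : ℕ) : ℝ) ≤ 2 * N := by
      have : (U : ℝ) * ((N / U : ℕ) : ℝ) ≤ N := by exact_mod_cast Nat.mul_div_le N U
      push_cast
      linarith
    rw [hKdef]
    gcongr
    rw [e1]
  have hres := primMean_residual_le R Q N U (N / U) hU0 le_rfl α β hK hbil i U le_rfl
    (by rw [← hU]; omega)
  rw [← hU2] at hres
  set T := 2 ^ (i + 1) with hT
  have hUT : U ≤ T := by omega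
  have hNTU : N / T ≤ N / U := Nat.div_le_div_left hUT hU0
  have hrect := hbil (Ioc U T) (Icc 1 (N / T)) (fun a ha => by rw [mem_Ioc] at ha; omega)
    (fun b hb => by rw [mem_Icc] at hb; omega)
  have hIcc : ∀ m, Icc 1 m = Ioc 0 m := fun m => rfl
  have hdec : ∀ (r : ℕ) (ψ : DirichletCharacter ℂ r),
      ∑ a ∈ Ioc U T, α a * ψ a * ∑ b ∈ Icc 1 (N / a), β b * ψ b =
      (∑ a ∈ Ioc U T, α a * ψ a) * (∑ b ∈ Icc 1 (N / T), β b * ψ b) +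
      ∑ a ∈ Ioc U T, α a * ψ a * ∑ b ∈ Ioc (N / T) (N / a), β b * ψ b := by
    intro r ψ
    rw [sum_mul, ← sum_add_distrib]
    refine sum_congr rfl fun a ha => ?_
    rw [mem_Ioc] at ha
    have hNTa : N / T ≤ N / a := Nat.div_le_div_left ha.2 (by omega)
    rw [hIcc, hIcc, ← sum_Ioc_consecutive _ (Nat.zero_le _) hNTa, mul_add]
  simp_rw [hdec]
  refine (primMean_add_le _ _ _ _).trans ((add_le_add hrect hres).trans ?_)
  set X := √(∑ a ∈ Ioc U T, ‖α a‖ ^ 2)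
  have s1 : ∑ b ∈ Icc 1 (N / T), ‖β b‖ ^ 2 ≤ ∑ b ∈ Icc 1 (N / U), ‖β b‖ ^ 2 :=
    sum_le_sum_of_subset_of_nonneg (Icc_subset_Icc_right hNTU) fun _ _ _ => by positivity
  have s2 : ∑ b ∈ Ioc (N / T) (N / U), ‖β b‖ ^ 2 ≤ ∑ b ∈ Icc 1 (N / U), ‖β b‖ ^ 2 := by
    refine sum_le_sum_of_subset_of_nonneg ?_ fun _ _ _ => by positivity
    rw [hIcc]
    exact Ioc_subset_Ioc_left (Nat.zero_le _)
  calc _ ≤ K * (X * √(∑ b ∈ Icc 1 (N / U), ‖β b‖ ^ 2)) +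
        i * K * (X * √(∑ b ∈ Icc 1 (N / U), ‖β b‖ ^ 2)) := by gcongr
    _ = _ := by ring

/-- Bilinear sums over `ab ≤ N` with `a` restricted to `(Z, Y]`. -/
theorem primMean_hyperbola_le (R Q N Z Y : ℕ) (hR : 0 < R) (hZ : 0 < Z) (α β : ℕ → ℂ) {ℓ : ℝ}
    (hℓ : 0 ≤ ℓ) (hα : ∀ a, a ≤ N → ‖α a‖ ≤ ℓ) (hα0 : ∀ a, α a ≠ 0 → Z < a ∧ a ≤ Y)
    (hβ : ∀ b, b ≤ N → ‖β b‖ ≤ 1) :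
    primMean R Q (fun _ ψ => ∑ a ∈ Icc 1 N, α a * ψ a * ∑ b ∈ Icc 1 (N / a), β b * ψ b) ≤
      (Nat.log 2 N + 1) ^ 2 * (45 * (Nat.log 2 Q + 1) *
        (Q + √(2 * Y) + √(2 * N / Z) + √(2 * N) / R)) * (√N * ℓ) := by
  set k := Nat.log 2 N + 1 with hk
  have hNk : N ≤ 2 ^ k := (Nat.lt_pow_succ_log_self (b := 2) (by norm_num) N).le
  have hα1 : α 1 = 0 := by
    by_contra h
    have := (hα0 1 h).1
    omega
  have hZ' : (0 : ℝ) < Z := by exact_mod_cast hZ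
  have hR' : (0 : ℝ) < R := by exact_mod_cast hR
  -- truncate `α` to `[1, N]`
  set α' : ℕ → ℂ := fun a => if a ≤ N then α a else 0 with hα'
  have hα'n : ∀ a, ‖α' a‖ ≤ ℓ := by
    intro a
    simp only [hα']
    split_ifs with h
    · exact hα a h
    · simpa using hℓ
  have hα'0 : ∀ a, α' a ≠ 0 → Z < a ∧ a ≤ Y := by
    intro a h
    simp only [hα', ite_ne_right_iff] at h
    exact hα0 a h.2
  have hα'1 : α' 1 = 0 := by simp only [hα', hα1, ite_self]
  have hdec : ∀ (r : ℕ) (ψ : DirichletCharacter ℂ r),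
      ∑ a ∈ Icc 1 N, α a * ψ a * ∑ b ∈ Icc 1 (N / a), β b * ψ b =
      ∑ i ∈ range k, ∑ a ∈ Ioc (2 ^ i) (2 ^ (i + 1)), α' a * ψ a *
        ∑ b ∈ Icc 1 (N / a), β b * ψ b := by
    intro r ψ
    have h1 : ∀ k : ℕ, ∑ i ∈ range k, ∑ a ∈ Ioc (2 ^ i) (2 ^ (i + 1)), α' a * ψ a *
        ∑ b ∈ Icc 1 (N / a), β b * ψ b = ∑ a ∈ Icc 1 (2 ^ k), α' a * ψ a *
        ∑ b ∈ Icc 1 (N / a), β b * ψ b := by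
      intro k
      induction k with
      | zero => simp [hα'1]
      | succ k ih =>
        rw [sum_range_succ, ih]
        exact sum_Ioc_consecutive (m := 0) _ (Nat.zero_le _)
          (Nat.pow_le_pow_right (by norm_num) (by omega))
    rw [h1]
    rw [← sum_subset (Icc_subset_Icc_right hNk)]
    · refine sum_congr rfl fun a ha => ?_
      rw [mem_Icc] at ha
      simp only [hα', if_pos ha.2]
    · intro a ha ha'
      rw [mem_Icc] at ha ha'
      have : ¬ a ≤ N := fun h => ha' ⟨ha.1, h⟩
      simp only [hα', if_neg this, zero_mul]
  simp_rw [hdec]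
  refine (primMean_sum_le _ _ _ _).trans ?_
  set B : ℝ := 45 * (Nat.log 2 Q + 1) *
        (Q + √(2 * Y) + √(2 * N / Z) + √(2 * N) / R) with hB
  have hB0 : 0 ≤ B := by positivity
  have hblock : ∀ i ∈ range k, primMean R Q (fun _ ψ => ∑ a ∈ Ioc (2 ^ i) (2 ^ (i + 1)),
      α' a * ψ a * ∑ b ∈ Icc 1 (N / a), β b * ψ b) ≤ k * B * (√N * ℓ) := by
    intro i hi
    rw [mem_range] at hi
    -- A block meeting the support of `α'` satisfies `2^i < Y` and `Z < 2^(i+1)`, which bounds the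
    -- two square roots in its estimate.
    by_cases hne : ∃ a ∈ Ioc (2 ^ i) (2 ^ (i + 1)), α' a ≠ 0
    · obtain ⟨a, ha, hane⟩ := hne
      rw [mem_Ioc] at ha
      have haZY := hα'0 a hane
      refine (primMean_hyperbola_block_le R Q N i hR α' β).trans ?_
      have hpos : (0 : ℝ) < 2 ^ i := by positivity
      have e1 : (2 : ℝ) ^ (i + 1) ≤ 2 * Y := by
        have : 2 ^ i ≤ Y := by omega
        have : (2 : ℝ) ^ i ≤ Y := by exact_mod_cast this
        rw [pow_succ]; linarith
      have e2 : (N : ℝ) / 2 ^ i ≤ 2 * N / Z := by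
        rw [div_le_div_iff₀ hpos hZ']
        have : Z ≤ 2 * 2 ^ i := by rw [pow_succ] at ha; omega
        have : (Z : ℝ) ≤ 2 * 2 ^ i := by exact_mod_cast this
        nlinarith [(Nat.cast_nonneg N : (0 : ℝ) ≤ N)]
      have e3 : ((i : ℝ) + 1) ≤ k := by exact_mod_cast hi
      have n1 : ∑ a ∈ Ioc (2 ^ i) (2 ^ (i + 1)), ‖α' a‖ ^ 2 ≤ 2 ^ i * ℓ ^ 2 := by
        calc _ ≤ ∑ a ∈ Ioc (2 ^ i) (2 ^ (i + 1)), ℓ ^ 2 :=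
              sum_le_sum fun a _ => by
                have := hα'n a
                gcongr
          _ = _ := by
              rw [sum_const, Nat.card_Ioc, nsmul_eq_mul]
              congr 1
              rw [pow_succ, show 2 ^ i * 2 - 2 ^ i = 2 ^ i by omega]
              push_cast; rfl
      have n2 : ∑ b ∈ Icc 1 (N / 2 ^ i), ‖β b‖ ^ 2 ≤ (N : ℝ) / 2 ^ i := by
        calc _ ≤ ∑ b ∈ Icc 1 (N / 2 ^ i), (1 : ℝ) := sum_le_sum fun b hb => by
              rw [mem_Icc] at hb
              have := hβ b (hb.2.trans (Nat.div_le_self _ _))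
              exact pow_le_one₀ (norm_nonneg _) this
          _ = ((N / 2 ^ i : ℕ) : ℝ) := by simp
          _ ≤ _ := by
              refine Nat.cast_div_le.trans (le_of_eq ?_)
              push_cast; rfl
      have n3 : √(∑ a ∈ Ioc (2 ^ i) (2 ^ (i + 1)), ‖α' a‖ ^ 2) *
          √(∑ b ∈ Icc 1 (N / 2 ^ i), ‖β b‖ ^ 2) ≤ √N * ℓ := by
        calc _ ≤ √(2 ^ i * ℓ ^ 2) * √((N : ℝ) / 2 ^ i) := by gcongr
          _ = √N * ℓ := by
            rw [← Real.sqrt_mul (by positivity),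
              show (2 : ℝ) ^ i * ℓ ^ 2 * (N / 2 ^ i) = N * ℓ ^ 2 by field_simp,
              Real.sqrt_mul (by positivity), Real.sqrt_sq hℓ]
      rw [hB]
      gcongr
    · push Not at hne
      have : ∀ (r : ℕ) (ψ : DirichletCharacter ℂ r), ∑ a ∈ Ioc (2 ^ i) (2 ^ (i + 1)),
          α' a * ψ a * ∑ b ∈ Icc 1 (N / a), β b * ψ b = 0 := by
        intro r ψ
        refine sum_eq_zero fun a ha => ?_
        rw [hne a ha, zero_mul, zero_mul]
      simp_rw [this]
      have h0 : primMean R Q (fun _ _ => 0) = 0 := by simp [primMean]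
      rw [h0]
      positivity
  refine (sum_le_sum hblock).trans (le_of_eq ?_)
  rw [sum_const, card_range, nsmul_eq_mul, hk]
  push_cast
  ring

lemma sum_antidiagonal_eq {M : Type*} [AddCommMonoid M] (N : ℕ) (H : ℕ → ℕ → M) :
    ∑ n ∈ Icc 1 N, ∑ p ∈ n.divisorsAntidiagonal, H p.1 p.2 =
      ∑ a ∈ Icc 1 N, ∑ b ∈ Icc 1 (N / a), H a b := by
  rw [sum_sigma', sum_sigma']
  refine sum_nbij' (fun i => ⟨i.2.1, i.2.2⟩) (fun i => ⟨i.1 * i.2, (i.1, i.2)⟩) ?_ ?_ ?_ ?_ ?_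
  · rintro ⟨n, a, b⟩ h
    simp only [mem_sigma, mem_Icc, Nat.mem_divisorsAntidiagonal] at h ⊢
    obtain ⟨⟨h1, h2⟩, rfl, h4⟩ := h
    have ha : 0 < a := Nat.pos_of_ne_zero fun h => h4 (by rw [h, zero_mul])
    have hb : 0 < b := Nat.pos_of_ne_zero fun h => h4 (by rw [h, mul_zero])
    refine ⟨⟨ha, (Nat.le_mul_of_pos_right a hb).trans h2⟩, hb, ?_⟩
    rw [Nat.le_div_iff_mul_le ha, mul_comm]
    exact h2
  · rintro ⟨a, b⟩ h
    simp only [mem_sigma, mem_Icc, Nat.mem_divisorsAntidiagonal] at h ⊢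
    obtain ⟨⟨h1, h2⟩, h3, h4⟩ := h
    rw [Nat.le_div_iff_mul_le h1, mul_comm] at h4
    have := Nat.mul_pos h1 h3
    exact ⟨⟨this, h4⟩, trivial, this.ne'⟩
  · rintro ⟨n, a, b⟩ h
    simp only [mem_sigma, mem_Icc, Nat.mem_divisorsAntidiagonal] at h
    obtain ⟨_, rfl, _⟩ := h
    rfl
  · rintro ⟨a, b⟩ _
    rfl
  · rintro ⟨n, a, b⟩ _
    rfl

/-! ### Integers with a large smooth divisor or a large square divisor -/

lemma prod_Ioc_div_sub_one_sq (Z : ℕ) (hZ : 1 ≤ Z) :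
    ∏ n ∈ Ioc 1 Z, ((n : ℝ) / (n - 1)) ^ 2 = (Z : ℝ) ^ 2 := by
  induction Z, hZ using Nat.le_induction with
  | base => simp
  | succ n hn ih =>
    rw [← insert_Ioc_right_eq_Ioc_add_one (by omega), prod_insert (by simp), ih]
    have : (n : ℝ) ≠ 0 := by positivity
    push_cast
    rw [add_sub_cancel_right, div_pow, div_mul_cancel₀ _ (pow_ne_zero 2 this)]

/-- Rankin's bound for a sum over smooth numbers. -/
lemma sum_smooth_rpow_le (Z N : ℕ) (hZ : 1 ≤ Z) {κ : ℝ} (hκ1 : κ < 1)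
    (hκ0 : 0 ≤ κ) (hκZ : (Z : ℝ) ^ κ ≤ 3 / 2) :
    ∑ d ∈ Icc 1 N with d ∈ Nat.smoothNumbers (Z + 1), (d : ℝ) ^ (κ - 1) ≤ (Z : ℝ) ^ 2 := by
  classical
  set h : ℕ →* ℝ :=
    { toFun := fun d => (d : ℝ) ^ (κ - 1)
      map_one' := by simp
      map_mul' := fun a b => by
        push_cast
        rw [Real.mul_rpow (by positivity) (by positivity)] } with hh
  have happ : ∀ d, h d = (d : ℝ) ^ (κ - 1) := fun d => rfl
  have hlt : ∀ {p : ℕ}, p.Prime → ‖h p‖ < 1 := by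
    intro p hp
    rw [happ, Real.norm_of_nonneg (by positivity)]
    exact Real.rpow_lt_one_of_one_lt_of_neg (by exact_mod_cast hp.one_lt) (by linarith)
  obtain ⟨hsum, hhas⟩ :=
    EulerProduct.summable_and_hasSum_smoothNumbers_prod_primesBelow_geometric hlt (Z + 1)
  have step1 : ∑ d ∈ Icc 1 N with d ∈ Nat.smoothNumbers (Z + 1), (d : ℝ) ^ (κ - 1) ≤
      ∏ p ∈ (Z + 1).primesBelow, (1 - h p)⁻¹ := by
    rw [← hhas.tsum_eq]
    have := hhas.summable.sum_le_tsum
      ((Icc 1 N).filter (· ∈ Nat.smoothNumbers (Z + 1)) |>.subtype (· ∈ Nat.smoothNumbers (Z + 1)))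
      (fun i _ => by rw [happ]; positivity)
    refine le_trans (le_of_eq ?_) this
    rw [sum_subtype_eq_sum_filter, filter_filter]
    simp only [and_self, happ]
  refine step1.trans ?_
  rw [← prod_Ioc_div_sub_one_sq Z hZ]
  calc ∏ p ∈ (Z + 1).primesBelow, (1 - h p)⁻¹
      ≤ ∏ p ∈ (Z + 1).primesBelow, ((p : ℝ) / (p - 1)) ^ 2 := by
        refine prod_le_prod (fun p hp => ?_) fun p hp => ?_
        · have := hlt (Nat.prime_of_mem_primesBelow hp)
          rw [Real.norm_eq_abs, abs_lt] at this
          exact inv_nonneg.mpr (by linarith)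
        · have hpp := Nat.prime_of_mem_primesBelow hp
          have hpZ : (p : ℝ) ≤ Z := by
            have := Nat.lt_of_mem_primesBelow hp
            exact_mod_cast (by omega : p ≤ Z)
          have hp2 : (2 : ℝ) ≤ p := by exact_mod_cast hpp.two_le
          have e1 : h p ≤ 3 / 2 / p := by
            rw [happ, Real.rpow_sub_one (by positivity)]
            gcongr
            exact (Real.rpow_le_rpow (by positivity) hpZ hκ0).trans hκZ
          have e2 : (1 : ℝ) - 3 / 2 / p = (p - 3 / 2) / p := by field_simp
          have e3 : 0 < (p : ℝ) - 3 / 2 := by linarith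
          calc (1 - h p)⁻¹ ≤ (1 - 3 / 2 / (p : ℝ))⁻¹ := by
                apply inv_anti₀
                · rw [e2]; positivity
                · linarith
            _ = p / (p - 3 / 2) := by rw [e2, inv_div]
            -- After clearing denominators this is exactly `p ≥ 2`; the constant `3/2` in the
            -- hypothesis on `κ` is chosen for it. The squares then telescope to `Z²`.
            _ ≤ _ := by
                rw [div_pow, div_le_div_iff₀ e3 (by nlinarith)]
                nlinarith
    _ ≤ _ := by
        refine prod_le_prod_of_subset_of_one_le (fun p hp => ?_) (fun p _ => by positivity)
          fun p hp _ => ?_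
        · have := Nat.lt_of_mem_primesBelow hp
          have := (Nat.prime_of_mem_primesBelow hp).two_le
          rw [mem_Ioc]
          omega
        · have hp2 : (2 : ℝ) ≤ p := by exact_mod_cast (mem_Ioc.mp hp).1
          apply one_le_pow₀
          rw [one_le_div (by linarith)]
          linarith

/-- Few integers have a large smooth divisor. -/
lemma card_large_smooth_divisor_le (Z N : ℕ) (hZ : 1 ≤ Z) {κ E : ℝ} (hκ1 : κ < 1)
    (hκ0 : 0 ≤ κ) (hκZ : (Z : ℝ) ^ κ ≤ 3 / 2) (hE : 0 < E) (S : Finset ℕ)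
    (hS : ∀ n ∈ S, n ∈ Icc 1 N ∧ ∃ d ∈ Nat.smoothNumbers (Z + 1), d ∣ n ∧ E < d) :
    (S.card : ℝ) ≤ N * (E ^ (-κ) * (Z : ℝ) ^ 2) := by
  classical
  set D := (Icc 1 N).filter (fun d => d ∈ Nat.smoothNumbers (Z + 1)) with hD
  set D' := D.filter (fun d : ℕ => E < d) with hD'
  have hsub : S ⊆ D'.biUnion fun d => (Ioc 0 N).filter (d ∣ ·) := by
    intro n hn
    obtain ⟨h1, d, hd, hdn, hEd⟩ := hS n hn
    rw [mem_Icc] at h1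
    rw [mem_biUnion]
    refine ⟨d, ?_, ?_⟩
    · rw [hD', hD, mem_filter, mem_filter, mem_Icc]
      exact ⟨⟨⟨Nat.pos_of_dvd_of_pos hdn h1.1, (Nat.le_of_dvd h1.1 hdn).trans h1.2⟩, hd⟩, hEd⟩
    · rw [mem_filter, mem_Ioc]
      exact ⟨⟨h1.1, h1.2⟩, hdn⟩
  have h1 : (S.card : ℝ) ≤ ∑ d ∈ D', ((N / d : ℕ) : ℝ) := by
    have := (card_le_card hsub).trans card_biUnion_le
    simp_rw [Nat.Ioc_filter_dvd_card_eq_div] at this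
    exact_mod_cast this
  calc (S.card : ℝ) ≤ ∑ d ∈ D', ((N / d : ℕ) : ℝ) := h1
    -- Rankin's trick: `1 ≤ (d/E)^κ` for the divisors `d > E`.
    _ ≤ ∑ d ∈ D', N * (E ^ (-κ) * (d : ℝ) ^ (κ - 1)) := by
        refine sum_le_sum fun d hd => ?_
        have hEd : E < d := (mem_filter.mp hd).2
        have hd0 : (0 : ℝ) < d := hE.trans hEd
        refine Nat.cast_div_le.trans ?_
        rw [div_eq_mul_inv]
        gcongr
        rw [Real.rpow_sub_one hd0.ne', Real.rpow_neg hE.le, ← mul_div_assoc, ← div_eq_inv_mul,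
          inv_eq_one_div]
        gcongr
        rw [one_le_div (by positivity)]
        gcongr
    _ ≤ ∑ d ∈ D, N * (E ^ (-κ) * (d : ℝ) ^ (κ - 1)) :=
        sum_le_sum_of_subset_of_nonneg (filter_subset _ _) fun _ _ _ => by positivity
    _ = N * (E ^ (-κ) * ∑ d ∈ D, (d : ℝ) ^ (κ - 1)) := by rw [mul_sum, mul_sum]
    _ ≤ _ := by
        gcongr
        exact sum_smooth_rpow_le Z N hZ hκ1 hκ0 hκZ

lemma card_square_divisor_le (Z N : ℕ) (hZ : 1 ≤ Z) (S : Finset ℕ)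
    (hS : ∀ n ∈ S, n ∈ Icc 1 N ∧ ∃ p, Z < p ∧ p ^ 2 ∣ n) : (S.card : ℝ) ≤ N / Z := by
  classical
  have hsub : S ⊆ (Ioc Z N).biUnion fun d => (Ioc 0 N).filter (d ^ 2 ∣ ·) := by
    intro n hn
    obtain ⟨h1, p, hp, hpn⟩ := hS n hn
    rw [mem_Icc] at h1
    rw [mem_biUnion]
    refine ⟨p, ?_, ?_⟩
    · rw [mem_Ioc]
      refine ⟨hp, ?_⟩
      calc p ≤ p ^ 2 := Nat.le_self_pow (by norm_num) _
        _ ≤ n := Nat.le_of_dvd h1.1 hpn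
        _ ≤ N := h1.2
    · rw [mem_filter, mem_Ioc]
      exact ⟨⟨h1.1, h1.2⟩, hpn⟩
  have h1 : (S.card : ℝ) ≤ ∑ d ∈ Ioc Z N, ((N / d ^ 2 : ℕ) : ℝ) := by
    have := (card_le_card hsub).trans card_biUnion_le
    simp_rw [Nat.Ioc_filter_dvd_card_eq_div] at this
    exact_mod_cast this
  have h2 : ∑ d ∈ Ioc Z N, ((d : ℝ) ^ 2)⁻¹ ≤ (Z : ℝ)⁻¹ := by
    rcases le_or_gt Z N with h | h
    · refine (sum_Ioc_inv_sq_le_sub (by omega) h).trans ?_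
      have : (0 : ℝ) ≤ (N : ℝ)⁻¹ := by positivity
      linarith
    · rw [Ioc_eq_empty (by omega)]; simp
  calc (S.card : ℝ) ≤ ∑ d ∈ Ioc Z N, ((N / d ^ 2 : ℕ) : ℝ) := h1
    _ ≤ ∑ d ∈ Ioc Z N, N * ((d : ℝ) ^ 2)⁻¹ := by
        refine sum_le_sum fun d _ => ?_
        refine Nat.cast_div_le.trans (le_of_eq ?_)
        push_cast; rw [div_eq_mul_inv]
    _ = N * ∑ d ∈ Ioc Z N, ((d : ℝ) ^ 2)⁻¹ := by rw [mul_sum]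
    _ ≤ N * (Z : ℝ)⁻¹ := by gcongr
    _ = _ := by rw [div_eq_mul_inv]

/-! ### Smooth numbers: bilinear decomposition of the smooth part -/

/-- The restriction of `f` to integers free of prime factors exceeding `Y`. -/
def smoothPart (f : ℕ → ℂ) (Y : ℕ) : ℕ → ℂ :=
  open Classical in fun n => if n ∈ Nat.smoothNumbers (Y + 1) then f n else 0

/-- The primes in `(Z, Y]`. -/
def primesIoc (Z Y : ℕ) : Finset ℕ := (Ioc Z Y).filter Nat.Prime

/-- Multiplying by a power of a prime at most `Y` and coprime to `k` neither creates nor destroys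
`Y`-smoothness or coprimality to `k`, so both restrictions pass through `ClassC.primeLog_identity`.
-/
lemma smoothPart_identity {f Lam : ArithmeticFunction ℂ} (hm : f.IsMultiplicative)
    (hL : IsLambda f Lam) (hb : ∀ n : ℕ, ‖Lam n‖ ≤ ArithmeticFunction.vonMangoldt n)
    (k Z Y : ℕ) {n : ℕ} (hn : n ≠ 0) :
    coprimePart (smoothPart f Y) k n * (primeLog (primesIoc Z Y) n : ℂ) =
      ∑ p ∈ n.divisorsAntidiagonal, coprimePart (lambdaOn (primesIoc Z Y) Lam) k p.1 *
        coprimePart (smoothPart f Y) k p.2 := by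
  classical
  by_cases h : n ∈ Nat.smoothNumbers (Y + 1) ∧ n.Coprime k
  · have e : coprimePart (smoothPart f Y) k n = f n := by
      unfold coprimePart smoothPart
      rw [if_pos h.2, if_pos h.1]
    rw [e, ClassC.primeLog_identity hm hL hb _ hn]
    refine sum_congr rfl fun p hp => ?_
    rw [Nat.mem_divisorsAntidiagonal] at hp
    have hc := h.2
    rw [← hp.1, Nat.coprime_mul_iff_left] at hc
    have hs : p.2 ∈ Nat.smoothNumbers (Y + 1) :=
      Nat.mem_smoothNumbers_of_dvd h.1 ⟨p.1, by rw [mul_comm]; exact hp.1.symm⟩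
    unfold coprimePart smoothPart
    rw [if_pos hc.1, if_pos hc.2, if_pos hs]
  · have e : coprimePart (smoothPart f Y) k n = 0 := by
      unfold coprimePart smoothPart
      by_cases h1 : n.Coprime k
      · rw [if_pos h1, if_neg (fun h2 => h ⟨h2, h1⟩)]
      · rw [if_neg h1]
    rw [e, zero_mul]
    symm
    refine sum_eq_zero fun p hp => ?_
    rw [Nat.mem_divisorsAntidiagonal] at hp
    by_contra hne
    have h1 : coprimePart (lambdaOn (primesIoc Z Y) Lam) k p.1 ≠ 0 :=
      fun h0 => hne (by rw [h0, zero_mul])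
    have h2 : coprimePart (smoothPart f Y) k p.2 ≠ 0 := fun h0 => hne (by rw [h0, mul_zero])
    unfold coprimePart at h1 h2
    unfold smoothPart at h2
    rw [ite_ne_right_iff] at h1 h2
    obtain ⟨h2a, h2b⟩ := h2
    rw [ite_ne_right_iff] at h2b
    obtain ⟨p', j, hp', hj, hpj, hP⟩ := exists_prime_pow_of_lambdaOn_ne_zero hb h1.2
    apply h
    rw [← hp.1]
    refine ⟨Nat.mul_mem_smoothNumbers ?_ h2b.1, Nat.Coprime.mul_left h1.1 h2a⟩
    rw [Nat.mem_smoothNumbers']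
    intro p'' hp'' hd
    rw [← hpj] at hd
    rw [(Nat.prime_dvd_prime_iff_eq hp'' hp').mp (hp''.dvd_of_dvd_pow hd)]
    unfold primesIoc at hP
    rw [mem_filter, mem_Ioc] at hP
    omega

lemma norm_smoothPart_le_one {f : ℕ → ℂ} (hf : ∀ n, ‖f n‖ ≤ 1) (k Y n : ℕ) :
    ‖coprimePart (smoothPart f Y) k n‖ ≤ 1 := by
  unfold coprimePart smoothPart
  split_ifs <;> simp [hf]

lemma norm_coprimePart_lambdaOn_le {Lam : ℕ → ℂ}
    (hb : ∀ n : ℕ, ‖Lam n‖ ≤ ArithmeticFunction.vonMangoldt n) (P : Finset ℕ) (k a : ℕ) :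
    ‖coprimePart (lambdaOn P Lam) k a‖ ≤ ArithmeticFunction.vonMangoldt a := by
  unfold coprimePart lambdaOn
  split_ifs
  · exact hb a
  · simp
  · simp

lemma primeLog_le_log (P : Finset ℕ) {n : ℕ} (hn : n ≠ 0) : primeLog P n ≤ Real.log n := by
  rw [primeLog_eq_log_primePart]
  have h := primePart_mul_coprimePrimePart P hn
  have h0 : primePart P n ≠ 0 := fun h0 => hn (by rw [← h, h0, zero_mul])
  apply Real.log_le_log
  · exact_mod_cast Nat.pos_of_ne_zero h0
  · exact_mod_cast Nat.le_of_dvd (Nat.pos_of_ne_zero hn) ⟨_, h.symm⟩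

/-- The bilinear part of the sum over smooth numbers. -/
lemma primMean_main_le {lam F ℓ : ℕ → ℂ} (R Q N Z Y j : ℕ) (hR : 0 < R) (hZ : 0 < Z) {B : ℝ}
    (hB : 0 ≤ B) (hlam : ∀ a, a ≤ N → ‖lam a‖ ≤ B) (hlam0 : ∀ a, lam a ≠ 0 → Z < a ∧ a ≤ Y)
    (hF : ∀ n, n ≤ N → ‖F n‖ ≤ 1) (hℓ : ∀ a b, a ≠ 0 → b ≠ 0 → ℓ (a * b) = ℓ a + ℓ b)
    (hℓ1 : ∀ a, a ≤ N → ‖ℓ a‖ ≤ 1) (hℓ2 : ∀ a, a ≤ N → ‖1 - ℓ a‖ ≤ 1) :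
    primMean R Q (fun _ ψ => ∑ n ∈ Icc 1 N, (∑ p ∈ n.divisorsAntidiagonal, lam p.1 * F p.2) *
        (1 - ℓ n) ^ j * ψ n) ≤
      2 ^ j * ((Nat.log 2 N + 1) ^ 2 * (45 * (Nat.log 2 Q + 1) *
        (Q + √(2 * Y) + √(2 * N / Z) + √(2 * N) / R)) * (√N * B)) := by
  -- Additivity of `ℓ` gives `1 - ℓ(ab) = (1 - ℓ b) + (-ℓ a)`, and the binomial theorem separates
  -- the variables. All weights have modulus at most `1`, so the total cost is `2^j`.
  have hdec : ∀ (r : ℕ) (ψ : DirichletCharacter ℂ r),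
      ∑ n ∈ Icc 1 N, (∑ p ∈ n.divisorsAntidiagonal, lam p.1 * F p.2) * (1 - ℓ n) ^ j * ψ n =
      ∑ m ∈ range (j + 1), (j.choose m : ℂ) * ∑ a ∈ Icc 1 N, (lam a * (- ℓ a) ^ (j - m)) * ψ a *
        ∑ b ∈ Icc 1 (N / a), (F b * (1 - ℓ b) ^ m) * ψ b := by
    intro r ψ
    have h1 : ∀ n ∈ Icc 1 N, (∑ p ∈ n.divisorsAntidiagonal, lam p.1 * F p.2) *
        (1 - ℓ n) ^ j * ψ n = ∑ p ∈ n.divisorsAntidiagonal,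
          ∑ m ∈ range (j + 1), (j.choose m : ℂ) * ((lam p.1 * (- ℓ p.1) ^ (j - m)) * ψ p.1 *
            ((F p.2 * (1 - ℓ p.2) ^ m) * ψ p.2)) := by
      intro n _
      rw [sum_mul, sum_mul]
      refine sum_congr rfl fun p hp => ?_
      rw [Nat.mem_divisorsAntidiagonal] at hp
      have hp1 : p.1 ≠ 0 := fun h => hp.2 (by rw [← hp.1, h, zero_mul])
      have hp2 : p.2 ≠ 0 := fun h => hp.2 (by rw [← hp.1, h, mul_zero])
      rw [← hp.1, hℓ _ _ hp1 hp2, Nat.cast_mul, map_mul,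
        show (1 : ℂ) - (ℓ p.1 + ℓ p.2) = (1 - ℓ p.2) + (- ℓ p.1) by ring, add_pow,
        mul_sum, sum_mul]
      refine sum_congr rfl fun m _ => ?_
      ring
    rw [sum_congr rfl h1, sum_antidiagonal_eq N (fun a b => ∑ m ∈ range (j + 1),
      (j.choose m : ℂ) * ((lam a * (- ℓ a) ^ (j - m)) * ψ a * ((F b * (1 - ℓ b) ^ m) * ψ b)))]
    simp_rw [mul_sum]
    rw [sum_congr rfl fun a _ => sum_comm, sum_comm]
  simp_rw [hdec]
  refine (primMean_sum_le _ _ _ _).trans ?_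
  set K : ℝ := (Nat.log 2 N + 1) ^ 2 * (45 * (Nat.log 2 Q + 1) *
        (Q + √(2 * Y) + √(2 * N / Z) + √(2 * N) / R)) * (√N * B) with hK
  have hterm : ∀ m ∈ range (j + 1), primMean R Q (fun _ ψ => (j.choose m : ℂ) *
      ∑ a ∈ Icc 1 N, (lam a * (- ℓ a) ^ (j - m)) * ψ a *
        ∑ b ∈ Icc 1 (N / a), (F b * (1 - ℓ b) ^ m) * ψ b) ≤ (j.choose m : ℝ) * K := by
    intro m _
    rw [primMean_const_mul, Complex.norm_natCast]
    gcongr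
    refine primMean_hyperbola_le R Q N Z Y hR hZ (fun a => lam a * (- ℓ a) ^ (j - m))
      (fun b => F b * (1 - ℓ b) ^ m) hB ?_ ?_ ?_
    · intro a ha
      rw [norm_mul, norm_pow, norm_neg]
      calc ‖lam a‖ * ‖ℓ a‖ ^ (j - m) ≤ B * 1 := by
            gcongr
            · exact hlam a ha
            · exact pow_le_one₀ (norm_nonneg _) (hℓ1 a ha)
        _ = B := mul_one _
    · intro a ha
      exact hlam0 a (left_ne_zero_of_mul ha)
    · intro b hb
      rw [norm_mul, norm_pow]
      exact mul_le_one₀ (hF b hb) (by positivity) (pow_le_one₀ (norm_nonneg _) (hℓ2 b hb))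
  refine (sum_le_sum hterm).trans (le_of_eq ?_)
  rw [← sum_mul, ← Nat.cast_sum, Nat.sum_range_choose]
  push_cast
  ring

lemma sum_norm_sq_le_card_mul {N : ℕ} (e : ℕ → ℂ) (S : Finset ℕ) {B : ℝ}
    (hS : S ⊆ Icc 1 N) (he : ∀ n ∈ Icc 1 N, ‖e n‖ ≤ B)
    (h0 : ∀ n ∈ Icc 1 N, n ∉ S → e n = 0) :
    ∑ n ∈ Icc 1 N, ‖e n‖ ^ 2 ≤ S.card * B ^ 2 := by
  rw [← sum_subset hS]
  · refine (sum_le_sum fun n hn => ?_).trans (le_of_eq ?_) (b := ∑ n ∈ S, B ^ 2)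
    · have := he n (hS hn)
      gcongr
    · rw [sum_const, nsmul_eq_mul]
  · intro n hn hn'
    rw [h0 n hn hn']; simp

/-- The mean over characters of large conductor of `f ∈ 𝒞` restricted to smooth numbers. -/
theorem primMean_smooth_le {f Lam : ArithmeticFunction ℂ} (hm : f.IsMultiplicative)
    (hL : IsLambda f Lam) (hb : ∀ n : ℕ, ‖Lam n‖ ≤ ArithmeticFunction.vonMangoldt n)
    (hf : ∀ n, ‖f n‖ ≤ 1) (k R Q Z Y J : ℕ) (hR : 0 < R) (hZ : 1 ≤ Z) {x κ T : ℝ} (hx : 2 ≤ x)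
    (hQ : (Q : ℝ) ≤ √(⌊x⌋₊ : ℝ)) (hκ1 : κ < 1) (hκ0 : 0 ≤ κ) (hκZ : (Z : ℝ) ^ κ ≤ 3 / 2) :
    primMean R Q (fun _ ψ => charSum (coprimePart (smoothPart f Y) k) x ψ) ≤
      J * (2 ^ J * ((Nat.log 2 ⌊x⌋₊ + 1) ^ 2 * (45 * (Nat.log 2 Q + 1) *
        (Q + √(2 * Y) + √(2 * x / Z) + √(2 * x) / R)) * √x) +
        180 * (Nat.log 2 Q + 1) * √x * √(x / Z)) +
      180 * (Nat.log 2 Q + 1) * √x *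
        √(x * ((2 * T / Real.log x) ^ (2 * J) + Real.exp (-T) +
          Real.exp (-κ * T) * (Z : ℝ) ^ 2)) := by
  classical
  set N := ⌊x⌋₊ with hN
  have hNx : (N : ℝ) ≤ x := Nat.floor_le (by linarith)
  have hN2 : 2 ≤ N := Nat.le_floor (by exact_mod_cast hx)
  set L := Real.log x with hLdef
  have hLpos : 0 < L := Real.log_pos (by linarith)
  set P := primesIoc Z Y with hP
  set F : ℕ → ℂ := coprimePart (smoothPart f Y) k with hFdef
  have hF1 : ∀ n, ‖F n‖ ≤ 1 := norm_smoothPart_le_one hf k Y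
  set lam : ℕ → ℂ := coprimePart (lambdaOn P Lam) k with hlamdef
  have hlamΛ : ∀ a, ‖lam a‖ ≤ ArithmeticFunction.vonMangoldt a :=
    norm_coprimePart_lambdaOn_le hb P k
  have hlam_pp : ∀ a, lam a ≠ 0 → ∃ p j, p.Prime ∧ 0 < j ∧ p ^ j = a ∧ Z < p ∧ p ≤ Y := by
    intro a ha
    simp only [hlamdef, coprimePart, ite_ne_right_iff] at ha
    obtain ⟨p, j, h1, h2, h3, h4⟩ := exists_prime_pow_of_lambdaOn_ne_zero hb ha.2
    rw [hP, primesIoc, mem_filter, mem_Ioc] at h4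
    exact ⟨p, j, h1, h2, h3, h4.1⟩
  have hlogn : ∀ n : ℕ, n ≤ N → Real.log n ≤ L := by
    intro n hn
    rcases Nat.eq_zero_or_pos n with rfl | h0
    · simpa using hLpos.le
    · apply Real.log_le_log (by exact_mod_cast h0)
      have : (n : ℝ) ≤ N := by exact_mod_cast hn
      linarith
  set w : ℕ → ℝ := fun n => primeLog P n / L with hw
  have hw0 : ∀ n, 0 ≤ w n := fun n => div_nonneg (primeLog_nonneg _ _) hLpos.le
  have hw1 : ∀ n, n ≤ N → w n ≤ 1 := by
    intro n hn
    rw [hw]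
    simp only
    rw [div_le_one hLpos]
    rcases Nat.eq_zero_or_pos n with rfl | h0
    · simpa [primeLog] using hLpos.le
    · exact (primeLog_le_log P h0.ne').trans (hlogn n hn)
  set ℓ : ℕ → ℂ := fun n => ((w n : ℝ) : ℂ) with hℓ
  have hℓadd : ∀ a b, a ≠ 0 → b ≠ 0 → ℓ (a * b) = ℓ a + ℓ b := by
    intro a b ha hb
    simp only [hℓ, hw]
    rw [primeLog_mul P ha hb]
    push_cast
    ring
  have hℓ1 : ∀ a, a ≤ N → ‖ℓ a‖ ≤ 1 := by
    intro a ha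
    rw [hℓ, Complex.norm_of_nonneg (hw0 a)]
    exact hw1 a ha
  have hℓ2' : ∀ a, a ≤ N → ‖1 - ℓ a‖ = 1 - w a := by
    intro a ha
    have : (1 : ℂ) - ℓ a = ((1 - w a : ℝ) : ℂ) := by simp only [hℓ]; push_cast; ring
    rw [this, Complex.norm_of_nonneg (by linarith [hw1 a ha])]
  have hℓ2 : ∀ a, a ≤ N → ‖1 - ℓ a‖ ≤ 1 := by
    intro a ha
    rw [hℓ2' a ha]
    linarith [hw0 a]
  -- The bilinear bound needs `a ≤ Y`. The discarded part `lam₂` lives on proper prime powers,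
  -- because the underlying primes are themselves at most `Y`.
  set lam₁ : ℕ → ℂ := fun a => if a ≤ Y then lam a else 0 with hlam₁
  set lam₂ : ℕ → ℂ := fun a => if a ≤ Y then 0 else lam a with hlam₂
  set e : ℕ → ℕ → ℂ := fun j n =>
    (∑ p ∈ n.divisorsAntidiagonal, lam₂ p.1 * F p.2) * (1 - ℓ n) ^ j with he
  -- the decomposition
  have hdec : ∀ (r : ℕ) (ψ : DirichletCharacter ℂ r), charSum F x ψ =
      ∑ j ∈ range J, ((L : ℂ)⁻¹ * ∑ n ∈ Icc 1 N, (∑ p ∈ n.divisorsAntidiagonal,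
          lam₁ p.1 * F p.2) * (1 - ℓ n) ^ j * ψ n +
        (L : ℂ)⁻¹ * ∑ n ∈ Icc 1 N, e j n * ψ n) +
      ∑ n ∈ Icc 1 N, (F n * (1 - ℓ n) ^ J) * ψ n := by
    intro r ψ
    -- Pointwise this is the geometric sum `1 - (1 - ℓ)^J = ℓ ∑_{j<J} (1 - ℓ)^j` multiplied by `F`,
    -- with `F ℓ L` replaced by the convolution of `lam` with `F`.
    have hpt : ∀ n ∈ Icc 1 N, F n = ∑ j ∈ range J, ((L : ℂ)⁻¹ * ((∑ p ∈ n.divisorsAntidiagonal,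
          lam₁ p.1 * F p.2) * (1 - ℓ n) ^ j) + (L : ℂ)⁻¹ * e j n) + F n * (1 - ℓ n) ^ J := by
      intro n hn
      rw [mem_Icc] at hn
      have hid := smoothPart_identity hm hL hb k Z Y (n := n) (by omega)
      have hsplit : ∑ p ∈ n.divisorsAntidiagonal, lam p.1 * F p.2 =
          ∑ p ∈ n.divisorsAntidiagonal, lam₁ p.1 * F p.2 +
          ∑ p ∈ n.divisorsAntidiagonal, lam₂ p.1 * F p.2 := by
        rw [← sum_add_distrib]
        refine sum_congr rfl fun p _ => ?_
        simp only [hlam₁, hlam₂]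
        split_ifs <;> ring
      have hLne : (L : ℂ) ≠ 0 := by exact_mod_cast hLpos.ne'
      have h1 : (L : ℂ)⁻¹ * (∑ p ∈ n.divisorsAntidiagonal, lam₁ p.1 * F p.2) +
          (L : ℂ)⁻¹ * (∑ p ∈ n.divisorsAntidiagonal, lam₂ p.1 * F p.2) = F n * ℓ n := by
        rw [← mul_add, ← hsplit, ← hid]
        simp only [hℓ, hw]
        push_cast
        field_simp
        rfl
      have h2 : ∀ j, (L : ℂ)⁻¹ * ((∑ p ∈ n.divisorsAntidiagonal, lam₁ p.1 * F p.2) *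
          (1 - ℓ n) ^ j) + (L : ℂ)⁻¹ * e j n = F n * ℓ n * (1 - ℓ n) ^ j := by
        intro j
        rw [← h1]
        simp only [he]
        ring
      simp_rw [h2]
      rw [← mul_sum]
      have h3 := mul_neg_geom_sum (1 - ℓ n) J
      rw [sub_sub_cancel] at h3
      rw [mul_assoc, h3]
      ring
    unfold charSum
    rw [sum_congr rfl fun n hn => by rw [hpt n hn, add_mul, sum_mul]]
    rw [sum_add_distrib, sum_comm]
    congr 1
    refine sum_congr rfl fun j _ => ?_
    rw [mul_sum, mul_sum, ← sum_add_distrib]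
    refine sum_congr rfl fun n _ => ?_
    ring
  simp_rw [hdec]
  refine (primMean_add_le _ _ _ _).trans (add_le_add ?_ ?_)
  · refine (primMean_sum_le _ _ _ _).trans ?_
    set K : ℝ := ((Nat.log 2 N + 1) ^ 2 * (45 * (Nat.log 2 Q + 1) *
        (Q + √(2 * Y) + √(2 * x / Z) + √(2 * x) / R)) * √x) with hK
    have hj : ∀ j ∈ range J, primMean R Q (fun r ψ =>
        (L : ℂ)⁻¹ * ∑ n ∈ Icc 1 N, (∑ p ∈ n.divisorsAntidiagonal,
          lam₁ p.1 * F p.2) * (1 - ℓ n) ^ j * ψ n +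
        (L : ℂ)⁻¹ * ∑ n ∈ Icc 1 N, e j n * ψ n) ≤
        2 ^ J * K + 180 * (Nat.log 2 Q + 1) * √x * √(x / Z) := by
      intro j hj
      rw [mem_range] at hj
      refine (primMean_add_le _ _ _ _).trans (add_le_add ?_ ?_)
      · rw [primMean_const_mul, norm_inv, Complex.norm_of_nonneg hLpos.le]
        have hmain := primMean_main_le (lam := lam₁) (F := F) (ℓ := ℓ) R Q N Z Y j hR hZ
          hLpos.le ?_ ?_ (fun n _ => hF1 n) hℓadd hℓ1 hℓ2
        · calc L⁻¹ * _ ≤ L⁻¹ * (2 ^ j * ((Nat.log 2 N + 1) ^ 2 * (45 * (Nat.log 2 Q + 1) *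
                (Q + √(2 * Y) + √(2 * N / Z) + √(2 * N) / R)) * (√N * L))) := by gcongr
            _ = 2 ^ j * ((Nat.log 2 N + 1) ^ 2 * (45 * (Nat.log 2 Q + 1) *
                (Q + √(2 * Y) + √(2 * N / Z) + √(2 * N) / R)) * √N) := by
                field_simp
            _ ≤ 2 ^ J * K := by
                rw [hK]
                gcongr
                · norm_num
        · intro a ha
          simp only [hlam₁]
          split_ifs
          · refine (hlamΛ a).trans (ArithmeticFunction.vonMangoldt_le_log.trans (hlogn a ha))
          · simpa using hLpos.le
        · intro a ha
          simp only [hlam₁, ite_ne_right_iff] at ha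
          obtain ⟨p, j', hp, hj', rfl, hZp, _⟩ := hlam_pp a ha.2
          exact ⟨hZp.trans_le (Nat.le_self_pow hj'.ne' p), ha.1⟩
      · rw [primMean_const_mul, norm_inv, Complex.norm_of_nonneg hLpos.le]
        have hlin := primMean_linear_le R Q N hR hQ (by omega) (Icc 1 N)
          (fun b hb => (mem_Icc.mp hb).2) (e j)
        have hnorm : ∑ n ∈ Icc 1 N, ‖e j n‖ ^ 2 ≤ x / Z * L ^ 2 := by
          -- If `lam₂` contributes at `n`, then some `p > Z` has `p² ∣ n`. Such `n` are few, so the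
          -- linear form of the large sieve suffices.
          set S := (Icc 1 N).filter fun n => ∃ p, Z < p ∧ p ^ 2 ∣ n with hS
          refine (sum_norm_sq_le_card_mul (e j) S (B := L) (filter_subset _ _) ?_ ?_).trans ?_
          · intro n hn
            rw [mem_Icc] at hn
            simp only [he]
            rw [norm_mul, norm_pow]
            calc _ ≤ L * 1 := by
                  gcongr
                  · refine (norm_sum_le _ _).trans ?_
                    calc _ ≤ ∑ p ∈ n.divisorsAntidiagonal,
                          ArithmeticFunction.vonMangoldt p.1 := by
                          refine sum_le_sum fun p _ => ?_
                          rw [norm_mul]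
                          have : ‖lam₂ p.1‖ ≤ ArithmeticFunction.vonMangoldt p.1 := by
                            simp only [hlam₂]
                            split_ifs
                            · simp
                            · exact hlamΛ _
                          calc _ ≤ ArithmeticFunction.vonMangoldt p.1 * 1 := by
                                gcongr
                                exact hF1 _
                            _ = _ := mul_one _
                      _ = Real.log n := sum_antidiagonal_vonMangoldt n
                      _ ≤ L := hlogn n hn.2
                  · exact pow_le_one₀ (norm_nonneg _) (hℓ2 n hn.2)
              _ = L := mul_one _
          · intro n hn hnS
            simp only [he]
            rw [sum_eq_zero, zero_mul]
            intro p hp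
            rw [Nat.mem_divisorsAntidiagonal] at hp
            by_contra hne
            have h1 : lam₂ p.1 ≠ 0 := left_ne_zero_of_mul hne
            simp only [hlam₂] at h1
            rw [ite_ne_left_iff] at h1
            obtain ⟨hpY, hl⟩ := h1
            obtain ⟨p', j', hp', hj', hpp, hZp, hpY'⟩ := hlam_pp p.1 (Ne.symm hl)
            apply hnS
            rw [hS, mem_filter]
            refine ⟨hn, p', hZp, ?_⟩
            have hj2 : 2 ≤ j' := by
              by_contra hlt
              have : j' = 1 := by omega
              rw [this, pow_one] at hpp
              omega
            exact (pow_dvd_pow p' hj2).trans (hpp ▸ ⟨p.2, hp.1.symm⟩)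
          · have hcard := card_square_divisor_le Z N hZ S (fun n hn => by
              rw [hS, mem_filter] at hn; exact hn)
            gcongr
            refine hcard.trans ?_
            gcongr
        calc L⁻¹ * _ ≤ L⁻¹ * (180 * (Nat.log 2 Q + 1) * √N * √(∑ n ∈ Icc 1 N, ‖e j n‖ ^ 2)) := by
              gcongr
          _ ≤ L⁻¹ * (180 * (Nat.log 2 Q + 1) * √x * √(x / Z * L ^ 2)) := by gcongr
          _ = _ := by
              rw [Real.sqrt_mul (by positivity), Real.sqrt_sq hLpos.le]
              field_simp
    refine (sum_le_sum hj).trans (le_of_eq ?_)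
    rw [sum_const, card_range, nsmul_eq_mul]
  · have hlin := primMean_linear_le R Q N hR hQ (by omega) (Icc 1 N)
      (fun b hb => (mem_Icc.mp hb).2) (fun n => F n * (1 - ℓ n) ^ J)
    refine hlin.trans ?_
    have hsum : ∑ n ∈ Icc 1 N, ‖F n * (1 - ℓ n) ^ J‖ ^ 2 ≤
        x * ((2 * T / L) ^ (2 * J) + Real.exp (-T) + Real.exp (-κ * T) * (Z : ℝ) ^ 2) := by
      -- Outside two sparse sets, `n` small or having a `Z`-smooth divisor exceeding `e^T`, the
      -- weight `w n` is close to `1`. On the exceptional sets the trivial bound `1` is used.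
      set S₁ := (Icc 1 N).filter fun n : ℕ => (n : ℝ) ≤ x * Real.exp (-T) with hS₁
      set S₂ := (Icc 1 N).filter fun n : ℕ => ∃ d ∈ Nat.smoothNumbers (Z + 1), d ∣ n ∧
        Real.exp T < d with hS₂
      have hpt : ∀ n ∈ Icc 1 N, ‖F n * (1 - ℓ n) ^ J‖ ^ 2 ≤
          (2 * T / L) ^ (2 * J) + ((if (n : ℝ) ≤ x * Real.exp (-T) then 1 else 0) +
          if ∃ d ∈ Nat.smoothNumbers (Z + 1), d ∣ n ∧ Real.exp T < d then 1 else 0) := by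
        intro n hn
        rw [mem_Icc] at hn
        have hle1 : ‖F n * (1 - ℓ n) ^ J‖ ^ 2 ≤ 1 := by
          rw [norm_mul, norm_pow]
          exact pow_le_one₀ (by positivity) (mul_le_one₀ (hF1 n) (by positivity)
            (pow_le_one₀ (norm_nonneg _) (hℓ2 n hn.2)))
        have hpos : 0 ≤ (2 * T / L) ^ (2 * J) := by
          rw [pow_mul]; positivity
        split_ifs with h1 h2 h2
        · linarith
        · linarith
        · linarith
        · by_cases hF0 : F n = 0
          · rw [hF0]
            simp only [zero_mul, norm_zero, add_zero]
            rw [zero_pow (by norm_num)]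
            exact hpos
          have hn0 : n ≠ 0 := by omega
          have hnpos : (0 : ℝ) < n := by exact_mod_cast hn.1
          have hsm : n ∈ Nat.smoothNumbers (Y + 1) := by
            by_contra hns
            apply hF0
            simp only [hFdef, coprimePart, smoothPart, if_neg hns, ite_self]
          set d := coprimePrimePart P n with hd
          have hmul := primePart_mul_coprimePrimePart P hn0
          have hd0 : d ≠ 0 := fun h => hn0 (by rw [← hmul, ← hd, h, mul_zero])
          have hpp0 : primePart P n ≠ 0 := fun h => hn0 (by rw [← hmul, h, zero_mul])
          have hdn : d ∣ n := ⟨primePart P n, by rw [mul_comm]; exact hmul.symm⟩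
          have hdsm : d ∈ Nat.smoothNumbers (Z + 1) := by
            rw [Nat.mem_smoothNumbers']
            intro p hp hpd
            have hpP := prime_dvd_coprimePrimePart hp hpd
            have hpY := Nat.mem_smoothNumbers'.mp hsm p hp (hpd.trans hdn)
            rw [hP, primesIoc, mem_filter, mem_Ioc] at hpP
            by_contra hlt
            exact hpP ⟨⟨by omega, by omega⟩, hp⟩
          have hdT : (d : ℝ) ≤ Real.exp T := by
            by_contra hlt
            exact h2 ⟨d, hdsm, hdn, not_le.mp hlt⟩
          have hlogd : Real.log d ≤ T := by
            rw [← Real.log_exp T]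
            exact Real.log_le_log (by exact_mod_cast Nat.pos_of_ne_zero hd0) hdT
          have hlogn' : L - T ≤ Real.log n := by
            have : x * Real.exp (-T) < n := not_le.mp h1
            have h3 := Real.log_le_log (by positivity) this.le
            rw [Real.log_mul (by positivity) (by positivity), Real.log_exp] at h3
            linarith
          have hlogsplit : Real.log n = primeLog P n + Real.log d := by
            rw [primeLog_eq_log_primePart, ← Real.log_mul (by exact_mod_cast hpp0)
              (by exact_mod_cast hd0), ← Nat.cast_mul, hmul]
          -- One `T` comes from `log n ≥ L - T`, the other from the part `d` of `n` composed of
          -- primes outside `P`.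
          have hwb : 1 - w n ≤ 2 * T / L := by
            simp only [hw]
            rw [le_div_iff₀ hLpos, sub_mul, div_mul_cancel₀ _ hLpos.ne']
            linarith
          have h1w : 0 ≤ 1 - w n := by linarith [hw1 n hn.2]
          rw [norm_mul, norm_pow, hℓ2' n hn.2, add_zero, add_zero, mul_pow, ← pow_mul,
            mul_comm J 2]
          calc _ ≤ 1 ^ 2 * (2 * T / L) ^ (2 * J) := by
                gcongr
                exact hF1 n
            _ = _ := by ring
      have hc1 : (S₁.card : ℝ) ≤ x * Real.exp (-T) := by
        have : S₁ ⊆ Icc 1 ⌊x * Real.exp (-T)⌋₊ := by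
          intro n hn
          rw [hS₁, mem_filter, mem_Icc] at hn
          rw [mem_Icc]
          exact ⟨hn.1.1, Nat.le_floor hn.2⟩
        have := card_le_card this
        rw [Nat.card_Icc, Nat.add_sub_cancel] at this
        calc (S₁.card : ℝ) ≤ ⌊x * Real.exp (-T)⌋₊ := by exact_mod_cast this
          _ ≤ _ := Nat.floor_le (by positivity)
      have hc2 : (S₂.card : ℝ) ≤ x * (Real.exp (-κ * T) * (Z : ℝ) ^ 2) := by
        refine (card_large_smooth_divisor_le Z N hZ hκ1 hκ0 hκZ (Real.exp_pos T) S₂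
          (fun n hn => by rw [hS₂, mem_filter] at hn; exact hn)).trans ?_
        rw [← Real.exp_mul, show T * -κ = -κ * T by ring]
        gcongr
      calc _ ≤ ∑ n ∈ Icc 1 N, ((2 * T / L) ^ (2 * J) +
          ((if (n : ℝ) ≤ x * Real.exp (-T) then (1 : ℝ) else 0) +
          if ∃ d ∈ Nat.smoothNumbers (Z + 1), d ∣ n ∧ Real.exp T < d then 1 else 0)) :=
            sum_le_sum hpt
        _ = N * (2 * T / L) ^ (2 * J) + (S₁.card + S₂.card) := by
            rw [sum_add_distrib, sum_add_distrib, sum_const, Nat.card_Icc, nsmul_eq_mul,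
              Nat.add_sub_cancel, ← sum_filter, ← sum_filter, sum_const, sum_const,
              nsmul_eq_mul, nsmul_eq_mul, mul_one, mul_one]
        _ ≤ x * (2 * T / L) ^ (2 * J) + (x * Real.exp (-T) +
            x * (Real.exp (-κ * T) * (Z : ℝ) ^ 2)) := by
            have : 0 ≤ (2 * T / L) ^ (2 * J) := by rw [pow_mul]; positivity
            gcongr
        _ = _ := by ring
    gcongr

/-! ### Euler products and sums over totients and primes -/

/-- A finite part of the Dirichlet series over integers composed of primes in `P`, whose Euler
product is finite. -/
lemma sum_factoredNumbers_rpow_le (P S : Finset ℕ) (hS : ∀ n ∈ S, n ∈ Nat.factoredNumbers P) {s : ℝ}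
    (hs : 0 < s) :
    ∑ n ∈ S, (n : ℝ) ^ (-s) ≤ ∏ p ∈ P with p.Prime, (1 - (p : ℝ) ^ (-s))⁻¹ := by
  classical
  set h : ℕ →* ℝ :=
    { toFun := fun d => (d : ℝ) ^ (-s)
      map_one' := by simp
      map_mul' := fun a b => by
        push_cast
        rw [Real.mul_rpow (by positivity) (by positivity)] } with hh
  have happ : ∀ d, h d = (d : ℝ) ^ (-s) := fun d => rfl
  have hlt : ∀ {p : ℕ}, p.Prime → ‖h p‖ < 1 := by
    intro p hp
    rw [happ, Real.norm_of_nonneg (by positivity)]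
    exact Real.rpow_lt_one_of_one_lt_of_neg (by exact_mod_cast hp.one_lt) (by linarith)
  obtain ⟨hsum, hhas⟩ :=
    EulerProduct.summable_and_hasSum_factoredNumbers_prod_filter_prime_geometric hlt P
  have := hhas.summable.sum_le_tsum (S.subtype (· ∈ Nat.factoredNumbers P))
    (fun i _ => by rw [happ]; positivity)
  rw [hhas.tsum_eq, sum_subtype_eq_sum_filter, filter_true_of_mem hS] at this
  exact this

/-- The quotient is the product of `p/(p-1)` over `p ∣ k`. Comparing factors with `1 + p^(-1/2)` and
expanding over squarefree divisors yields a convolution that is easy to average over `k`. -/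
lemma div_totient_le_sum_divisors {k : ℕ} (hk : k ≠ 0) :
    (k : ℝ) / k.totient ≤ 2 * ∑ d ∈ k.divisors, (d : ℝ) ^ (-(1 / 2 : ℝ)) := by
  set h : ArithmeticFunction ℝ := ⟨fun n => if n = 0 then 0 else (n : ℝ) ^ (-(1 / 2 : ℝ)), by simp⟩
    with hh
  have happ : ∀ n, n ≠ 0 → h n = (n : ℝ) ^ (-(1 / 2 : ℝ)) := fun n hn => if_neg hn
  have hm : h.IsMultiplicative := by
    rw [ArithmeticFunction.IsMultiplicative.iff_ne_zero]
    refine ⟨by rw [happ 1 one_ne_zero]; simp, fun {m n} hm hn _ => ?_⟩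
    rw [happ _ (mul_ne_zero hm hn), happ _ hm, happ _ hn]
    push_cast
    rw [Real.mul_rpow (by positivity) (by positivity)]
  set r := ∏ p ∈ k.primeFactors, p with hr
  have hrk : r ∣ k := Nat.prod_primeFactors_dvd k
  have hsq : Squarefree r := by
    rw [hr]
    refine (Finset.squarefree_prod_of_pairwise_isCoprime ?_ ?_)
    · intro p hp p' hp' hne
      exact Nat.coprime_iff_isRelPrime.mp ((Nat.coprime_primes (Nat.prime_of_mem_primeFactors hp)
        (Nat.prime_of_mem_primeFactors hp')).mpr hne)
    · exact fun p hp => (Nat.prime_of_mem_primeFactors hp).prime.squarefree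
  have hrp : r.primeFactors = k.primeFactors :=
    Nat.primeFactors_prod fun p hp => Nat.prime_of_mem_primeFactors hp
  have e1 := hm.prodPrimeFactors_one_add_of_squarefree hsq
  rw [hrp] at e1
  have e2 : ∑ d ∈ r.divisors, h d ≤ ∑ d ∈ k.divisors, (d : ℝ) ^ (-(1 / 2 : ℝ)) := by
    rw [sum_congr rfl fun d hd => happ d (Nat.pos_of_mem_divisors hd).ne']
    exact sum_le_sum_of_subset_of_nonneg (Nat.divisors_subset_of_dvd hk hrk)
      fun _ _ _ => by positivity
  have e3 : (k : ℝ) / k.totient = ∏ p ∈ k.primeFactors, ((p : ℝ) / (p - 1)) := by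
    have := Nat.totient_mul_prod_primeFactors k
    have h0 : (0 : ℝ) < k.totient := by
      exact_mod_cast Nat.totient_pos.mpr (Nat.pos_of_ne_zero hk)
    rw [prod_div_distrib, div_eq_div_iff h0.ne']
    · have e : ∏ p ∈ k.primeFactors, ((p : ℝ) - 1) = ((∏ p ∈ k.primeFactors, (p - 1) : ℕ) : ℝ) := by
        push_cast
        refine prod_congr rfl fun p hp => ?_
        rw [Nat.cast_sub (Nat.prime_of_mem_primeFactors hp).one_le]
        simp
      rw [e, ← Nat.cast_prod, ← Nat.cast_mul, ← Nat.cast_mul, ← this, mul_comm]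
    · refine prod_ne_zero_iff.mpr fun p hp => ?_
      have : (1 : ℝ) < p := by exact_mod_cast (Nat.prime_of_mem_primeFactors hp).one_lt
      linarith
  have e4 : ∀ p ∈ k.primeFactors, ((p : ℝ) / (p - 1)) ≤ (if p = 2 then 2 else 1) * (1 + h p) := by
    intro p hp
    have hpp := Nat.prime_of_mem_primeFactors hp
    rw [happ p hpp.ne_zero, Real.rpow_neg (by positivity), ← Real.sqrt_eq_rpow]
    -- The prime `2` is the only one with `1/(p-1) > p^(-1/2)`; it accounts for the factor `2`.
    split_ifs with h2
    · subst h2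
      norm_num
    · have h3 : (3 : ℝ) ≤ p := by
        have := hpp.two_le
        exact_mod_cast (by omega : 3 ≤ p)
      have hs : √(p : ℝ) ≤ p - 1 := by
        rw [Real.sqrt_le_left (by linarith)]
        nlinarith
      have hs0 : 0 < √(p : ℝ) := Real.sqrt_pos.mpr (by linarith)
      have e5 : (p : ℝ) / (p - 1) = 1 + (p - 1 : ℝ)⁻¹ := by
        have : (p : ℝ) - 1 ≠ 0 := by linarith
        field_simp
        ring
      rw [e5, one_mul]
      gcongr
  rw [e3]
  refine (prod_le_prod (fun p hp => ?_) e4).trans ?_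
  · have : (1 : ℝ) < p := by exact_mod_cast (Nat.prime_of_mem_primeFactors hp).one_lt
    exact div_nonneg (by linarith) (by linarith)
  · rw [prod_mul_distrib, e1]
    refine mul_le_mul ?_ e2 (sum_nonneg fun d hd => ?_) (by norm_num)
    · rw [prod_ite_eq']
      split_ifs <;> norm_num
    · rw [happ d (Nat.pos_of_mem_divisors hd).ne']
      positivity

lemma sum_one_div_le (Q : ℕ) : ∑ k ∈ Icc 1 Q, 1 / (k : ℝ) ≤ 1 + Real.log Q := by
  have := harmonic_le_one_add_log Q
  rw [harmonic_eq_sum_Icc] at this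
  push_cast at this
  simpa [one_div] using this

/-- Averaging `div_totient_le_sum_divisors` separates a convergent series of `d^(-3/2)` from a
harmonic sum. -/
lemma exists_sum_one_div_totient_le :
    ∃ C : ℝ, 0 < C ∧ ∀ Q : ℕ, ∑ k ∈ Icc 1 Q, 1 / (k.totient : ℝ) ≤ C * (1 + Real.log Q) := by
  have hsum : Summable fun n : ℕ => (n : ℝ) ^ (-(3 / 2 : ℝ)) :=
    Real.summable_nat_rpow.mpr (by norm_num)
  set S := ∑' n : ℕ, (n : ℝ) ^ (-(3 / 2 : ℝ)) with hS
  have hS0 : 0 ≤ S := tsum_nonneg fun n => by positivity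
  refine ⟨2 * S + 1, by positivity, fun Q => ?_⟩
  have h1 : ∀ k ∈ Icc 1 Q, 1 / (k.totient : ℝ) ≤
      ∑ p ∈ k.divisorsAntidiagonal, 2 * ((p.1 : ℝ) ^ (-(3 / 2 : ℝ)) * (1 / (p.2 : ℝ))) := by
    intro k hk
    have hk0 : k ≠ 0 := by have := (mem_Icc.mp hk).1; omega
    have hk' : (0 : ℝ) < k := by exact_mod_cast Nat.pos_of_ne_zero hk0
    have h := div_totient_le_sum_divisors hk0
    have e : 1 / (k.totient : ℝ) = k / k.totient / k := by field_simp
    rw [e, div_le_iff₀ hk']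
    refine h.trans (le_of_eq ?_)
    rw [← mul_sum, mul_assoc, sum_mul,
      ← Nat.sum_divisorsAntidiagonal (fun d _ => (d : ℝ) ^ (-(1 / 2 : ℝ)))]
    congr 1
    refine sum_congr rfl fun p hp => ?_
    obtain ⟨h1, h2⟩ := Nat.mem_divisorsAntidiagonal.mp hp
    have p1 : (p.1 : ℝ) ≠ 0 := fun h => h2 (by rw [← h1, Nat.cast_eq_zero.mp h, zero_mul])
    have p2 : (p.2 : ℝ) ≠ 0 := fun h => h2 (by rw [← h1, Nat.cast_eq_zero.mp h, mul_zero])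
    rw [← h1, show (-(3 / 2) : ℝ) = -(1 / 2) - 1 by norm_num, Real.rpow_sub_one p1]
    push_cast
    field_simp
  refine (sum_le_sum h1).trans ((sum_antidiagonal_le Q
    (fun d e => 2 * ((d : ℝ) ^ (-(3 / 2 : ℝ)) * (1 / (e : ℝ)))) fun _ _ => by positivity).trans ?_)
  simp_rw [← mul_sum, ← sum_mul]
  have h2 : ∑ d ∈ Icc 1 Q, (d : ℝ) ^ (-(3 / 2 : ℝ)) ≤ S :=
    hsum.sum_le_tsum _ fun _ _ => by positivity
  have h3 := sum_one_div_le Q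
  have h4 : 0 ≤ Real.log Q := Real.log_natCast_nonneg Q
  calc _ ≤ 2 * (S * (1 + Real.log Q)) := by gcongr
    _ ≤ _ := by nlinarith

/-- Integers composed of primes dividing `q` are sparse: the Euler product at exponent `1/2` has
only the factors `p ∣ q`, each at most `4`. -/
lemma exists_sum_inv_sqrt_le :
    ∃ C : ℝ, 0 < C ∧ ∀ q : ℕ, q ≠ 0 → ∀ S : Finset ℕ,
      (∀ n ∈ S, n ≠ 0 ∧ ∀ p, p.Prime → p ∣ n → p ∣ q) →
        ∑ n ∈ S, (n : ℝ) ^ (-(1 / 2 : ℝ)) ≤ C * (q : ℝ) ^ (1 / 4 : ℝ) := by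
  refine ⟨4 ^ 256, by positivity, fun q hq S hS => ?_⟩
  refine (sum_factoredNumbers_rpow_le q.primeFactors S (fun n hn => ?_) (by norm_num)).trans ?_
  · rw [Nat.mem_factoredNumbers']
    exact fun p hp hpn => Nat.mem_primeFactors.mpr ⟨hp, (hS n hn).2 p hp hpn, hq⟩
  · rw [filter_true_of_mem fun p hp => Nat.prime_of_mem_primeFactors hp]
    -- Since `4 = 256^(1/4)`, a prime `p ≥ 256` absorbs its factor in `p^(1/4)`; the smaller primes
    -- cost at most `4^256` in total.
    have h1 : ∀ p ∈ q.primeFactors, (1 - (p : ℝ) ^ (-(1 / 2 : ℝ)))⁻¹ ≤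
        (if p ∈ range 256 then 4 else 1) * (p : ℝ) ^ (1 / 4 : ℝ) := by
      intro p hp
      have hp2 : (2 : ℝ) ≤ p := by exact_mod_cast (Nat.prime_of_mem_primeFactors hp).two_le
      have h4 : (1 - (p : ℝ) ^ (-(1 / 2 : ℝ)))⁻¹ ≤ 4 := by
        rw [inv_le_comm₀ _ (by norm_num)]
        · have : (p : ℝ) ^ (-(1 / 2 : ℝ)) ≤ 3 / 4 := by
            rw [Real.rpow_neg (by positivity), ← Real.sqrt_eq_rpow, inv_le_comm₀ _ (by norm_num)]
            · apply Real.le_sqrt_of_sq_le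
              linarith
            · exact Real.sqrt_pos.mpr (by linarith)
          linarith
        · have : (p : ℝ) ^ (-(1 / 2 : ℝ)) < 1 :=
            Real.rpow_lt_one_of_one_lt_of_neg (by linarith) (by norm_num)
          linarith
      refine h4.trans ?_
      split_ifs with h
      · have : 1 ≤ (p : ℝ) ^ (1 / 4 : ℝ) := Real.one_le_rpow (by linarith) (by norm_num)
        linarith
      · rw [mem_range, not_lt] at h
        have h' : (256 : ℝ) ≤ p := by exact_mod_cast h
        have h5 : (4 : ℝ) = 256 ^ (1 / 4 : ℝ) := by
          rw [show (256 : ℝ) = 4 ^ (4 : ℝ) by norm_num, ← Real.rpow_mul (by norm_num)]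
          norm_num
        calc (4 : ℝ) = 256 ^ (1 / 4 : ℝ) := h5
          _ ≤ (p : ℝ) ^ (1 / 4 : ℝ) := Real.rpow_le_rpow (by norm_num) h' (by norm_num)
          _ = _ := (one_mul _).symm
    refine (prod_le_prod (fun p hp => ?_) h1).trans ?_
    · have hp2 : (2 : ℝ) ≤ p := by exact_mod_cast (Nat.prime_of_mem_primeFactors hp).two_le
      have : (p : ℝ) ^ (-(1 / 2 : ℝ)) < 1 :=
        Real.rpow_lt_one_of_one_lt_of_neg (by linarith) (by norm_num)
      exact inv_nonneg.mpr (by linarith)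
    · rw [prod_mul_distrib]
      refine mul_le_mul ?_ ?_ (prod_nonneg fun _ _ => by positivity) (by positivity)
      · rw [prod_ite, prod_const, prod_const_one, mul_one]
        refine pow_le_pow_right₀ (by norm_num) ?_
        calc _ ≤ (range 256).card := card_le_card fun p hp => (mem_filter.mp hp).2
          _ = _ := card_range _
      · rw [Real.finsetProd_rpow _ _ fun _ _ => by positivity]
        refine Real.rpow_le_rpow (prod_nonneg fun _ _ => by positivity) ?_ (by norm_num)
        rw [← Nat.cast_prod]
        exact_mod_cast Nat.le_of_dvd (Nat.pos_of_ne_zero hq) (Nat.prod_primeFactors_dvd q)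

/-- Chebyshev's bound for `θ` at `2^(i+1)`, where every prime of the block has logarithm at least `i
log 2`; each term is at most `2^(-i)`. -/
lemma sum_prime_dyadic_le (i : ℕ) (hi : 1 ≤ i) :
    ∑ p ∈ Ioc (2 ^ i : ℕ) (2 ^ (i + 1)) with p.Prime, 1 / ((p : ℝ) - 1) ≤ 4 / i := by
  have hi' : (0 : ℝ) < i := by exact_mod_cast hi
  have hl2 : 0 < Real.log 2 := Real.log_pos (by norm_num)
  set T := (Ioc (2 ^ i : ℕ) (2 ^ (i + 1))).filter Nat.Prime with hT
  have h1 : (T.card : ℝ) * (i * Real.log 2) ≤ Real.log 4 * 2 ^ (i + 1) := by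
    have := Chebyshev.theta_le_log4_mul_x (x := 2 ^ (i + 1)) (by positivity)
    refine le_trans ?_ this
    rw [Chebyshev.theta_eq_sum_Icc, ← nsmul_eq_mul, ← sum_const]
    have hfl : ⌊(2 : ℝ) ^ (i + 1)⌋₊ = 2 ^ (i + 1) := by exact_mod_cast Nat.floor_natCast (2 ^ (i + 1))
    rw [hfl]
    refine (sum_le_sum (f := fun _ => (i : ℝ) * Real.log 2) (g := fun p : ℕ => Real.log p)
      fun p hp => ?_).trans (sum_le_sum_of_subset_of_nonneg (fun p hp => ?_)
        fun p _ _ => Real.log_natCast_nonneg p)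
    · rw [hT, mem_filter, mem_Ioc] at hp
      rw [← Real.log_pow]
      exact Real.log_le_log (by positivity) (by exact_mod_cast hp.1.1.le)
    · rw [hT, mem_filter, mem_Ioc] at hp
      rw [mem_filter, mem_Icc]
      exact ⟨⟨Nat.zero_le _, hp.1.2⟩, hp.2⟩
  have h4 : Real.log 4 = 2 * Real.log 2 := by
    rw [show (4 : ℝ) = 2 ^ 2 by norm_num, Real.log_pow]; norm_num
  have h2 : (T.card : ℝ) ≤ 4 * 2 ^ i / i := by
    rw [le_div_iff₀ hi']
    rw [h4, pow_succ] at h1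
    nlinarith
  calc ∑ p ∈ T, 1 / ((p : ℝ) - 1) ≤ ∑ _p ∈ T, 1 / (2 : ℝ) ^ i := by
        refine sum_le_sum fun p hp => ?_
        rw [hT, mem_filter, mem_Ioc] at hp
        have : (2 : ℝ) ^ i + 1 ≤ p := by exact_mod_cast hp.1.1
        exact one_div_le_one_div_of_le (by positivity) (by linarith)
    _ = T.card * (1 / (2 : ℝ) ^ i) := by rw [sum_const, nsmul_eq_mul]
    _ ≤ 4 * 2 ^ i / i * (1 / (2 : ℝ) ^ i) := by gcongr
    _ = _ := by field_simp

lemma sum_prime_two_pow_le (I : ℕ) :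
    ∑ p ∈ Icc 1 (2 ^ (I + 1) : ℕ) with p.Prime, 1 / ((p : ℝ) - 1) ≤
      1 + 4 * ∑ i ∈ Icc 1 I, 1 / (i : ℝ) := by
  induction I with
  | zero =>
    have : (Icc 1 (2 ^ (0 + 1))).filter Nat.Prime = {2} := by decide
    rw [this]
    norm_num
  | succ I ih =>
    have h : (Icc 1 (2 ^ (I + 1 + 1))).filter Nat.Prime = (Icc 1 (2 ^ (I + 1))).filter Nat.Prime ∪
        (Ioc (2 ^ (I + 1)) (2 ^ (I + 1 + 1))).filter Nat.Prime := by
      rw [← filter_union]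
      congr 1
      ext p
      simp only [mem_union, mem_Icc, mem_Ioc]
      have : 2 ^ (I + 1) ≤ 2 ^ (I + 1 + 1) := Nat.pow_le_pow_right (by norm_num) (by omega)
      have : 1 ≤ 2 ^ (I + 1) := Nat.one_le_two_pow
      omega
    rw [h, sum_union, sum_Icc_succ_top (by omega)]
    · have := sum_prime_dyadic_le (I + 1) (by omega)
      rw [mul_add, mul_one_div]
      linarith
    · refine disjoint_left.mpr fun p h1 h2 => ?_
      rw [mem_filter, mem_Icc] at h1
      rw [mem_filter, mem_Ioc] at h2
      omega

/-- An upper bound for the sum of the reciprocals of the primes, of the order `log log R`. -/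
lemma sum_prime_le (R : ℕ) (hR : 1 ≤ R) :
    ∑ p ∈ Icc 1 R with p.Prime, 1 / ((p : ℝ) - 1) ≤ 5 + 4 * Real.log (1 + 2 * Real.log R) := by
  have hR' : (1 : ℝ) ≤ R := by exact_mod_cast hR
  have hlR : 0 ≤ Real.log R := Real.log_nonneg hR'
  set I := Nat.log 2 R with hI
  have h1 : R ≤ 2 ^ (I + 1) := (Nat.lt_pow_succ_log_self (by norm_num) R).le
  have h2 : (I : ℝ) ≤ 2 * Real.log R := by
    have : (2 : ℝ) ^ I ≤ R := by exact_mod_cast Nat.pow_log_le_self 2 (by omega)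
    have h := Real.log_le_log (by positivity) this
    rw [Real.log_pow] at h
    have := Real.log_two_gt_d9
    nlinarith [(Nat.cast_nonneg I : (0 : ℝ) ≤ I)]
  have h3 := sum_one_div_le I
  have h4 : Real.log I ≤ Real.log (1 + 2 * Real.log R) := by
    rcases Nat.eq_zero_or_pos I with h | h
    · rw [h, Nat.cast_zero, Real.log_zero]
      exact Real.log_nonneg (by linarith)
    · exact Real.log_le_log (by exact_mod_cast h) (by linarith)
  calc _ ≤ ∑ p ∈ Icc 1 (2 ^ (I + 1) : ℕ) with p.Prime, 1 / ((p : ℝ) - 1) := by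
        refine sum_le_sum_of_subset_of_nonneg (filter_subset_filter _ (Icc_subset_Icc_right h1))
          fun p hp _ => ?_
        have : (1 : ℝ) ≤ p := by exact_mod_cast (mem_Icc.mp (mem_filter.mp hp).1).1
        exact div_nonneg zero_le_one (by linarith)
    _ ≤ _ := (sum_prime_two_pow_le I).trans (by linarith)

/-- A lower bound for the sum of the reciprocals of the primes, of the order `log log Y`. -/
lemma log_log_le_sum_prime (Y : ℕ) (hY : 1 ≤ Y) :
    Real.log (Real.log (Y + 1)) ≤ ∑ p ∈ Icc 1 Y with p.Prime, 1 / ((p : ℝ) - 1) := by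
  have hY' : (1 : ℝ) ≤ Y := by exact_mod_cast hY
  -- Exponentiated, the claim is Euler's argument: `log(Y+1)` is at most the harmonic sum, hence at
  -- most the product of `1 + 1/(p-1)` over `p ≤ Y`.
  rw [Real.log_le_iff_le_exp (Real.log_pos (by linarith)), Real.exp_sum]
  have h1 := log_add_one_le_harmonic Y
  rw [harmonic_eq_sum_Icc] at h1
  push_cast at h1
  refine h1.trans ?_
  have h2 := sum_factoredNumbers_rpow_le (Icc 1 Y) (Icc 1 Y) (fun n hn => ?_) one_pos
  · simp_rw [Real.rpow_neg_one] at h2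
    refine h2.trans (prod_le_prod (fun p hp => ?_) fun p hp => ?_)
    all_goals
      have hp2 : (2 : ℝ) ≤ p := by exact_mod_cast (mem_filter.mp hp).2.two_le
      have hp0 : (0 : ℝ) < p - 1 := by linarith
      have e : (1 - (p : ℝ)⁻¹)⁻¹ = 1 / ((p : ℝ) - 1) + 1 := by
        have : (p : ℝ) - 1 ≠ 0 := hp0.ne'
        have : (p : ℝ) ≠ 0 := by linarith
        field_simp
        ring
      rw [e]
    · positivity
    · exact Real.add_one_le_exp _
  · rw [mem_Icc] at hn
    rw [Nat.mem_factoredNumbers']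
    intro p hp hpn
    rw [mem_Icc]
    exact ⟨hp.one_le, (Nat.le_of_dvd (by omega) hpn).trans hn.2⟩

/-! ### Discrepancies of convolutions and small conductors -/

lemma norm_Delta_le {c : ℕ → ℂ} (hc : ∀ n, ‖c n‖ ≤ 1) {X : ℝ} (hX : 0 ≤ X) (q : ℕ) (a : (ZMod q)ˣ) :
    ‖Delta c X q a‖ ≤ 2 * X := by
  have h1 : ∀ (P : ℕ → Prop) [DecidablePred P], ‖∑ n ∈ (Icc 1 ⌊X⌋₊).filter P, c n‖ ≤ X := by
    intro P _
    calc _ ≤ ∑ n ∈ (Icc 1 ⌊X⌋₊).filter P, ‖c n‖ := norm_sum_le _ _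
      _ ≤ ∑ n ∈ (Icc 1 ⌊X⌋₊).filter P, 1 := sum_le_sum fun n _ => hc n
      _ ≤ ∑ n ∈ Icc 1 ⌊X⌋₊, (1 : ℝ) :=
          sum_le_sum_of_subset_of_nonneg (filter_subset _ _) fun _ _ _ => zero_le_one
      _ = ⌊X⌋₊ := by simp
      _ ≤ X := Nat.floor_le hX
  have h2 : ‖(1 / (q.totient : ℂ))‖ ≤ 1 := by
    rw [norm_div, norm_one, Complex.norm_natCast]
    rcases Nat.eq_zero_or_pos q.totient with h | h
    · rw [h]; norm_num
    · rw [div_le_one (by exact_mod_cast h)]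
      exact_mod_cast h
  unfold Delta
  refine (norm_sub_le _ _).trans ?_
  rw [norm_mul]
  have h3 := h1 (fun n => (n : ZMod q) = a)
  have h4 := mul_le_mul h2 (h1 (fun n => n.Coprime q)) (norm_nonneg _) zero_le_one
  linarith

/-- `Delta` of a Dirichlet convolution. -/
lemma Delta_convolution {c u v : ℕ → ℂ} {x : ℝ} (d : ℕ) (b : (ZMod d)ˣ)
    (hc : ∀ n ∈ Icc 1 ⌊x⌋₊, c n = ∑ p ∈ n.divisorsAntidiagonal, u p.1 * v p.2) :
    Delta c x d b = ∑ m ∈ Icc 1 ⌊x⌋₊, u m *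
      (if h : m.Coprime d then Delta v (x / m) d (b * (ZMod.unitOfCoprime m h)⁻¹) else 0) := by
  have h1 : ∀ (P : ℕ → Prop) [DecidablePred P], ∑ n ∈ (Icc 1 ⌊x⌋₊).filter P, c n =
      ∑ m ∈ Icc 1 ⌊x⌋₊, u m * ∑ l ∈ (Icc 1 ⌊x / m⌋₊).filter (fun l => P (m * l)), v l := by
    intro P _
    rw [sum_filter]
    have e : ∀ n ∈ Icc 1 ⌊x⌋₊, (if P n then c n else 0) = ∑ p ∈ n.divisorsAntidiagonal,
        if P (p.1 * p.2) then u p.1 * v p.2 else 0 := by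
      intro n hn
      rw [hc n hn]
      have : ∀ p ∈ n.divisorsAntidiagonal, (if P (p.1 * p.2) then u p.1 * v p.2 else 0) =
          if P n then u p.1 * v p.2 else 0 := fun p hp => by
        rw [(Nat.mem_divisorsAntidiagonal.mp hp).1]
      rw [sum_congr rfl this]
      split_ifs <;> simp
    rw [sum_congr rfl e, sum_antidiagonal_eq ⌊x⌋₊ (fun m l => if P (m * l) then u m * v l else 0)]
    refine sum_congr rfl fun m _ => ?_
    rw [Nat.floor_div_natCast, sum_filter, mul_sum]
    exact sum_congr rfl fun l _ => by rw [mul_ite, mul_zero]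
  unfold Delta
  rw [h1, h1, mul_sum, ← sum_sub_distrib]
  refine sum_congr rfl fun m _ => ?_
  split_ifs with h
  · have e1 : ∀ l : ℕ, (((m * l : ℕ) : ZMod d) = b) ↔
        (l : ZMod d) = ((b * (ZMod.unitOfCoprime m h)⁻¹ : (ZMod d)ˣ) : ZMod d) := by
      intro l
      rw [Nat.cast_mul, ← ZMod.coe_unitOfCoprime m h, Units.val_mul, Units.eq_mul_inv_iff_mul_eq,
        mul_comm]
    have e2 : ∀ l : ℕ, (m * l).Coprime d ↔ l.Coprime d := by
      intro l
      rw [Nat.coprime_mul_iff_left]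
      exact ⟨fun h => h.2, fun h' => ⟨h, h'⟩⟩
    simp_rw [e1, e2]
    ring
  · have e1 : ∀ l : ℕ, ¬ ((m * l : ℕ) : ZMod d) = b := by
      intro l hl
      have : (m * l).Coprime d := by
        rw [← ZMod.isUnit_iff_coprime, hl]
        exact b.isUnit
      exact h (Nat.Coprime.coprime_mul_right this)
    have e2 : ∀ l : ℕ, ¬ (m * l).Coprime d := fun l hl => h (Nat.Coprime.coprime_mul_right hl)
    rw [filter_false_of_mem fun l _ => e1 l, filter_false_of_mem fun l _ => e2 l]
    simp

lemma norm_Delta_le_of_convolution {c u v : ℕ → ℂ} {x : ℝ} (d : ℕ) (b : (ZMod d)ˣ)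
    (hc : ∀ n ∈ Icc 1 ⌊x⌋₊, c n = ∑ p ∈ n.divisorsAntidiagonal, u p.1 * v p.2) (M : ℕ → ℝ)
    (hM : ∀ m ∈ Icc 1 ⌊x⌋₊, u m ≠ 0 → ∀ b, ‖Delta v (x / m) d b‖ ≤ M m) :
    ‖Delta c x d b‖ ≤ ∑ m ∈ Icc 1 ⌊x⌋₊, ‖u m‖ * M m := by
  rw [Delta_convolution d b hc]
  refine (norm_sum_le _ _).trans (sum_le_sum fun m hm => ?_)
  rw [norm_mul]
  by_cases hu : u m = 0
  · rw [hu]; simp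
  refine mul_le_mul_of_nonneg_left ?_ (norm_nonneg _)
  split_ifs with h
  · exact hM m hm hu _
  · rw [norm_zero]
    exact (norm_nonneg _).trans (hM m hm hu b)

/-- Sum over the moduli of the small-conductor parts. -/
lemma sum_smallPart_le (c : ℕ → ℂ) (x : ℝ) (R Q : ℕ) (b : (q : ℕ) → (ZMod q)ˣ) (h : ℕ → ℝ)
    (h0 : ∀ d, 0 ≤ h d)
    (hh : ∀ q ∈ Icc 1 Q, ∀ d ∈ Icc 1 R, d ∣ q →
      ∀ b : (ZMod d)ˣ, ‖Delta (coprimePart c q) x d b‖ ≤ h d) :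
    ∑ q ∈ Icc 1 Q, ‖smallPart c x R q (b q)‖ ≤
      (∑ k ∈ Icc 1 Q, 1 / (k.totient : ℝ)) *
        ((∑ e ∈ Icc 1 R, 1 / (e.totient : ℝ)) * ∑ d ∈ Icc 1 R, h d) := by
  set G : ℕ → ℝ := fun r => 1 / (r.totient : ℝ) * ∑ d ∈ r.divisors, d.totient * h d with hG
  have hG0 : ∀ r, 0 ≤ G r := fun r => mul_nonneg (by positivity)
    (sum_nonneg fun d _ => mul_nonneg (by positivity) (h0 d))
  set F : ℕ → ℕ → ℝ := fun k r => if r ≤ R then 1 / (k.totient : ℝ) * G r else 0 with hF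
  have hF0 : ∀ k r, 0 ≤ F k r := by
    intro k r
    simp only [hF]
    split_ifs
    · exact mul_nonneg (by positivity) (hG0 _)
    · exact le_rfl
  have htot : ∀ {q r : ℕ}, 0 < q → r ∣ q →
      (1 : ℝ) / q.totient ≤ 1 / (q / r).totient * (1 / r.totient) := by
    intro q r hq hr
    have hr0 : 0 < r := Nat.pos_of_dvd_of_pos hr hq
    have hk0 : 0 < q / r := Nat.div_pos (Nat.le_of_dvd hq hr) hr0
    rw [one_div_mul_one_div]
    apply one_div_le_one_div_of_le
    · have := Nat.totient_pos.mpr hr0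
      have := Nat.totient_pos.mpr hk0
      positivity
    · have := Nat.totient_super_multiplicative (q / r) r
      rw [Nat.div_mul_cancel hr] at this
      exact_mod_cast this
  have h1 : ∀ q ∈ Icc 1 Q, ‖smallPart c x R q (b q)‖ ≤
      ∑ p ∈ q.divisorsAntidiagonal, F p.1 p.2 := by
    intro q hqI
    have hq := mem_Icc.mp hqI
    have : NeZero q := ⟨by omega⟩
    unfold smallPart
    rw [norm_mul, norm_div, norm_one, Complex.norm_natCast, Nat.sum_divisorsAntidiagonal' F]
    refine (mul_le_mul_of_nonneg_left (norm_sum_le _ _) (by positivity)).trans ?_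
    rw [mul_sum]
    refine (sum_le_sum fun r hr => ?_).trans (sum_le_sum_of_subset_of_nonneg
      (filter_subset (fun r => r ≠ 1 ∧ r ≤ R) q.divisors) (fun r _ _ => hF0 (q / r) r))
    rw [mem_filter, Nat.mem_divisors] at hr
    simp only [hF]
    rw [if_pos hr.2.2, hG, ← mul_assoc]
    refine mul_le_mul (htot hq.1 hr.1.1) (norm_condPart_le c x _ hr.1.1 hr.2.1 h
      fun d hd b => ?_) (norm_nonneg _) (by positivity)
    have hr0 : 0 < r := Nat.pos_of_dvd_of_pos hr.1.1 hq.1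
    refine hh q hqI d (mem_Icc.mpr ⟨Nat.pos_of_dvd_of_pos hd hr0, ?_⟩) (hd.trans hr.1.1) b
    exact (Nat.le_of_dvd hr0 hd).trans hr.2.2
  -- Writing `r = e d`, the inequality `φ(e) φ(d) ≤ φ(r)` cancels the weight `φ(d)`, so the `h d`
  -- enter unweighted and the sum over `e` costs only a logarithm of `R`.
  have h2 : ∑ r ∈ Icc 1 R, G r ≤ (∑ e ∈ Icc 1 R, 1 / (e.totient : ℝ)) * ∑ d ∈ Icc 1 R, h d := by
    have e : ∀ r ∈ Icc 1 R, G r ≤ ∑ p ∈ r.divisorsAntidiagonal, 1 / (p.1.totient : ℝ) * h p.2 := by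
      intro r hr
      have hr0 : 0 < r := (mem_Icc.mp hr).1
      simp only [hG]
      rw [Nat.sum_divisorsAntidiagonal' (fun e d => 1 / (e.totient : ℝ) * h d), mul_sum]
      refine sum_le_sum fun d hd => ?_
      have hdr := Nat.dvd_of_mem_divisors hd
      have hd0 : (0 : ℝ) < d.totient := by
        exact_mod_cast Nat.totient_pos.mpr (Nat.pos_of_mem_divisors hd)
      calc 1 / (r.totient : ℝ) * (d.totient * h d)
          ≤ (1 / (r / d).totient * (1 / d.totient)) * (d.totient * h d) :=
            mul_le_mul_of_nonneg_right (htot hr0 hdr) (mul_nonneg hd0.le (h0 d))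
        _ = _ := by field_simp
    refine (sum_le_sum e).trans ((sum_antidiagonal_le R (fun e d => 1 / (e.totient : ℝ) * h d)
      fun e d => mul_nonneg (by positivity) (h0 d)).trans (le_of_eq ?_))
    simp_rw [← mul_sum, ← sum_mul]
  refine (sum_le_sum h1).trans ((sum_antidiagonal_le Q F hF0).trans ?_)
  rw [sum_mul]
  refine sum_le_sum fun k _ => ?_
  simp only [hF]
  rw [← sum_filter, ← mul_sum]
  refine mul_le_mul_of_nonneg_left (le_trans ?_ h2) (by positivity)
  refine sum_le_sum_of_subset_of_nonneg (fun r hr => ?_) fun r _ _ => hG0 r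
  rw [mem_filter, mem_Icc] at hr
  rw [mem_Icc]
  omega

/-! ### Maximal discrepancies and multiples of the modulus -/

/-- The maximum over reduced residue classes of `|Δ(f, X; q, a)|`. -/
def maxDelta (f : ℕ → ℂ) (X : ℝ) (q : ℕ) : ℝ := ⨆ a : (ZMod q)ˣ, ‖Delta f X q a‖

lemma norm_Delta_le_maxDelta (f : ℕ → ℂ) (X : ℝ) {q : ℕ} (hq : q ≠ 0) (a : (ZMod q)ˣ) :
    ‖Delta f X q a‖ ≤ maxDelta f X q := by
  have : NeZero q := ⟨hq⟩
  exact le_ciSup (Finite.bddAbove_range fun a : (ZMod q)ˣ => ‖Delta f X q a‖) a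

lemma maxDelta_le {f : ℕ → ℂ} {X : ℝ} {q : ℕ} {M : ℝ} (h : ∀ a : (ZMod q)ˣ, ‖Delta f X q a‖ ≤ M) :
    maxDelta f X q ≤ M := ciSup_le h

lemma maxDelta_nonneg (f : ℕ → ℂ) (X : ℝ) (q : ℕ) : 0 ≤ maxDelta f X q :=
  Real.iSup_nonneg fun _ => norm_nonneg _

lemma bvSum_eq (f : ℕ → ℂ) (X Q : ℝ) : bvSum f X Q = ∑ q ∈ Icc 1 ⌊Q⌋₊, maxDelta f X q := rfl

lemma exists_bvSum_eq (f : ℕ → ℂ) (X Q : ℝ) :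
    ∃ b : (q : ℕ) → (ZMod q)ˣ, bvSum f X Q = ∑ q ∈ Icc 1 ⌊Q⌋₊, ‖Delta f X q (b q)‖ := by
  have : ∀ q : ℕ, ∃ b : (ZMod q)ˣ, 0 < q → ‖Delta f X q b‖ = ⨆ a : (ZMod q)ˣ, ‖Delta f X q a‖ := by
    intro q
    rcases Nat.eq_zero_or_pos q with h | h
    · exact ⟨1, fun h' => by omega⟩
    · have : NeZero q := ⟨h.ne'⟩
      obtain ⟨b, hb⟩ := exists_eq_ciSup_of_finite (f := fun a : (ZMod q)ˣ => ‖Delta f X q a‖)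
      exact ⟨b, fun _ => hb⟩
  choose b hb using this
  exact ⟨b, sum_congr rfl fun q hq => (hb q (mem_Icc.mp hq).1).symm⟩

/-- Passing to a multiple of the modulus for a function supported on integers coprime to it. -/
lemma maxDelta_le_mul (g : ℕ → ℂ) (X : ℝ) {d p : ℕ} (hd : d ≠ 0) (hp : p.Prime) (hpd : d.Coprime p)
    (hg : ∀ n, g n ≠ 0 → n.Coprime (d * p)) :
    maxDelta g X d ≤ (p - 1) * maxDelta g X (d * p) := by
  classical
  have : NeZero d := ⟨hd⟩
  have : NeZero (d * p) := ⟨mul_ne_zero hd hp.ne_zero⟩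
  have hdvd : d ∣ d * p := dvd_mul_right d p
  have hφ : ((d * p).totient : ℂ) = d.totient * (p - 1) := by
    rw [Nat.totient_mul hpd, Nat.totient_prime hp, Nat.cast_mul, Nat.cast_sub hp.one_le, Nat.cast_one]
  have hφd : (d.totient : ℂ) ≠ 0 := by
    exact_mod_cast (Nat.totient_pos.mpr (Nat.pos_of_ne_zero hd)).ne'
  have hp1 : (p : ℂ) - 1 ≠ 0 := by
    rw [sub_ne_zero]
    exact_mod_cast hp.one_lt.ne'
  refine maxDelta_le fun a => ?_
  set T := (univ : Finset (ZMod (d * p))ˣ).filter (fun b => ZMod.unitsMap hdvd b = a) with hT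
  -- The fibres of reduction on unit groups are translates of one another, so each has `φ(dp)/φ(d) =
  -- p - 1` elements.
  have hcard : T.card = p - 1 := by
    have h1 : ∀ a', ((univ : Finset (ZMod (d * p))ˣ).filter
        (fun b => ZMod.unitsMap hdvd b = a')).card = T.card := by
      intro a'
      have hsurj := ZMod.unitsMap_surjective hdvd
      obtain ⟨t, ht⟩ := hsurj (a * a'⁻¹)
      refine card_bij (fun b _ => t * b) ?_ ?_ ?_
      · intro b hb
        rw [mem_filter] at hb
        rw [hT, mem_filter, map_mul, ht, hb.2]
        simp
      · intro b _ b' _ h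
        exact mul_left_cancel h
      · intro b hb
        rw [hT, mem_filter] at hb
        refine ⟨t⁻¹ * b, ?_, by simp⟩
        rw [mem_filter, map_mul, map_inv, ht, hb.2]
        simp
    have h2 := card_eq_sum_card_fiberwise (s := (univ : Finset (ZMod (d * p))ˣ))
      (t := (univ : Finset (ZMod d)ˣ)) (f := ZMod.unitsMap hdvd) (fun _ _ => mem_univ _)
    rw [sum_congr rfl fun a' _ => h1 a', sum_const, smul_eq_mul, card_univ, card_univ,
      ZMod.card_units_eq_totient, ZMod.card_units_eq_totient, Nat.totient_mul hpd,
      Nat.totient_prime hp] at h2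
    exact (Nat.eq_of_mul_eq_mul_left (Nat.totient_pos.mpr (Nat.pos_of_ne_zero hd)) h2).symm
  have hall : ∀ k, k ∣ d * p → ∑ n ∈ (Icc 1 ⌊X⌋₊).filter (fun n : ℕ => n.Coprime k), g n =
      ∑ n ∈ Icc 1 ⌊X⌋₊, g n := by
    intro k hk
    rw [sum_filter]
    refine sum_congr rfl fun n _ => ?_
    split_ifs with h
    · rfl
    · by_contra h'
      exact h (Nat.Coprime.coprime_dvd_right hk (hg n (Ne.symm h')))
  -- A class modulo `d` is the union of its `p - 1` reduced lifts modulo `d p` as far as `g` can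
  -- see, and the main terms match because `φ(dp) = (p-1) φ(d)`.
  have key : Delta g X d a = ∑ b ∈ T, Delta g X (d * p) b := by
    unfold Delta
    rw [hall d hdvd, hall (d * p) dvd_rfl, sum_sub_distrib, sum_const, hcard, nsmul_eq_mul, hφ,
      Nat.cast_sub hp.one_le, Nat.cast_one]
    congr 1
    · simp_rw [sum_filter]
      rw [sum_comm]
      refine sum_congr rfl fun n _ => ?_
      by_cases hn : g n = 0
      · simp [hn]
      · have hc := hg n hn
        have e : ∀ b : (ZMod (d * p))ˣ, ((n : ZMod (d * p)) = b) ↔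
            ZMod.unitOfCoprime n hc = b := by
          intro b
          rw [← ZMod.coe_unitOfCoprime n hc, Units.val_inj]
        simp_rw [e]
        rw [sum_ite_eq, hT]
        simp only [mem_filter, mem_univ, true_and]
        congr 1
        rw [← Units.val_inj, ZMod.unitsMap_val, ZMod.coe_unitOfCoprime, ZMod.cast_natCast hdvd]
    · field_simp
  rw [key]
  calc _ ≤ ∑ b ∈ T, ‖Delta g X (d * p) b‖ := norm_sum_le _ _
    _ ≤ ∑ b ∈ T, maxDelta g X (d * p) :=
        sum_le_sum fun b _ => norm_Delta_le_maxDelta g X (NeZero.ne _) b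
    _ = _ := by
        rw [sum_const, hcard, nsmul_eq_mul, Nat.cast_sub hp.one_le, Nat.cast_one]

/-- The moduli up to `R` carry only a small proportion of `∑_{q ≤ Q} max_a |Δ(g, X; q, a)|`. -/
lemma sum_maxDelta_mul_sum_prime_le (g : ℕ → ℂ) (X : ℝ) {R Y Q : ℕ} (hQ : R * Y ≤ Q)
    (hg : ∀ n, g n ≠ 0 → ∀ k ∈ Icc 1 Q, n.Coprime k) :
    (∑ d ∈ Icc 1 R, maxDelta g X d) * ∑ p ∈ Ioc R Y with p.Prime, 1 / ((p : ℝ) - 1) ≤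
      ∑ q ∈ Icc 1 Q, maxDelta g X q := by
  classical
  set T := (Ioc R Y).filter Nat.Prime with hT
  have hmem : ∀ z ∈ Icc 1 R ×ˢ T, z.1 * z.2 ∈ Icc 1 Q := by
    intro z hz
    rw [mem_product, mem_Icc, hT, mem_filter, mem_Ioc] at hz
    rw [mem_Icc]
    exact ⟨Nat.mul_pos hz.1.1 hz.2.2.pos, (Nat.mul_le_mul hz.1.2 hz.2.1.2).trans hQ⟩
  -- Since `d ≤ R < p`, the prime `p` is recovered from the product `d p`.
  have hinj : Set.InjOn (fun z : ℕ × ℕ => z.1 * z.2) (Icc 1 R ×ˢ T : Finset (ℕ × ℕ)) := by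
    rintro ⟨d, p⟩ h ⟨d', p'⟩ h' he
    simp only [coe_product, Set.mem_prod, mem_coe, hT, mem_filter, mem_Icc, mem_Ioc] at h h' he
    have hpp : p = p' := by
      have h1 : p ∣ d' * p' := he ▸ dvd_mul_left p d
      rcases (Nat.Prime.dvd_mul h.2.2).mp h1 with h2 | h2
      · have := Nat.le_of_dvd h'.1.1 h2
        omega
      · exact (Nat.prime_dvd_prime_iff_eq h.2.2 h'.2.2).mp h2
    subst hpp
    rw [Nat.eq_of_mul_eq_mul_right h.2.2.pos he]
  rw [sum_mul_sum, ← sum_product']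
  calc _ ≤ ∑ z ∈ Icc 1 R ×ˢ T, maxDelta g X (z.1 * z.2) := by
        refine sum_le_sum fun z hz => ?_
        have hm := hmem z hz
        rw [mem_product, mem_Icc, hT, mem_filter, mem_Ioc] at hz
        have hp1 : (0 : ℝ) < z.2 - 1 := by
          have : (1 : ℝ) < z.2 := by exact_mod_cast hz.2.2.one_lt
          linarith
        rw [mul_one_div, div_le_iff₀ hp1, mul_comm]
        refine maxDelta_le_mul g X (by omega) hz.2.2 ?_ fun n hn => hg n hn _ hm
        exact (Nat.coprime_of_lt_prime (by omega) (by omega) hz.2.2).symm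
    _ = ∑ q ∈ (Icc 1 R ×ˢ T).image (fun z => z.1 * z.2), maxDelta g X q :=
        (sum_image hinj).symm
    _ ≤ _ := sum_le_sum_of_subset_of_nonneg (image_subset_iff.mpr hmem)
        fun q _ _ => maxDelta_nonneg g X q

/-- The discrepancy of `f ∈ 𝒞` restricted to integers coprime to `q`, in terms of that of `f`. -/
lemma exists_norm_Delta_coprimePart_le :
    ∃ C : ℝ, 0 < C ∧ ∀ (f : ArithmeticFunction ℂ), ClassC f → ∀ x η : ℝ, 1 ≤ x → 0 ≤ η →
      (∀ X : ℝ, x ^ (1 / 2 : ℝ) ≤ X → X ≤ x → ∀ d : ℕ, 1 ≤ d → ∀ a : (ZMod d)ˣ,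
        ‖Delta f X d a‖ ≤ η * X) →
      ∀ q : ℕ, q ≠ 0 → (q : ℝ) ≤ x ^ (1 / 2 : ℝ) → ∀ d : ℕ, 1 ≤ d → ∀ b : (ZMod d)ˣ,
        ‖Delta (coprimePart f q) x d b‖ ≤ η * x * (1 + Real.log x) + C * x ^ (7 / 8 : ℝ) := by
  obtain ⟨C, hC, hsq⟩ := exists_sum_inv_sqrt_le
  refine ⟨2 * C, by positivity, fun f hf x η hx hη hyp q hq hqx d hd b => ?_⟩
  have hx0 : 0 < x := by linarith
  obtain ⟨g, hg, hg1, hgs⟩ := exists_coprime_convolution hf q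
  set z := x ^ (1 / 2 : ℝ) with hz
  have hz0 : 0 < z := by positivity
  have hzz : z * z = x := by
    rw [hz, ← Real.rpow_add hx0]
    norm_num
  set N := ⌊x⌋₊ with hN
  -- For `m ≤ √x` the point `x/m` is still at least `√x` and the hypothesis applies. For larger `m`
  -- the trivial bound `2x/m ≤ 2 x^(3/4) m^(-1/2)` is summed over the sparse support of `g`, giving
  -- `x^(3/4) q^(1/4) ≤ x^(7/8)` up to a constant.
  set M : ℕ → ℝ := fun m => if (m : ℝ) ≤ z then η * (x / m) else 2 * (x / m) with hM
  have h1 := norm_Delta_le_of_convolution (c := coprimePart f q) (u := g) (v := f) (x := x) d b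
    (fun n _ => by rw [← hg n, ArithmeticFunction.mul_apply]) M (fun m hm _ b => ?_)
  · refine h1.trans ?_
    set S := (Icc 1 N).filter (fun m => g m ≠ 0 ∧ ¬ (m : ℝ) ≤ z) with hS
    have h2 : ∀ m ∈ Icc 1 N, ‖g m‖ * M m ≤ η * x * (1 / (m : ℝ)) +
        (if g m ≠ 0 ∧ ¬ (m : ℝ) ≤ z then 2 * x ^ (3 / 4 : ℝ) * (m : ℝ) ^ (-(1 / 2 : ℝ)) else 0) := by
      intro m hm
      have hm0 : (0 : ℝ) < m := by exact_mod_cast (mem_Icc.mp hm).1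
      have hpos : 0 ≤ η * x * (1 / (m : ℝ)) := by positivity
      by_cases h0 : g m = 0
      · rw [h0]
        simpa using hpos
      simp only [hM]
      by_cases hmz : (m : ℝ) ≤ z
      · rw [if_pos hmz, if_neg (by tauto), add_zero]
        calc _ ≤ 1 * (η * (x / m)) := by gcongr; exact hg1 m
          _ = _ := by ring
      · rw [if_neg hmz, if_pos ⟨h0, hmz⟩]
        refine le_trans ?_ (le_add_of_nonneg_left hpos)
        have e1 : x / m = x * ((m : ℝ) ^ (-(1 / 2 : ℝ)) * (m : ℝ) ^ (-(1 / 2 : ℝ))) := by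
          rw [← Real.rpow_add hm0]
          norm_num
          rw [Real.rpow_neg_one]
          rfl
        have e2 : (m : ℝ) ^ (-(1 / 2 : ℝ)) ≤ x ^ (-(1 / 4) : ℝ) := by
          calc (m : ℝ) ^ (-(1 / 2 : ℝ)) ≤ z ^ (-(1 / 2 : ℝ)) :=
                Real.rpow_le_rpow_of_nonpos hz0 (not_le.mp hmz).le (by norm_num)
            _ = _ := by rw [hz, ← Real.rpow_mul hx0.le]; norm_num
        have e3 : x * x ^ (-(1 / 4) : ℝ) = x ^ (3 / 4 : ℝ) := by
          nth_rewrite 1 [← Real.rpow_one x]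
          rw [← Real.rpow_add hx0]
          norm_num
        calc ‖g m‖ * (2 * (x / m)) ≤ 1 * (2 * (x / m)) := by gcongr; exact hg1 m
          _ = 2 * x * (m : ℝ) ^ (-(1 / 2 : ℝ)) * (m : ℝ) ^ (-(1 / 2 : ℝ)) := by rw [e1]; ring
          _ ≤ 2 * x * x ^ (-(1 / 4) : ℝ) * (m : ℝ) ^ (-(1 / 2 : ℝ)) := by gcongr
          _ = _ := by rw [← e3]; ring
    refine (sum_le_sum h2).trans ?_
    rw [sum_add_distrib, ← sum_filter, ← hS, ← mul_sum, ← mul_sum]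
    have hN1 : (1 : ℝ) ≤ N := by exact_mod_cast Nat.le_floor (by simpa using hx)
    have h3 : ∑ k ∈ Icc 1 N, 1 / (k : ℝ) ≤ 1 + Real.log x := by
      refine (sum_one_div_le N).trans ?_
      gcongr
      exact Nat.floor_le hx0.le
    have h4 := hsq q hq S fun n hn => by
      rw [hS, mem_filter, mem_Icc] at hn
      exact ⟨by omega, fun p hp hpn => hgs n hn.2.1 p hp hpn⟩
    have h5 : (q : ℝ) ^ (1 / 4 : ℝ) ≤ x ^ (1 / 8 : ℝ) := by
      calc (q : ℝ) ^ (1 / 4 : ℝ) ≤ z ^ (1 / 4 : ℝ) := by gcongr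
        _ = _ := by rw [hz, ← Real.rpow_mul hx0.le]; norm_num
    have h6 : x ^ (3 / 4 : ℝ) * x ^ (1 / 8 : ℝ) = x ^ (7 / 8 : ℝ) := by
      rw [← Real.rpow_add hx0]; norm_num
    calc _ ≤ η * x * (1 + Real.log x) + 2 * x ^ (3 / 4 : ℝ) * (C * x ^ (1 / 8 : ℝ)) := by
          gcongr
          exact h4.trans (by gcongr)
      _ = _ := by rw [← h6]; ring
  · have hm0 : (0 : ℝ) < m := by exact_mod_cast (mem_Icc.mp hm).1
    have hm1 : (1 : ℝ) ≤ m := by exact_mod_cast (mem_Icc.mp hm).1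
    simp only [hM]
    split_ifs with h
    · refine hyp _ ?_ (div_le_self hx0.le hm1) d hd b
      rw [le_div_iff₀ hm0]
      calc z * m ≤ z * z := by gcongr
        _ = x := hzz
    · exact norm_Delta_le (fun n => hf.norm_le_one n) (by positivity) d b

/-! ### The rough part: integers with a prime factor exceeding `y` -/

/-- The restriction of `f` to the primes exceeding `Y`. -/
def primesAbove (f : ℕ → ℂ) (Y n : ℕ) : ℂ := if n.Prime ∧ Y < n then f n else 0

/-- The restriction of `f` to the integers with a prime factor exceeding `Y`. -/
def roughPart (f : ℕ → ℂ) (Y n : ℕ) : ℂ := f n - smoothPart f Y n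

/-- An integer below `(Y+1)²` has at most one prime factor exceeding `Y`, with exponent one. Thus
the convolution has at most one term, and multiplicativity evaluates it; the large prime is coprime
to `q ≤ Y` automatically. -/
lemma coprimePart_roughPart {f : ArithmeticFunction ℂ} (hf : f.IsMultiplicative) {Y q n : ℕ}
    (hq0 : 0 < q) (hq : q ≤ Y) (hn0 : 0 < n) (hn : n < (Y + 1) * (Y + 1)) :
    coprimePart (roughPart f Y) q n =
      ∑ p ∈ n.divisorsAntidiagonal, coprimePart f q p.1 * primesAbove f Y p.2 := by
  classical
  by_cases hs : n ∈ Nat.smoothNumbers (Y + 1)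
  · have h1 : roughPart f Y n = 0 := by
      unfold roughPart smoothPart
      rw [if_pos hs, sub_self]
    have h2 : coprimePart (roughPart f Y) q n = 0 := by
      unfold coprimePart
      split_ifs
      · exact h1
      · rfl
    rw [h2]
    refine (sum_eq_zero fun p hp => ?_).symm
    unfold primesAbove
    rw [if_neg, mul_zero]
    rintro ⟨h3, h4⟩
    have := (Nat.mem_smoothNumbers'.mp hs) p.2 h3
      ((Nat.mem_divisorsAntidiagonal.mp hp).1 ▸ dvd_mul_left p.2 p.1)
    omega
  · have h1 : roughPart f Y n = f n := by
      unfold roughPart smoothPart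
      rw [if_neg hs, sub_zero]
    rw [Nat.mem_smoothNumbers'] at hs
    push Not at hs
    obtain ⟨p, hp, ⟨m, hm⟩, hpY⟩ := hs
    have hm0 : 0 < m := Nat.pos_of_ne_zero fun h => by rw [h, mul_zero] at hm; omega
    have hmY : m ≤ Y := by
      by_contra h
      have := Nat.mul_le_mul hpY (by omega : Y + 1 ≤ m)
      omega
    have hcop : m.Coprime p := (Nat.coprime_of_lt_prime hm0.ne' (by omega) hp).symm
    have hpq : p.Coprime q := Nat.coprime_of_lt_prime hq0.ne' (by omega) hp
    rw [sum_eq_single (m, p)]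
    · have h2 : coprimePart (roughPart f Y) q n = coprimePart f q m * f p := by
        unfold coprimePart
        rw [h1, hm, mul_comm p m, hf.map_mul_of_coprime hcop]
        have : (m * p).Coprime q ↔ m.Coprime q := by
          rw [Nat.coprime_mul_iff_left]
          exact ⟨fun h => h.1, fun h => ⟨h, hpq⟩⟩
        simp only [this]
        split_ifs <;> simp
      rw [h2]
      unfold primesAbove
      rw [if_pos ⟨hp, by omega⟩]
    · rintro ⟨m', p'⟩ hmem hne
      unfold primesAbove
      rw [if_neg, mul_zero]
      rintro ⟨h3, h4⟩
      simp only at h3 h4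
      obtain ⟨h5, _⟩ := Nat.mem_divisorsAntidiagonal.mp hmem
      simp only at h5
      have h6 : p' ∣ p * m := by rw [← hm, ← h5]; exact dvd_mul_left _ _
      rcases (Nat.Prime.dvd_mul h3).mp h6 with h7 | h7
      · have h8 := (Nat.prime_dvd_prime_iff_eq h3 hp).mp h7
        subst h8
        apply hne
        rw [hm, mul_comm] at h5
        rw [Nat.eq_of_mul_eq_mul_left hp.pos h5]
      · have := Nat.le_of_dvd hm0 h7
        omega
    · intro h
      exact absurd (Nat.mem_divisorsAntidiagonal.mpr ⟨by rw [hm, mul_comm], hn0.ne'⟩) h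

lemma Delta_primesAbove (f : ℕ → ℂ) {X y : ℝ} (hyX : y ≤ X) (q : ℕ) (a : (ZMod q)ˣ) :
    Delta (primesAbove f ⌊y⌋₊) X q a = Delta (onPrimes f) X q a - Delta (onPrimes f) y q a := by
  have hle : ⌊y⌋₊ ≤ ⌊X⌋₊ := Nat.floor_le_floor hyX
  have h1 : ∀ (P : ℕ → Prop) [DecidablePred P], ∑ n ∈ (Icc 1 ⌊X⌋₊).filter P, primesAbove f ⌊y⌋₊ n =
      ∑ n ∈ (Icc 1 ⌊X⌋₊).filter P, onPrimes f n - ∑ n ∈ (Icc 1 ⌊y⌋₊).filter P, onPrimes f n := by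
    intro P _
    have e : (Icc 1 ⌊y⌋₊).filter P = ((Icc 1 ⌊X⌋₊).filter P).filter (· ≤ ⌊y⌋₊) := by
      ext n
      simp only [mem_filter, mem_Icc]
      constructor
      · rintro ⟨⟨h1, h2⟩, h3⟩; exact ⟨⟨⟨h1, h2.trans hle⟩, h3⟩, h2⟩
      · rintro ⟨⟨⟨h1, _⟩, h3⟩, h2⟩; exact ⟨⟨h1, h2⟩, h3⟩
    rw [e, sum_filter (p := (· ≤ ⌊y⌋₊)), ← sum_sub_distrib]
    refine sum_congr rfl fun n _ => ?_
    unfold primesAbove onPrimes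
    by_cases hp : n.Prime
    · rw [Set.indicator_of_mem (by exact hp)]
      by_cases hn : n ≤ ⌊y⌋₊
      · rw [if_neg (by omega), if_pos hn, sub_self]
      · rw [if_pos ⟨hp, by omega⟩, if_neg hn, sub_zero]
    · rw [Set.indicator_of_notMem (by exact hp), if_neg (fun h => hp h.1)]
      simp
  unfold Delta
  rw [h1, h1]
  ring

lemma maxDelta_primesAbove_le (f : ℕ → ℂ) {X y : ℝ} (hyX : y ≤ X) {q : ℕ} (hq : q ≠ 0) :
    maxDelta (primesAbove f ⌊y⌋₊) X q ≤ maxDelta (onPrimes f) X q + maxDelta (onPrimes f) y q := by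
  refine maxDelta_le fun a => ?_
  rw [Delta_primesAbove f hyX]
  exact (norm_sub_le _ _).trans
    (add_le_add (norm_Delta_le_maxDelta _ _ hq a) (norm_Delta_le_maxDelta _ _ hq a))

lemma maxDelta_primesAbove_eq_zero (f : ℕ → ℂ) {X y : ℝ} (hXy : X ≤ y) (q : ℕ) :
    maxDelta (primesAbove f ⌊y⌋₊) X q = 0 := by
  have h0 : ∀ n ∈ Icc 1 ⌊X⌋₊, primesAbove f ⌊y⌋₊ n = 0 := by
    intro n hn
    have := Nat.floor_le_floor hXy
    rw [mem_Icc] at hn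
    exact if_neg (by omega)
  refine le_antisymm (maxDelta_le fun a => le_of_eq ?_) (maxDelta_nonneg _ _ _)
  unfold Delta
  rw [sum_eq_zero fun n hn => h0 n (mem_filter.mp hn).1,
    sum_eq_zero fun n hn => h0 n (mem_filter.mp hn).1]
  simp

/-- The maximal discrepancies of `f` on the primes in `(y, x / m]`, summed over `m`. -/
def primeDiscrepancy (f : ℕ → ℂ) (x y : ℝ) (q : ℕ) : ℝ :=
  ∑ m ∈ Icc 1 ⌊x⌋₊, maxDelta (primesAbove f ⌊y⌋₊) (x / m) q

/-- The coefficients of the cofactor `m` are bounded by `1`, so both `f(m)` and the coprimality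
condition on `m` disappear. The resulting bound depends on `d` but not on `q`. -/
lemma norm_Delta_coprimePart_roughPart_le {f : ArithmeticFunction ℂ} (hf : ClassC f) {x y : ℝ}
    (hx : 0 ≤ x) (hxy : x < (⌊y⌋₊ + 1 : ℝ) * (⌊y⌋₊ + 1)) {q : ℕ} (hq0 : 0 < q) (hq : q ≤ ⌊y⌋₊) {d : ℕ}
    (hd : d ≠ 0) (b : (ZMod d)ˣ) :
    ‖Delta (coprimePart (roughPart f ⌊y⌋₊) q) x d b‖ ≤ primeDiscrepancy f x y d := by
  refine (norm_Delta_le_of_convolution (u := coprimePart f q) (v := primesAbove f ⌊y⌋₊) d b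
    (fun n hn => ?_) (fun m => maxDelta (primesAbove f ⌊y⌋₊) (x / m) d)
    fun m _ _ b => norm_Delta_le_maxDelta _ _ hd b).trans (sum_le_sum fun m _ => ?_)
  · rw [mem_Icc] at hn
    refine coprimePart_roughPart hf.1 hq0 hq hn.1 ?_
    have h1 : (n : ℝ) ≤ x := (Nat.cast_le.mpr hn.2).trans (Nat.floor_le hx)
    exact_mod_cast h1.trans_lt hxy
  · refine mul_le_of_le_one_left (maxDelta_nonneg _ _ _) ?_
    unfold coprimePart
    split_ifs
    · exact hf.norm_le_one m
    · simp

lemma norm_Delta_roughPart_le {f : ArithmeticFunction ℂ} (hf : ClassC f) {x y : ℝ}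
    (hx : 0 ≤ x) (hxy : x < (⌊y⌋₊ + 1 : ℝ) * (⌊y⌋₊ + 1)) (hy : 1 ≤ y) {q : ℕ} (hq : q ≠ 0)
    (b : (ZMod q)ˣ) :
    ‖Delta (roughPart f ⌊y⌋₊) x q b‖ ≤ primeDiscrepancy f x y q := by
  have h := norm_Delta_coprimePart_roughPart_le hf hx hxy one_pos (Nat.le_floor (by simpa using hy))
    hq b
  have e : coprimePart (roughPart f ⌊y⌋₊) 1 = roughPart f ⌊y⌋₊ := by
    funext n
    exact if_pos (Nat.coprime_one_right n)
  rwa [e] at h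

/-- Primes in `(y, x/m]` exist only for `m ≤ x/y`, and the hypothesis at `x/m` and at `y ≤ x/m`
gives `2εx/m`. The harmonic sum over `m` produces `1 + log(x/y)`. -/
lemma sum_primeDiscrepancy_le {f : ℕ → ℂ} {x y ε : ℝ} {Q : ℕ} (hy : 0 < y) (hyx : y ≤ x)
    (hε : 0 ≤ ε)
    (hyp : ∀ X, y ≤ X → X ≤ x → ∑ q ∈ Icc 1 Q, maxDelta (onPrimes f) X q ≤ ε * X) :
    ∑ q ∈ Icc 1 Q, primeDiscrepancy f x y q ≤ 2 * ε * x * (1 + Real.log (x / y)) := by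
  have hx : 0 < x := by linarith
  unfold primeDiscrepancy
  rw [sum_comm]
  have h1 : ∀ m ∈ Icc 1 ⌊x⌋₊, ∑ q ∈ Icc 1 Q, maxDelta (primesAbove f ⌊y⌋₊) (x / m) q ≤
      if m ≤ ⌊x / y⌋₊ then 2 * ε * x * (1 / (m : ℝ)) else 0 := by
    intro m hm
    have hm0 : (0 : ℝ) < m := by exact_mod_cast (mem_Icc.mp hm).1
    have hm1 : (1 : ℝ) ≤ m := by exact_mod_cast (mem_Icc.mp hm).1
    split_ifs with h
    · have h2 : (m : ℝ) ≤ x / y := (Nat.le_floor_iff (by positivity)).mp h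
      have h3 : y ≤ x / m := by
        rw [le_div_iff₀ hy] at h2
        rw [le_div_iff₀ hm0]
        linarith
      calc _ ≤ ∑ q ∈ Icc 1 Q, (maxDelta (onPrimes f) (x / m) q + maxDelta (onPrimes f) y q) :=
            sum_le_sum fun q hq => maxDelta_primesAbove_le f h3
              (by have := (mem_Icc.mp hq).1; omega)
        _ ≤ ε * (x / m) + ε * y := by
            rw [sum_add_distrib]
            exact add_le_add (hyp _ h3 (div_le_self hx.le hm1)) (hyp y le_rfl hyx)
        _ ≤ ε * (x / m) + ε * (x / m) := by gcongr
        _ = _ := by ring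
    · rw [not_le, Nat.floor_lt (by positivity), div_lt_iff₀ hy] at h
      refine le_of_eq (sum_eq_zero fun q _ => maxDelta_primesAbove_eq_zero f ?_ q)
      rw [div_le_iff₀ hm0]
      linarith
  refine (sum_le_sum h1).trans ?_
  rw [← sum_filter, ← mul_sum]
  have hxy1 : 1 ≤ x / y := by rwa [le_div_iff₀ hy, one_mul]
  refine mul_le_mul_of_nonneg_left ?_ (by positivity)
  calc _ ≤ ∑ m ∈ Icc 1 ⌊x / y⌋₊, 1 / (m : ℝ) := by
        refine sum_le_sum_of_subset_of_nonneg (fun m hm => ?_) fun _ _ _ => by positivity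
        rw [mem_filter, mem_Icc] at hm
        exact mem_Icc.mpr ⟨hm.1.1, hm.2⟩
    _ ≤ 1 + Real.log ⌊x / y⌋₊ := sum_one_div_le _
    _ ≤ _ := by
        gcongr
        · exact_mod_cast Nat.floor_pos.mpr hxy1
        · exact Nat.floor_le (by positivity)

/-- Applied for each `m` separately: a prime exceeding `y ≥ Q` is coprime to every modulus up to
`Q`, which is the support condition needed. -/
lemma sum_primeDiscrepancy_mul_sum_prime_le (f : ℕ → ℂ) (x y : ℝ) {R Y Q : ℕ} (hQ : R * Y ≤ Q)
    (hQy : Q ≤ ⌊y⌋₊) :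
    (∑ d ∈ Icc 1 R, primeDiscrepancy f x y d) * ∑ p ∈ Ioc R Y with p.Prime, 1 / ((p : ℝ) - 1) ≤
      ∑ q ∈ Icc 1 Q, primeDiscrepancy f x y q := by
  unfold primeDiscrepancy
  rw [sum_comm, sum_comm (s := Icc 1 Q), sum_mul]
  refine sum_le_sum fun m _ => sum_maxDelta_mul_sum_prime_le _ _ hQ fun n hn k hk => ?_
  have hk' := mem_Icc.mp hk
  have hn' : n.Prime ∧ ⌊y⌋₊ < n := by
    by_contra h
    exact hn (if_neg h)
  exact Nat.coprime_of_lt_prime (by omega) (by omega) hn'.1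

/-! ### Combination of the four parts -/

lemma bvSum_le_of_parts {f : ArithmeticFunction ℂ} (hf : ClassC f) {x y Q : ℝ} {R : ℕ} (hR : 0 < R)
    (hx : 0 ≤ x) (hxy : x < (⌊y⌋₊ + 1 : ℝ) * (⌊y⌋₊ + 1)) (hy : 1 ≤ y) (hQy : ⌊Q⌋₊ ≤ ⌊y⌋₊)
    {h P D D' ΦQ ΦR : ℝ} (h0 : 0 ≤ h)
    (hh : ∀ q ∈ Icc 1 ⌊Q⌋₊, ∀ d : ℕ, 1 ≤ d → ∀ b : (ZMod d)ˣ,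
      ‖Delta (coprimePart f q) x d b‖ ≤ h)
    (hP : ∀ k, primMean R ⌊Q⌋₊ (fun _ ψ => charSum (coprimePart (smoothPart f ⌊y⌋₊) k) x ψ) ≤ P)
    (hΦQ : ∑ k ∈ Icc 1 ⌊Q⌋₊, 1 / (k.totient : ℝ) ≤ ΦQ)
    (hΦR : ∑ k ∈ Icc 1 R, 1 / (k.totient : ℝ) ≤ ΦR)
    (hD : ∑ q ∈ Icc 1 ⌊Q⌋₊, primeDiscrepancy f x y q ≤ D)
    (hD' : ∑ q ∈ Icc 1 R, primeDiscrepancy f x y q ≤ D') :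
    bvSum f x Q ≤ ΦQ * (ΦR * (R * h)) + ΦQ * P + D + ΦQ * (ΦR * D') := by
  obtain ⟨b, hb⟩ := exists_bvSum_eq f x Q
  set N := ⌊Q⌋₊ with hN
  set Y := ⌊y⌋₊ with hY
  have hpd0 : ∀ d, 0 ≤ primeDiscrepancy f x y d :=
    fun d => sum_nonneg fun m _ => maxDelta_nonneg _ _ _
  have hΦQ0 : 0 ≤ ∑ k ∈ Icc 1 N, 1 / (k.totient : ℝ) := sum_nonneg fun _ _ => by positivity
  have hΦR0 : 0 ≤ ∑ k ∈ Icc 1 R, 1 / (k.totient : ℝ) := sum_nonneg fun _ _ => by positivity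
  have hΦQ1 := hΦQ0.trans hΦQ
  have hΦR1 := hΦR0.trans hΦR
  have hP0 : 0 ≤ P := (primMean_nonneg _ _ _).trans (hP 1)
  have hD'0 : 0 ≤ D' := (sum_nonneg fun d _ => hpd0 d).trans hD'
  have h1 : ∀ q ∈ Icc 1 N, ‖Delta f x q (b q)‖ ≤ ‖smallPart f x R q (b q)‖ +
      ‖largePart (smoothPart f Y) x R q (b q)‖ + ‖Delta (roughPart f Y) x q (b q)‖ +
        ‖smallPart (roughPart f Y) x R q (b q)‖ := by
    intro q hq
    have : NeZero q := ⟨by have := (mem_Icc.mp hq).1; omega⟩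
    have e1 := Delta_eq_smallPart_add_largePart f x hR (b q)
    have e2 := Delta_eq_smallPart_add_largePart (roughPart f Y) x hR (b q)
    have e3 := largePart_add (smoothPart f Y) (roughPart f Y) x R q (b q)
    have e4 : (fun n => smoothPart f Y n + roughPart f Y n) = f := by
      funext n
      unfold roughPart
      ring
    rw [e4] at e3
    -- The large-conductor part of the rough function is traded for its full discrepancy minus its
    -- small-conductor part, both of which reduce to discrepancies over primes.
    have e5 : Delta f x q (b q) = smallPart f x R q (b q) + largePart (smoothPart f Y) x R q (b q) +
        Delta (roughPart f Y) x q (b q) - smallPart (roughPart f Y) x R q (b q) := by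
      rw [e1, e2, e3]; ring
    rw [e5]
    exact (norm_sub_le _ _).trans (add_le_add (norm_add₃_le) le_rfl)
  have h2 := sum_smallPart_le f x R N b (fun _ => h) (fun _ => h0)
    fun q hq d hd _ b => hh q hq d (mem_Icc.mp hd).1 b
  have h3 := sum_largePart_le (smoothPart f Y) x R N b
  have h4 : ∑ q ∈ Icc 1 N, ‖Delta (roughPart f Y) x q (b q)‖ ≤ D :=
    (sum_le_sum fun q hq => norm_Delta_roughPart_le hf hx hxy hy
      (by have := (mem_Icc.mp hq).1; omega) (b q)).trans hD
  have h5 := sum_smallPart_le (roughPart f Y) x R N b (primeDiscrepancy f x y) hpd0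
    fun q hq d hd _ b => norm_Delta_coprimePart_roughPart_le hf hx hxy (mem_Icc.mp hq).1
      ((mem_Icc.mp hq).2.trans hQy) (by have := (mem_Icc.mp hd).1; omega) b
  rw [hb]
  refine (sum_le_sum h1).trans ?_
  rw [sum_add_distrib, sum_add_distrib, sum_add_distrib]
  refine add_le_add (add_le_add (add_le_add (h2.trans ?_) (h3.trans ?_)) h4) (h5.trans ?_)
  · rw [sum_const, Nat.card_Icc, Nat.add_sub_cancel, nsmul_eq_mul]
    gcongr
  · calc _ ≤ ∑ k ∈ Icc 1 N, 1 / (k.totient : ℝ) * P :=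
          sum_le_sum fun k _ => mul_le_mul_of_nonneg_left (hP k) (by positivity)
      _ = (∑ k ∈ Icc 1 N, 1 / (k.totient : ℝ)) * P := by rw [sum_mul]
      _ ≤ _ := by gcongr
  · have : 0 ≤ ∑ d ∈ Icc 1 R, primeDiscrepancy f x y d := sum_nonneg fun d _ => hpd0 d
    gcongr

/-! ### Choice of parameters and asymptotics -/

open Filter

lemma natLog_two_add_one_le {n : ℕ} {x : ℝ} (hn : (n : ℝ) ≤ x) (hx : 1 ≤ Real.log x) :
    (Nat.log 2 n : ℝ) + 1 ≤ 3 * Real.log x := by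
  rcases Nat.eq_zero_or_pos n with h | h
  · rw [h]
    simp
    linarith
  · have h1 : (2 : ℝ) ^ Nat.log 2 n ≤ n := by exact_mod_cast Nat.pow_log_le_self 2 h.ne'
    have h2 := Real.log_le_log (by positivity) (h1.trans hn)
    rw [Real.log_pow] at h2
    have := Real.log_two_gt_d9
    nlinarith [(Nat.cast_nonneg (Nat.log 2 n) : (0 : ℝ) ≤ Nat.log 2 n)]

lemma eventually_mul_log_log_sq_le (M : ℝ) :
    ∀ᶠ x : ℝ in atTop, M * Real.log (Real.log x) ^ 2 ≤ √(Real.log x) := by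
  have h1 : (fun t : ℝ => Real.log t ^ 2) =o[atTop] fun t => t ^ (1 / 2 : ℝ) := by
    have := isLittleO_log_rpow_rpow_atTop (s := 1 / 2) (2 : ℝ) (by norm_num)
    simpa using this
  have h2 := (h1.bound (c := 1 / (|M| + 1)) (by positivity))
  have h3 := (Real.tendsto_log_atTop.eventually h2)
  filter_upwards [h3, Real.tendsto_log_atTop.eventually_ge_atTop 0] with x hx hx0
  rw [Real.norm_of_nonneg (by positivity), Real.norm_of_nonneg (by positivity),
    ← Real.sqrt_eq_rpow, one_div, ← div_eq_inv_mul, le_div_iff₀ (by positivity)] at hx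
  have := le_abs_self M
  nlinarith [sq_nonneg (Real.log (Real.log x))]

lemma eventually_log_rpow_le (M : ℝ) {δ : ℝ} (hδ : 0 < δ) :
    ∀ᶠ x : ℝ in atTop, Real.log x ^ M ≤ x ^ δ := by
  have h1 := isLittleO_log_rpow_rpow_atTop M hδ
  filter_upwards [h1.bound (c := 1) one_pos, eventually_ge_atTop 1] with x hx hx1
  rwa [one_mul, Real.norm_of_nonneg (Real.rpow_nonneg (Real.log_nonneg hx1) _),
    Real.norm_of_nonneg (by positivity)] at hx

lemma eventually_log_log_le (B : ℝ) (hB : 0 ≤ B) :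
    ∀ᶠ x : ℝ in atTop, Real.log 4 + 5 + 4 * Real.log (1 + 2 * (B * Real.log (Real.log x))) ≤
      Real.log (Real.log x) / 2 := by
  have h : ∀ᶠ t : ℝ in atTop, Real.log 4 + 5 + 4 * Real.log (1 + 2 * (B * t)) ≤ t / 2 := by
    have h1 := Real.isLittleO_log_id_atTop.bound (c := 1 / 32) (by norm_num)
    filter_upwards [h1, eventually_ge_atTop 1, eventually_ge_atTop
      (4 * (Real.log 4 + 5 + 4 * Real.log (1 + 2 * B)))] with t ht ht1 ht2
    rw [Real.norm_of_nonneg (Real.log_nonneg ht1), id, Real.norm_of_nonneg (by linarith)] at ht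
    have h3 : Real.log (1 + 2 * (B * t)) ≤ Real.log (1 + 2 * B) + Real.log t := by
      rw [← Real.log_mul (by positivity) (by positivity)]
      refine Real.log_le_log (by positivity) ?_
      nlinarith
    linarith
  exact (Real.tendsto_log_atTop.comp Real.tendsto_log_atTop).eventually h

set_option maxHeartbeats 1000000 in
/-- The large-conductor mean values of the `y`-smooth part of `f ∈ 𝒞`. -/
lemma exists_primMean_smooth_le (A B γ : ℝ) (hA : 0 ≤ A) (hB : A + 3 ≤ B) (hγ : 2 * A + 6 ≤ γ) :
    ∃ K : ℝ, 0 ≤ K ∧ ∀ᶠ x : ℝ in atTop, ∀ f : ArithmeticFunction ℂ, ClassC f → ∀ k : ℕ,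
      primMean ⌊Real.log x ^ B⌋₊ ⌊x ^ (1 / 2 : ℝ) / Real.log x ^ B⌋₊
        (fun _ ψ => charSum (coprimePart (smoothPart f ⌊x / Real.log x ^ γ⌋₊) k) x ψ) ≤
          K * (x / Real.log x ^ A) := by
  -- With `T = √L/2` below, `(2T/L)^(2J) = L^(-J)`, so this `J` gives `L^(-(2A+2))`; its square root
  -- times the one logarithm of the linear sieve is `L^(-A)`.
  set J : ℕ := ⌈2 * A + 2⌉₊ with hJ
  set c := Real.log (3 / 2) with hc
  have hc0 : 0 < c := Real.log_pos (by norm_num)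
  have hc1 : c ≤ 1 / 2 := by
    have := Real.log_le_sub_one_of_pos (show (0 : ℝ) < 3 / 2 by norm_num)
    linarith
  -- Chosen so that `M (log L)² ≤ √L` says exactly that `κT ≥ (2A + 2 + 2(2A+7)) log L`. The summand
  -- `2(2A+7)` pays for `Z² ≤ L^(2(2A+7))`.
  set M := 2 * (2 * A + 7) * (2 * A + 2 + 2 * (2 * A + 7)) / c with hM
  refine ⟨J * (2 ^ J * (9 * 135 * 8) + 540) + 1080, by positivity, ?_⟩
  filter_upwards [eventually_ge_atTop 4, Real.tendsto_log_atTop.eventually_ge_atTop 8,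
    (Real.tendsto_log_atTop.comp Real.tendsto_log_atTop).eventually_ge_atTop 1,
    eventually_mul_log_log_sq_le M] with x hx4 hL8 hl1 hMl f hf k
  simp only [Function.comp_apply] at hl1
  have hfC := hf
  obtain ⟨hm, Lam, hLam, hb⟩ := hf
  set L := Real.log x with hL
  set l := Real.log L with hl
  have hx0 : 0 < x := by linarith
  have hL0 : 0 < L := by linarith
  have hL1 : 1 ≤ L := by linarith
  -- The saving required of each term of the bilinear bound: three logarithms are lost, two to the
  -- dyadic blocks and halvings in `a` and one to the blocks of conductors.
  set w := L ^ (-(A + 3)) with hw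
  have hw0 : 0 < w := by positivity
  set Z : ℕ := ⌈L ^ (2 * A + 6)⌉₊ with hZ
  have hLp1 : 1 ≤ L ^ (2 * A + 6) := Real.one_le_rpow hL1 (by linarith)
  have hZge : L ^ (2 * A + 6) ≤ Z := Nat.le_ceil _
  have hZ1 : (1 : ℝ) ≤ Z := hLp1.trans hZge
  have hZle : (Z : ℝ) ≤ L ^ (2 * A + 7) := by
    have h1 := (Nat.ceil_lt_add_one (show 0 ≤ L ^ (2 * A + 6) by positivity)).le
    have h2 : L ^ (2 * A + 7) = L ^ (2 * A + 6) * L := by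
      rw [← Real.rpow_add_one hL0.ne']
      ring_nf
    rw [h2]
    nlinarith
  set R : ℕ := ⌊L ^ B⌋₊ with hR
  have hLB1 : 1 ≤ L ^ B := Real.one_le_rpow hL1 (by linarith)
  have hRpos : 0 < R := Nat.floor_pos.mpr hLB1
  have hRge : L ^ B / 2 ≤ R := by
    have h1 := Nat.lt_floor_add_one (L ^ B)
    have h2 : (1 : ℝ) ≤ R := by exact_mod_cast hRpos
    linarith
  set Q : ℕ := ⌊x ^ (1 / 2 : ℝ) / L ^ B⌋₊ with hQ
  set Y : ℕ := ⌊x / L ^ γ⌋₊ with hY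
  have hLBw : 1 / L ^ B ≤ w := by
    rw [one_div, ← Real.rpow_neg hL0.le]
    exact Real.rpow_le_rpow_of_exponent_le hL1 (by linarith)
  have hQle : (Q : ℝ) ≤ √x * w := by
    calc (Q : ℝ) ≤ x ^ (1 / 2 : ℝ) / L ^ B := Nat.floor_le (by positivity)
      _ = √x * (1 / L ^ B) := by rw [Real.sqrt_eq_rpow]; ring
      _ ≤ _ := by gcongr
  have hww : w * w = L ^ (-(2 * A + 6)) := by
    rw [hw, ← Real.rpow_add hL0]
    ring_nf
  have hsqw : √(L ^ (-(2 * A + 6))) = w := by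
    rw [← hww, Real.sqrt_mul_self hw0.le]
  have hYle : √(2 * (Y : ℝ)) ≤ 2 * (√x * w) := by
    have h1 : (2 : ℝ) * Y ≤ 2 ^ 2 * (x * L ^ (-(2 * A + 6))) := by
      have : (Y : ℝ) ≤ x * L ^ (-(2 * A + 6)) := by
        calc (Y : ℝ) ≤ x / L ^ γ := Nat.floor_le (by positivity)
          _ = x * L ^ (-γ) := by rw [Real.rpow_neg hL0.le]; rfl
          _ ≤ _ := by
            gcongr
      have : 0 ≤ x * L ^ (-(2 * A + 6)) := by positivity
      linarith
    refine (Real.sqrt_le_sqrt h1).trans (le_of_eq ?_)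
    rw [Real.sqrt_mul (by norm_num), Real.sqrt_sq (by norm_num), Real.sqrt_mul hx0.le, hsqw]
  have hZinv : 1 / (Z : ℝ) ≤ L ^ (-(2 * A + 6)) := by
    rw [Real.rpow_neg hL0.le, ← one_div]
    exact one_div_le_one_div_of_le (by positivity) hZge
  have hxZ : √(x / Z) ≤ √x * w := by
    rw [div_eq_mul_one_div, Real.sqrt_mul hx0.le]
    gcongr
    exact (Real.sqrt_le_sqrt hZinv).trans hsqw.le
  have h2xZ : √(2 * x / Z) ≤ 2 * (√x * w) := by
    rw [mul_div_assoc, Real.sqrt_mul (by norm_num)]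
    gcongr
    rw [Real.sqrt_le_left (by norm_num)]
    norm_num
  have hxR : √(2 * x) / R ≤ 3 * (√x * w) := by
    have h1 : 1 / (R : ℝ) ≤ 2 * w := by
      calc 1 / (R : ℝ) ≤ 1 / (L ^ B / 2) := one_div_le_one_div_of_le (by positivity) hRge
        _ = 2 * (1 / L ^ B) := by field_simp
        _ ≤ _ := by gcongr
    have h2 : √(2 : ℝ) ≤ 3 / 2 := by
      rw [Real.sqrt_le_left (by norm_num)]
      norm_num
    calc √(2 * x) / R = √2 * √x * (1 / R) := by rw [Real.sqrt_mul (by norm_num)]; ring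
      _ ≤ 3 / 2 * √x * (2 * w) := by gcongr
      _ = _ := by ring
  have hlog1 : (Nat.log 2 ⌊x⌋₊ : ℝ) + 1 ≤ 3 * L :=
    natLog_two_add_one_le (Nat.floor_le hx0.le) hL1
  have hw1 : w ≤ 1 := Real.rpow_le_one_of_one_le_of_nonpos hL1 (by linarith)
  have hQx : (Q : ℝ) ≤ x := by
    have : √x ≤ x := by
      rw [Real.sqrt_le_left hx0.le]
      nlinarith
    calc (Q : ℝ) ≤ √x * 1 := hQle.trans (by gcongr)
      _ ≤ x := by linarith
  have hlog2 : (Nat.log 2 Q : ℝ) + 1 ≤ 3 * L := natLog_two_add_one_le hQx hL1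
  have hQN : (Q : ℝ) ≤ √(⌊x⌋₊ : ℝ) := by
    have h1 : w ≤ 1 / 2 := by
      have h3 : L ^ (A + 3) ≥ L ^ (1 : ℝ) := Real.rpow_le_rpow_of_exponent_le hL1 (by linarith)
      rw [Real.rpow_one] at h3
      rw [hw, Real.rpow_neg hL0.le, inv_le_comm₀ (by positivity) (by norm_num)]
      linarith
    have h2 : √x / 2 = √(x / 4) := by
      rw [Real.sqrt_div hx0.le, show (4 : ℝ) = 2 ^ 2 by norm_num, Real.sqrt_sq (by norm_num)]
    calc (Q : ℝ) ≤ √x * (1 / 2) := hQle.trans (by gcongr)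
      _ = √(x / 4) := by rw [← h2]; ring
      _ ≤ _ := by
        apply Real.sqrt_le_sqrt
        have := Nat.lt_floor_add_one x
        linarith
  -- The largest exponent for which `Z ≤ L^(2A+7)` guarantees `Z^κ ≤ 3/2`.
  set κ := c / ((2 * A + 7) * l) with hκ
  have hκ0 : 0 < κ := by positivity
  have hκ1 : κ < 1 := by
    rw [hκ, div_lt_one (by positivity)]
    nlinarith
  have hκZ : (Z : ℝ) ^ κ ≤ 3 / 2 := by
    calc (Z : ℝ) ^ κ ≤ (L ^ (2 * A + 7)) ^ κ := by gcongr
      _ = Real.exp c := by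
        rw [← Real.rpow_mul hL0.le, Real.rpow_def_of_pos hL0, hκ]
        congr 1
        rw [← hl]
        field_simp
      _ = 3 / 2 := by rw [hc, Real.exp_log (by norm_num)]
  set T := √L / 2 with hT
  set v := L ^ (-(2 * A + 2)) with hv
  have hvexp : v = Real.exp (-((2 * A + 2) * l)) := by
    rw [hv, Real.rpow_def_of_pos hL0, ← hl]
    ring_nf
  have hE1 : (2 * T / L) ^ (2 * J) ≤ v := by
    have h1 : (2 * T / L) ^ 2 = L⁻¹ := by
      rw [hT, div_pow, mul_div_cancel₀ _ (by norm_num : (2 : ℝ) ≠ 0), Real.sq_sqrt hL0.le]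
      field_simp
    rw [pow_mul, h1, inv_pow, ← Real.rpow_natCast, ← Real.rpow_neg hL0.le]
    refine Real.rpow_le_rpow_of_exponent_le hL1 ?_
    have := Nat.le_ceil (2 * A + 2)
    linarith
  have hcM : M * c = 2 * (2 * A + 7) * (2 * A + 2 + 2 * (2 * A + 7)) := by
    rw [hM, div_mul_cancel₀ _ hc0.ne']
  have hκT : (2 * A + 2 + 2 * (2 * A + 7)) * l ≤ κ * T := by
    rw [hκ, hT, div_mul_div_comm, le_div_iff₀ (by positivity)]
    calc (2 * A + 2 + 2 * (2 * A + 7)) * l * ((2 * A + 7) * l * 2)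
        = (M * c) * l ^ 2 := by rw [hcM]; ring
      _ = c * (M * l ^ 2) := by ring
      _ ≤ c * √L := by gcongr
  have hT0 : 0 ≤ T := by positivity
  have hE2 : Real.exp (-T) ≤ v := by
    rw [hvexp]
    apply Real.exp_le_exp.mpr
    have h1 : κ * T ≤ T := mul_le_of_le_one_left hT0 hκ1.le
    have h2 : 0 ≤ 2 * (2 * A + 7) * l := by positivity
    linarith
  have hE3 : Real.exp (-κ * T) * (Z : ℝ) ^ 2 ≤ v := by
    have h1 : (Z : ℝ) ^ 2 ≤ Real.exp (2 * (2 * A + 7) * l) := by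
      calc (Z : ℝ) ^ 2 ≤ (L ^ (2 * A + 7)) ^ 2 := by gcongr
        _ = _ := by
          rw [Real.rpow_def_of_pos hL0, ← Real.exp_nat_mul, ← hl]
          push_cast
          ring_nf
    calc Real.exp (-κ * T) * (Z : ℝ) ^ 2
        ≤ Real.exp (-κ * T) * Real.exp (2 * (2 * A + 7) * l) := by gcongr
      _ = Real.exp (-κ * T + 2 * (2 * A + 7) * l) := (Real.exp_add _ _).symm
      _ ≤ v := by
        rw [hvexp]
        apply Real.exp_le_exp.mpr
        linarith
  have hLv : L * √v = L ^ (-A) := by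
    have : √v = L ^ (-(A + 1)) := by
      rw [hv, Real.sqrt_eq_rpow, ← Real.rpow_mul hL0.le]
      ring_nf
    rw [this, mul_comm, ← Real.rpow_add_one hL0.ne']
    ring_nf
  have hLw : L ^ 3 * w = L ^ (-A) := by
    rw [hw, ← Real.rpow_natCast L 3, ← Real.rpow_add hL0]
    push_cast
    ring_nf
  have hLw1 : L * w ≤ L ^ (-A) := by
    rw [← hLw]
    gcongr
    exact le_self_pow₀ hL1 (by norm_num)
  have hsE : √(x * ((2 * T / L) ^ (2 * J) + Real.exp (-T) + Real.exp (-κ * T) * (Z : ℝ) ^ 2)) ≤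
      2 * (√x * √v) := by
    have : x * ((2 * T / L) ^ (2 * J) + Real.exp (-T) + Real.exp (-κ * T) * (Z : ℝ) ^ 2) ≤
        2 ^ 2 * (x * v) := by
      have h0 : 0 ≤ v := by positivity
      calc _ ≤ x * (v + v + v) := by gcongr
        _ ≤ _ := by nlinarith
    refine (Real.sqrt_le_sqrt this).trans (le_of_eq ?_)
    rw [Real.sqrt_mul (by norm_num), Real.sqrt_sq (by norm_num), Real.sqrt_mul hx0.le]
  have hsx : √x * √x = x := Real.mul_self_sqrt hx0.le
  have main := primMean_smooth_le hm hLam (fun n => norm_le_vonMangoldt hb n)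
    (fun n => hfC.norm_le_one n) k R Q Z Y J hRpos (by exact_mod_cast hZ1) (T := T)
    (by linarith : 2 ≤ x) hQN hκ1 hκ0.le hκZ
  refine main.trans ?_
  rw [← hL]
  have hLA : x / L ^ A = x * L ^ (-A) := by rw [Real.rpow_neg hL0.le]; rfl
  rw [hLA]
  have b1 : ((Nat.log 2 ⌊x⌋₊ : ℝ) + 1) ^ 2 * (45 * ((Nat.log 2 Q : ℝ) + 1) *
      (Q + √(2 * Y) + √(2 * x / Z) + √(2 * x) / R)) * √x ≤ 9 * 135 * 8 * (x * L ^ (-A)) := by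
    calc _ ≤ (3 * L) ^ 2 * (45 * (3 * L) * (√x * w + 2 * (√x * w) + 2 * (√x * w) +
            3 * (√x * w))) * √x := by gcongr
      _ = 9 * 135 * 8 * ((√x * √x) * (L ^ 3 * w)) := by ring
      _ = _ := by rw [hsx, hLw]
  have b2 : 180 * ((Nat.log 2 Q : ℝ) + 1) * √x * √(x / Z) ≤ 540 * (x * L ^ (-A)) := by
    calc _ ≤ 180 * (3 * L) * √x * (√x * w) := by gcongr
      _ = 540 * ((√x * √x) * (L * w)) := by ring
      _ ≤ _ := by rw [hsx]; gcongr
  have b3 : 180 * ((Nat.log 2 Q : ℝ) + 1) * √x * √(x * ((2 * T / L) ^ (2 * J) + Real.exp (-T) +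
      Real.exp (-κ * T) * (Z : ℝ) ^ 2)) ≤ 1080 * (x * L ^ (-A)) := by
    calc _ ≤ 180 * (3 * L) * √x * (2 * (√x * √v)) := by gcongr
      _ = 1080 * ((√x * √x) * (L * √v)) := by ring
      _ = _ := by rw [hsx, hLv]
  calc _ ≤ (J : ℝ) * (2 ^ J * (9 * 135 * 8 * (x * L ^ (-A))) + 540 * (x * L ^ (-A))) +
        1080 * (x * L ^ (-A)) := by gcongr
    _ = _ := by ring

lemma sum_prime_Ioc_eq (R Y : ℕ) (hRY : R ≤ Y) :
    ∑ p ∈ Ioc R Y with p.Prime, 1 / ((p : ℝ) - 1) =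
      ∑ p ∈ Icc 1 Y with p.Prime, 1 / ((p : ℝ) - 1) -
        ∑ p ∈ Icc 1 R with p.Prime, 1 / ((p : ℝ) - 1) := by
  rw [eq_sub_iff_add_eq, ← sum_union]
  · congr 1
    rw [← filter_union]
    ext p
    simp only [mem_filter, mem_union, mem_Ioc, mem_Icc, and_congr_left_iff]
    intro hp
    have := hp.pos
    omega
  · refine disjoint_left.mpr fun p h1 h2 => ?_
    rw [mem_filter, mem_Ioc] at h1
    rw [mem_filter, mem_Icc] at h2
    omega

/-- The upper end of the window plus one exceeds `x^(1/4)`, so the primes up to it contribute at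
least `log log x - log 4`; those up to `R`, a power of `log x`, contribute only `O(log log log x)`.
-/
lemma eventually_half_log_log_le_sum_prime (B : ℝ) (hB : 1 ≤ B) :
    ∀ᶠ x : ℝ in atTop, Real.log (Real.log x) / 2 ≤
      ∑ p ∈ Ioc ⌊Real.log x ^ B⌋₊ (⌊x ^ (1 / 2 : ℝ) / Real.log x ^ B⌋₊ / ⌊Real.log x ^ B⌋₊)
        with p.Prime, 1 / ((p : ℝ) - 1) := by
  filter_upwards [eventually_ge_atTop 1, Real.tendsto_log_atTop.eventually_ge_atTop 8,
    (Real.tendsto_log_atTop.comp Real.tendsto_log_atTop).eventually_ge_atTop 1,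
    eventually_log_rpow_le (2 * B) (δ := 1 / 8) (by norm_num),
    eventually_log_log_le B (by linarith)] with x hx1 hL8 hl1 hpow hll
  simp only [Function.comp_apply] at hl1
  set L := Real.log x with hL
  set l := Real.log L with hl
  have hx0 : 0 < x := by linarith
  have hL0 : 0 < L := by linarith
  have hL1 : 1 ≤ L := by linarith
  have hLB1 : 1 ≤ L ^ B := Real.one_le_rpow hL1 (by linarith)
  set R : ℕ := ⌊L ^ B⌋₊ with hR
  set Q : ℕ := ⌊x ^ (1 / 2 : ℝ) / L ^ B⌋₊ with hQ
  set Y := Q / R with hY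
  have hRpos : 0 < R := Nat.floor_pos.mpr hLB1
  have hR0 : (0 : ℝ) < R := by exact_mod_cast hRpos
  have hRle : (R : ℝ) ≤ L ^ B := Nat.floor_le (by positivity)
  have hLBB : L ^ B * L ^ B = L ^ (2 * B) := by rw [← Real.rpow_add hL0]; ring_nf
  have hx4 : 1 ≤ x ^ (1 / 4 : ℝ) := Real.one_le_rpow hx1 (by norm_num)
  have hY1 : x ^ (1 / 4 : ℝ) < (Y : ℝ) + 1 := by
    have h1 : x ^ (1 / 2 : ℝ) / L ^ B < R * ((Y : ℝ) + 1) := by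
      have h2 := Nat.lt_floor_add_one (x ^ (1 / 2 : ℝ) / L ^ B)
      have h3 : Q + 1 ≤ R * (Y + 1) := Nat.lt_mul_div_succ Q hRpos
      have h4 : (Q : ℝ) + 1 ≤ R * ((Y : ℝ) + 1) := by exact_mod_cast h3
      linarith
    rw [div_lt_iff₀ (by positivity)] at h1
    have h5 : x ^ (1 / 2 : ℝ) = x ^ (1 / 4 : ℝ) * x ^ (1 / 4 : ℝ) := by
      rw [← Real.rpow_add hx0]; norm_num
    have h6 : x ^ (1 / 8 : ℝ) ≤ x ^ (1 / 4 : ℝ) :=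
      Real.rpow_le_rpow_of_exponent_le hx1 (by norm_num)
    have h7 : R * ((Y : ℝ) + 1) * L ^ B ≤ x ^ (1 / 4 : ℝ) * ((Y : ℝ) + 1) := by
      calc R * ((Y : ℝ) + 1) * L ^ B ≤ L ^ B * ((Y : ℝ) + 1) * L ^ B := by gcongr
        _ = L ^ (2 * B) * ((Y : ℝ) + 1) := by rw [← hLBB]; ring
        _ ≤ x ^ (1 / 8 : ℝ) * ((Y : ℝ) + 1) := by gcongr
        _ ≤ _ := by gcongr
    rw [h5] at h1
    exact lt_of_mul_lt_mul_left (h1.trans_le h7) (by positivity)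
  have hRY : R ≤ Y := by
    have h1 : (R : ℝ) ≤ x ^ (1 / 4 : ℝ) := by
      calc (R : ℝ) ≤ L ^ B := hRle
        _ ≤ L ^ (2 * B) := Real.rpow_le_rpow_of_exponent_le hL1 (by linarith)
        _ ≤ x ^ (1 / 8 : ℝ) := hpow
        _ ≤ _ := Real.rpow_le_rpow_of_exponent_le hx1 (by norm_num)
    have h2 : (R : ℝ) < Y + 1 := h1.trans_lt hY1
    exact Nat.lt_succ_iff.mp (by exact_mod_cast h2)
  rw [sum_prime_Ioc_eq R Y hRY]
  have h1 := log_log_le_sum_prime Y (hRpos.trans_le hRY)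
  have h2 := sum_prime_le R hRpos
  have h3 : Real.log R ≤ B * l := by
    rw [hl, ← Real.log_rpow hL0]
    exact Real.log_le_log hR0 hRle
  have hlR : 0 ≤ Real.log R := Real.log_natCast_nonneg R
  have h4 : Real.log (1 + 2 * Real.log R) ≤ Real.log (1 + 2 * (B * l)) := by
    apply Real.log_le_log (by linarith)
    linarith
  have h5 : l - Real.log 4 ≤ Real.log (Real.log (Y + 1)) := by
    rw [hl, ← Real.log_div hL0.ne' (by norm_num)]
    apply Real.log_le_log (by positivity)
    have := Real.log_le_log (by positivity) hY1.le
    rw [Real.log_rpow hx0, ← hL] at this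
    linarith
  linarith

lemma eventually_bvSum_le (A B γ : ℝ) (hA : 0 ≤ A) (hB : A + 3 ≤ B) (hγ : 2 * A + 6 ≤ γ)
    (C₁ C₂ : ℝ) (hC₁ : 0 ≤ C₁) (hC₂ : 0 ≤ C₂) :
    ∃ K : ℝ, 0 ≤ K ∧ ∀ᶠ x : ℝ in atTop, ∀ f : ArithmeticFunction ℂ, ClassC f →
      (∀ X : ℝ, x / Real.log x ^ γ ≤ X → X ≤ x →
        bvSum (onPrimes f) X (x ^ (1 / 2 : ℝ) / Real.log x ^ B) ≤
          C₁ * (X / (Real.log x ^ A * Real.log (x / (x / Real.log x ^ γ))))) →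
      (∀ X : ℝ, x ^ (1 / 2 : ℝ) ≤ X → X ≤ x → ∀ q : ℕ, 1 ≤ q → ∀ a : (ZMod q)ˣ,
        ‖Delta f X q a‖ ≤ C₂ * (X / Real.log x ^ (A + 2 * B))) →
      bvSum f x (x ^ (1 / 2 : ℝ) / Real.log x ^ B) ≤ K * (x / Real.log x ^ (A - 1)) := by
  obtain ⟨C, hC, htot⟩ := exists_sum_one_div_totient_le
  obtain ⟨C', hC', hcop⟩ := exists_norm_Delta_coprimePart_le
  obtain ⟨Kp, hKp, hprim⟩ := exists_primMean_smooth_le A B γ hA hB hγ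
  refine ⟨C * C * (1 + B) * (2 * C₂ + C') + C * Kp + 4 * C₁ + 8 * C * C * (1 + B) * C₁,
    by have : 0 ≤ 1 + B := by linarith
       positivity, ?_⟩
  filter_upwards [eventually_gt_atTop 1, Real.tendsto_log_atTop.eventually_ge_atTop 8,
    (Real.tendsto_log_atTop.comp Real.tendsto_log_atTop).eventually_ge_atTop 1,
    eventually_log_rpow_le (1 + A + B + γ) (δ := 1 / 8) (by norm_num),
    eventually_half_log_log_le_sum_prime B (by linarith), hprim]
    with x hx1 hL8 hl1 hpow hρ hprim f hf hyp1 hyp2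
  simp only [Function.comp_apply] at hl1
  set L := Real.log x with hL
  set l := Real.log L with hl
  have hx0 : 0 < x := by linarith
  have hL0 : 0 < L := by linarith
  have hL1 : 1 ≤ L := by linarith
  have hl0 : 0 < l := by linarith
  have hB1 : 0 ≤ 1 + B := by linarith
  have hγ0 : 0 < γ := by linarith
  have hlL : l ≤ L := (Real.log_le_sub_one_of_pos hL0).trans (by linarith)
  have hLB1 : 1 ≤ L ^ B := Real.one_le_rpow hL1 (by linarith)
  set Q := x ^ (1 / 2 : ℝ) / L ^ B with hQ
  set y := x / L ^ γ with hy
  have hy0 : 0 < y := by positivity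
  set R : ℕ := ⌊L ^ B⌋₊ with hR
  have hRpos : 0 < R := Nat.floor_pos.mpr hLB1
  have hRle : (R : ℝ) ≤ L ^ B := Nat.floor_le (by positivity)
  have hxpow : ∀ {s t : ℝ}, s ≤ t → x ^ s ≤ x ^ t :=
    fun h => Real.rpow_le_rpow_of_exponent_le hx1.le h
  have hLpow : ∀ {s t : ℝ}, s ≤ t → L ^ s ≤ L ^ t :=
    fun h => Real.rpow_le_rpow_of_exponent_le hL1 h
  have hLγ : L ^ γ ≤ x ^ (1 / 8 : ℝ) := (hLpow (by linarith)).trans hpow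
  have hLγ1 : 1 ≤ L ^ γ := Real.one_le_rpow hL1 (by linarith)
  have hyx : y ≤ x := div_le_self hx0.le hLγ1
  have hy34 : x ^ (3 / 4 : ℝ) ≤ y := by
    rw [hy, le_div_iff₀ (by positivity)]
    calc x ^ (3 / 4 : ℝ) * L ^ γ ≤ x ^ (3 / 4 : ℝ) * x ^ (1 / 8 : ℝ) := by gcongr
      _ = x ^ (7 / 8 : ℝ) := by rw [← Real.rpow_add hx0]; norm_num
      _ ≤ x ^ (1 : ℝ) := hxpow (by norm_num)
      _ = x := Real.rpow_one x
  have hy1 : 1 ≤ y := (Real.one_le_rpow hx1.le (by norm_num)).trans hy34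
  have hQx : Q ≤ x ^ (1 / 2 : ℝ) := div_le_self (by positivity) hLB1
  have hQ0 : 0 ≤ Q := by positivity
  have hQnx : (⌊Q⌋₊ : ℝ) ≤ x ^ (1 / 2 : ℝ) := (Nat.floor_le hQ0).trans hQx
  have hxy : x < (⌊y⌋₊ + 1 : ℝ) * (⌊y⌋₊ + 1) := by
    have h1 := Nat.lt_floor_add_one y
    calc x = x ^ (1 / 2 : ℝ) * x ^ (1 / 2 : ℝ) := by rw [← Real.rpow_add hx0]; norm_num
      _ ≤ x ^ (3 / 4 : ℝ) * x ^ (3 / 4 : ℝ) :=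
          mul_le_mul (hxpow (by norm_num)) (hxpow (by norm_num)) (by positivity) (by positivity)
      _ ≤ y * y := by gcongr
      _ < _ := by gcongr
  have hQy : ⌊Q⌋₊ ≤ ⌊y⌋₊ := Nat.floor_le_floor (hQx.trans ((hxpow (by norm_num)).trans hy34))
  have hxy' : x / y = L ^ γ := by rw [hy]; field_simp
  have hlogxy : Real.log (x / y) = γ * l := by rw [hxy', Real.log_rpow hL0]
  set V := x / L ^ A with hV
  have hV0 : 0 < V := by positivity
  have hU : x / L ^ (A - 1) = L * V := by
    rw [hV, Real.rpow_sub_one hL0.ne']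
    field_simp
  -- the moduli of size up to `Q` and `R`
  have hΦQ : ∑ k ∈ Icc 1 ⌊Q⌋₊, 1 / (k.totient : ℝ) ≤ C * L := by
    refine (htot _).trans ?_
    gcongr
    have : Real.log ⌊Q⌋₊ ≤ L / 2 := by
      rcases Nat.eq_zero_or_pos ⌊Q⌋₊ with h | h
      · rw [h, Nat.cast_zero, Real.log_zero]; linarith
      · have := Real.log_le_log (by exact_mod_cast h) hQnx
        rw [Real.log_rpow hx0, ← hL] at this
        linarith
    linarith
  have hΦR : ∑ k ∈ Icc 1 R, 1 / (k.totient : ℝ) ≤ C * ((1 + B) * l) := by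
    refine (htot _).trans ?_
    gcongr
    have := Real.log_le_log (by exact_mod_cast hRpos) hRle
    rw [Real.log_rpow hL0, ← hl] at this
    linarith
  -- the discrepancy on the primes
  set ε := C₁ / (L ^ A * (γ * l)) with hε
  have hε0 : 0 ≤ ε := by positivity
  set D := 2 * ε * x * (1 + Real.log (x / y)) with hD
  have hDsum : ∑ q ∈ Icc 1 ⌊Q⌋₊, primeDiscrepancy f x y q ≤ D := by
    refine sum_primeDiscrepancy_le hy0 hyx hε0 fun X h1 h2 => ?_
    have h3 := hyp1 X h1 h2
    rw [bvSum_eq, hlogxy] at h3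
    refine h3.trans (le_of_eq ?_)
    rw [hε]
    ring
  -- The factor `1 + log(x/y)` from the sum over `m` cancels the `log(x/y) = γ l` in the hypothesis
  -- on primes.
  have hDle : D ≤ 4 * C₁ * V := by
    have h1 : 1 + γ * l ≤ 2 * (γ * l) := by nlinarith
    calc D ≤ 2 * ε * x * (2 * (γ * l)) := by rw [hD, hlogxy]; gcongr
      _ = _ := by
        rw [hε, hV]
        field_simp
        ring
  -- The gain `2/l` for small moduli comes from the primes between `R` and `Q/R`; it is consumed by
  -- the factor `l` in the totient sum up to `R` when `t4` is proved.
  have hDR : ∑ q ∈ Icc 1 R, primeDiscrepancy f x y q ≤ 2 * D / l := by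
    have h1 := sum_primeDiscrepancy_mul_sum_prime_le f x y (R := R) (Nat.mul_div_le ⌊Q⌋₊ R) hQy
    have h0 : 0 ≤ ∑ q ∈ Icc 1 R, primeDiscrepancy f x y q :=
      sum_nonneg fun d _ => sum_nonneg fun m _ => maxDelta_nonneg _ _ _
    have h2 := (mul_le_mul_of_nonneg_left hρ h0).trans (h1.trans hDsum)
    rw [le_div_iff₀ hl0]
    linarith
  -- the discrepancy of `f` for small moduli
  set η := C₂ / L ^ (A + 2 * B) with hη
  have hη0 : 0 ≤ η := by positivity
  have hh := hcop f hf x η hx1.le hη0 fun X h1 h2 d hd a => by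
    refine (hyp2 X h1 h2 d hd a).trans (le_of_eq ?_)
    rw [hη]
    ring
  set h := η * x * (1 + L) + C' * x ^ (7 / 8 : ℝ) with hhdef
  have hh0 : 0 ≤ h := by positivity
  have hRh : L * (L * (L ^ B * h)) ≤ (2 * C₂ + C') * (L * V) := by
    have e1 : L * (L * (L ^ B * (η * x * (1 + L)))) ≤ 2 * C₂ * (L * V) := by
      have e2 : L ^ (A + 2 * B) = L ^ A * L ^ B * L ^ B := by
        rw [← Real.rpow_add hL0, ← Real.rpow_add hL0]; ring_nf
      -- Of the `L^(-2B)` in the pointwise hypothesis, one `L^(-B)` cancels the number of moduli up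
      -- to `R`; the other absorbs the `L²` by which the totient sums and `1 + L` exceed the target.
      have e3 : L ^ 2 ≤ L ^ B := by
        rw [← Real.rpow_natCast]
        exact hLpow (by push_cast; linarith)
      calc L * (L * (L ^ B * (η * x * (1 + L)))) ≤ L * (L * (L ^ B * (η * x * (2 * L)))) := by
            gcongr
            linarith
        _ = 2 * C₂ * (L * V) * (L ^ 2 / L ^ B) := by
            rw [hη, e2, hV]
            field_simp
        _ ≤ 2 * C₂ * (L * V) * 1 := by
            gcongr
            exact div_le_one_of_le₀ e3 (by positivity)
        _ = _ := mul_one _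
    have e4 : L * (L * (L ^ B * (C' * x ^ (7 / 8 : ℝ)))) ≤ C' * (L * V) := by
      have e5 : L * L ^ B * L ^ A ≤ x ^ (1 / 8 : ℝ) := by
        refine le_trans (le_of_eq ?_) ((hLpow (by linarith : 1 + B + A ≤ 1 + A + B + γ)).trans hpow)
        rw [Real.rpow_add hL0, Real.rpow_add hL0, Real.rpow_one]
      have e6 : L * L ^ B * x ^ (7 / 8 : ℝ) ≤ V := by
        rw [hV, le_div_iff₀ (by positivity)]
        calc L * L ^ B * x ^ (7 / 8 : ℝ) * L ^ A = x ^ (7 / 8 : ℝ) * (L * L ^ B * L ^ A) := by ring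
          _ ≤ x ^ (7 / 8 : ℝ) * x ^ (1 / 8 : ℝ) := by gcongr
          _ = x := by rw [← Real.rpow_add hx0]; norm_num
      calc L * (L * (L ^ B * (C' * x ^ (7 / 8 : ℝ)))) = C' * (L * (L * L ^ B * x ^ (7 / 8 : ℝ))) := by
            ring
        _ ≤ _ := by gcongr
    rw [hhdef]
    linarith
  have main := bvSum_le_of_parts hf hRpos hx0.le hxy hy1 hQy hh0
    (fun q hq d hd b => hh q (by have := (mem_Icc.mp hq).1; omega)
      ((Nat.cast_le.mpr (mem_Icc.mp hq).2).trans hQnx) d hd b)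
    (fun k => hprim f hf k) hΦQ hΦR hDsum hDR
  refine main.trans ?_
  rw [hU]
  have t1 : C * L * (C * ((1 + B) * l) * (R * h)) ≤ C * C * (1 + B) * (2 * C₂ + C') * (L * V) := by
    calc C * L * (C * ((1 + B) * l) * (R * h)) ≤ C * L * (C * ((1 + B) * L) * (L ^ B * h)) := by
          gcongr
      _ = C * C * (1 + B) * (L * (L * (L ^ B * h))) := by ring
      _ ≤ C * C * (1 + B) * ((2 * C₂ + C') * (L * V)) := by gcongr
      _ = _ := by ring
  have t2 : C * L * (Kp * V) = C * Kp * (L * V) := by ring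
  have t3 : D ≤ 4 * C₁ * (L * V) := by
    refine hDle.trans ?_
    gcongr
    exact le_mul_of_one_le_left hV0.le hL1
  have t4 : C * L * (C * ((1 + B) * l) * (2 * D / l)) ≤ 8 * C * C * (1 + B) * C₁ * (L * V) := by
    calc C * L * (C * ((1 + B) * l) * (2 * D / l)) = 2 * C * C * (1 + B) * L * D := by field_simp
      _ ≤ 2 * C * C * (1 + B) * L * (4 * C₁ * V) := by gcongr
      _ = _ := by ring
  linarith

/-- For `x` in a bounded range the trivial bound `2x` per modulus suffices; the constant merely
bounds the number of moduli and the power of `log x`. -/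
lemma bvSum_le_of_le {f : ℕ → ℂ} (hf : ∀ n, ‖f n‖ ≤ 1) {A B x x₀ : ℝ} (hA : 0 ≤ A) (hB : 0 ≤ B)
    (hx : 2 ≤ x) (hxx : x ≤ x₀) :
    bvSum f x (x ^ (1 / 2 : ℝ) / Real.log x ^ B) ≤
      2 * (x₀ ^ (1 / 2 : ℝ) / Real.log 2 ^ B) * (Real.log x₀ ^ A / Real.log 2) *
        (x / Real.log x ^ (A - 1)) := by
  have hx0 : 0 < x := by linarith
  have hl2 : 0 < Real.log 2 := Real.log_pos (by norm_num)
  have hL2 : Real.log 2 ≤ Real.log x := Real.log_le_log (by norm_num) hx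
  have hL0 : 0 < Real.log x := hl2.trans_le hL2
  have hLx : Real.log x ≤ Real.log x₀ := Real.log_le_log hx0 hxx
  set Q := x ^ (1 / 2 : ℝ) / Real.log x ^ B with hQ
  have h1 : bvSum f x Q ≤ Q * (2 * x) := by
    rw [bvSum_eq]
    calc _ ≤ ∑ q ∈ Icc 1 ⌊Q⌋₊, 2 * x :=
          sum_le_sum fun q _ => maxDelta_le fun a => norm_Delta_le hf hx0.le q a
      _ = ⌊Q⌋₊ * (2 * x) := by rw [sum_const, Nat.card_Icc, Nat.add_sub_cancel, nsmul_eq_mul]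
      _ ≤ _ := by
        gcongr
        exact Nat.floor_le (by positivity)
  have h5 : 0 ≤ x₀ ^ (1 / 2 : ℝ) := Real.rpow_nonneg (by linarith) _
  have h2 : Q ≤ x₀ ^ (1 / 2 : ℝ) / Real.log 2 ^ B := by
    rw [hQ]
    gcongr
  have h3 : 1 ≤ Real.log x₀ ^ A / Real.log 2 * (1 / Real.log x ^ (A - 1)) := by
    rw [Real.rpow_sub_one hL0.ne', div_mul_div_comm, mul_one, le_div_iff₀ (by positivity), one_mul]
    have : Real.log x ^ A ≤ Real.log x₀ ^ A := by gcongr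
    have h4 : Real.log 2 * (Real.log x ^ A / Real.log x) =
        Real.log x ^ A * (Real.log 2 / Real.log x) := by ring
    rw [h4]
    exact (mul_le_of_le_one_right (by positivity) (div_le_one_of_le₀ hL2 hL0.le)).trans this
  calc _ ≤ Q * (2 * x) := h1
    _ ≤ x₀ ^ (1 / 2 : ℝ) / Real.log 2 ^ B * (2 * x) * 1 := by rw [mul_one]; gcongr
    _ ≤ x₀ ^ (1 / 2 : ℝ) / Real.log 2 ^ B * (2 * x) *
        (Real.log x₀ ^ A / Real.log 2 * (1 / Real.log x ^ (A - 1))) := by gcongr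
    _ = _ := by ring

end BVMult

end

theorem theorem2p1 (A B γ : ℝ) (hA : 0 ≤ A) (hB : A + 5 < B) (hγ : 2 * A + 6 < γ)
    (C₁ C₂ : ℝ) :
    ∃ K : ℝ, ∀ (x : ℝ), 2 ≤ x → ∀ Q y : ℝ,
      Q = x ^ (1 / 2 : ℝ) / Real.log x ^ B →
      y = x / Real.log x ^ γ →
      ∀ f : ArithmeticFunction ℂ, BVMult.ClassC f →
        (∀ X : ℝ, y ≤ X → X ≤ x →
          BVMult.bvSum (BVMult.onPrimes f) X Q ≤
            C₁ * (X / (Real.log x ^ A * Real.log (x / y)))) →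
        (∀ X : ℝ, x ^ (1 / 2 : ℝ) ≤ X → X ≤ x →
          ∀ q : ℕ, 1 ≤ q → ∀ a : (ZMod q)ˣ,
            ‖BVMult.Delta f X q a‖ ≤ C₂ * (X / Real.log x ^ (A + 2 * B))) →
        BVMult.bvSum f x Q ≤ K * (x / Real.log x ^ (A - 1)) := by
  -- Absolute values, because the asymptotic statement requires nonnegative constants whereas `C₁`
  -- and `C₂` are arbitrary reals.
  obtain ⟨K, hK, hev⟩ := BVMult.eventually_bvSum_le A B γ hA (by linarith) hγ.le |C₁| |C₂|
    (abs_nonneg _) (abs_nonneg _)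
  obtain ⟨x₁, hx₁⟩ := Filter.eventually_atTop.mp hev
  -- Beyond this threshold `log x ≥ 1`, so `log(x/y) = γ log log x` is nonnegative and replacing
  -- `C₁` by `|C₁|` weakens the hypothesis. Below it the trivial bound is used.
  set x₀ := max x₁ (Real.exp (Real.exp 1)) with hx₀
  have hx₀1 : 1 ≤ x₀ := (Real.one_le_exp (Real.exp_pos 1).le).trans (le_max_right _ _)
  have hlog0 : 0 ≤ Real.log x₀ := Real.log_nonneg hx₀1
  have hl2 : 0 < Real.log 2 := Real.log_pos (by norm_num)
  set K' := 2 * (x₀ ^ (1 / 2 : ℝ) / Real.log 2 ^ B) * (Real.log x₀ ^ A / Real.log 2) with hK'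
  have hK'0 : 0 ≤ K' := by positivity
  refine ⟨K + K', ?_⟩
  rintro x hx Q y rfl rfl f hf h1 h2
  have hL0 : 0 < Real.log x := Real.log_pos (by linarith)
  have hU : 0 ≤ x / Real.log x ^ (A - 1) := div_nonneg (by linarith) (by positivity)
  rcases le_total x x₀ with h | h
  · refine (BVMult.bvSum_le_of_le (fun n => hf.norm_le_one n) hA (by linarith) hx h).trans ?_
    exact mul_le_mul_of_nonneg_right (by linarith) hU
  · have hx0 : 0 < x := by linarith
    have hl1 : 1 ≤ Real.log x := by
      have h3 : Real.exp (Real.exp 1) ≤ x := (le_max_right _ _).trans h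
      have h4 := Real.log_le_log (Real.exp_pos _) h3
      rw [Real.log_exp] at h4
      exact (Real.one_le_exp zero_le_one).trans h4
    have hquot : x / (x / Real.log x ^ γ) = Real.log x ^ γ := by field_simp
    have hlog : 0 ≤ Real.log (x / (x / Real.log x ^ γ)) := by
      rw [hquot]
      exact Real.log_nonneg (Real.one_le_rpow hl1 (by linarith))
    refine (hx₁ x ((le_max_left _ _).trans h) f hf (fun X h3 h4 => ?_)
      fun X h3 h4 q hq a => ?_).trans (mul_le_mul_of_nonneg_right (by linarith) hU)
    · have hX : 0 ≤ X := le_trans (by positivity) h3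
      refine (h1 X h3 h4).trans (mul_le_mul_of_nonneg_right (le_abs_self _) ?_)
      exact div_nonneg hX (mul_nonneg (by positivity) hlog)
    · have hX : 0 ≤ X := le_trans (by positivity) h3
      exact (h2 X h3 h4 q hq a).trans
        (mul_le_mul_of_nonneg_right (le_abs_self _) (by positivity))
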